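/- Let $P$ be a smooth $n$-dimensional manifold (Hausdorff, second countable) with a Poisson bivector field $\pi$, and let $\mu$ be a volume form on $P$ (so $P$ is orientable). Write $K_P=\wedge^nT^*P$, and for $N\in\mathbb Z$ let $K_P^N$ be its $N$-th tensor power, with $K_P^N=(K_P^{-N})^*$ for $N<0$. For $\alpha\in\Omega^1(P)$ let $\tilde\pi(\alpha)$ be the vector field with $\beta(\tilde\pi(\alpha))=\pi(\alpha,\beta)$. The cotangent bundle is a Lie algebroid with anchor $\tilde\pi$ and bracket $$\{\alpha,\beta\}_\pi=d(\pi(\alpha,\beta))+\iota_{\tilde\pi(\alpha)}d\beta-\iota_{\tilde\pi(\beta)}d\alpha ,$$ and it is represented on $K_P$ by $D_\alpha\nu=L_{\tilde\pi(\alpha)}\nu+(\pi,d\alpha)\,\nu$, hence on every $K_P^N$ (by the Leibniz rule on tensor powers and by duality). Let $C^k_{P,N}=\Gamma(\mathrm{Hom}(\wedge^kT^*P,K_P^N))$, with the Lie algebroid differential $$(d_N\varphi)(\alpha_1,\dots,\alpha_{k+1})=\sum_{j}(-1)^{j+1}D_{\alpha_j}\varphi(\dots,\hat\alpha_j,\dots)+\sum_{i<j}(-1)^{i+j}\varphi(\{\alpha_i,\alpha_j\}_\pi,\dots,\hat\alpha_i,\dots,\hat\alpha_j,\dots),$$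 and let $H^\bullet(P,\pi;K_P^N)$ be its cohomology. Let $\mathcal V^k(P)$ be the space of $k$-vector fields, with $\mathcal V^{-1}(P)=0$. Then: 1. There is a unique vector field $\theta_\mu$ (the modular vector field) with $D_\alpha\mu=\alpha(\theta_\mu)\,\mu$ for all $\alpha\in\Omega^1(P)$, and there are unique linear operators $b_\mu:\mathcal V^k(P)\to\mathcal V^{k-1}(P)$ with $\iota_{b_\mu V}\mu=(-1)^k d(\iota_V\mu)$, where $\iota_{X_1\wedge\dots\wedge X_k}\mu=\mu(X_1,\dots,X_k,\cdot)$. For every $N$ the operator $d_N$ is well defined by the formula above. 2. For every integer $N$ the Lie derivative $L_{\theta_\mu}$ on $C^\bullet_{P,N}$ commutes with $d_N$, so it acts on $H^\bullet(P,\pi;K_P^N)$. If $N\ne1$, this action is zero in every degree. 3. For every integer $N$ the map $V\mapsto V\otimes\mu^N$ is an isomorphism $\mathcal V^k(P)\to C^k_{P,N}$ for every $k\ge0$. If $\delta_N:\mathcal V^k(P)\to\mathcal V^{k+1}(P)$ denotes the operator corresponding to $d_N$ under these isomorphisms, then on $\mathcal V^k(P)$ for every $k\ge0$ $$b_\mu\delta_N+\delta_Nb_\mu=(1-N)\,L_{\theta_\mu}.$$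 -/

import Mathlib

open scoped Manifold ContDiff TensorProduct

noncomputable section

namespace PoissonCohomology

/-! ### Algebra over a commutative real algebra `A` (later `A = C^∞(P)`) -/

section Auxiliary

variable {A : Type*} [CommRing A]
variable {M : Type*} [AddCommGroup M] [Module A M]
variable {L : Type*} [AddCommGroup L] [Module A L]

theorem alt_aux {k : ℕ} (c : L [⋀^Fin k]→ₗ[A] M) (s : L → L) (v : Fin k → L) (i : Fin k) (z : L) :
    ∑ j, c (Function.update (Function.update v i z) j (s (Function.update v i z j))) =
      c (Function.update v i (s z)) +
        ∑ j ∈ Finset.univ.erase i, c (Function.update (Function.update v j (s (v j))) i z) := by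
  rw [← Finset.add_sum_erase _ _ (Finset.mem_univ i)]
  congr 1
  · simp
  · refine Finset.sum_congr rfl fun j hj => ?_
    have hj := Finset.ne_of_mem_erase hj
    rw [Function.update_of_ne hj, Function.update_comm hj]

theorem alt_aux_zero {k : ℕ} (c : L [⋀^Fin k]→ₗ[A] M) (s : L → L) (v : Fin k → L) (i j : Fin k)
    (hv : v i = v j) (hij : i ≠ j) :
    ∑ l, c (Function.update v l (s (v l))) = 0 := by
  rw [Fintype.sum_eq_add i j hij]
  · have : Function.update v j (s (v j)) = Function.update v i (s (v i)) ∘ Equiv.swap i j := by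
      funext l
      by_cases h1 : l = i
      · subst h1; simp [Function.update_of_ne hij, Function.update_of_ne hij.symm, hv]
      · by_cases h2 : l = j
        · subst h2; simp [hv]
        · simp [Equiv.swap_apply_of_ne_of_ne h1 h2, h1, h2]
    rw [this, c.map_swap _ hij, add_neg_cancel]
  · rintro l ⟨h1, h2⟩
    exact c.map_eq_zero_of_eq _ (i := i) (j := j)
      (by rw [Function.update_of_ne h1.symm, Function.update_of_ne h2.symm, hv]) hij

theorem tpow_aux {m : ℕ} (s : M → M) (v : Fin m → M) (i : Fin m) (z : M) :
    ∑ j, PiTensorProduct.tprod A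
        (Function.update (Function.update v i z) j (s (Function.update v i z j))) =
      PiTensorProduct.tprod A (Function.update v i (s z)) +
        ∑ j ∈ Finset.univ.erase i,
          PiTensorProduct.tprod A (Function.update (Function.update v j (s (v j))) i z) := by
  rw [← Finset.add_sum_erase _ _ (Finset.mem_univ i)]
  congr 1
  · simp
  · refine Finset.sum_congr rfl fun j hj => ?_
    have hj := Finset.ne_of_mem_erase hj
    rw [Function.update_of_ne hj, Function.update_comm hj]

end Auxiliary

section Algebra

variable {A : Type*} [CommRing A] [Algebra ℝ A]

/-- A derivation of the module of sections `M` over the vector field (derivation) `X`: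
an `ℝ`-linear operator `T` with `T (f m) = f T m + X(f) m`. -/
structure DerOver (X : Derivation ℝ A A) (M : Type*) [AddCommGroup M] [Module A M] [Module ℝ M]
    extends M →ₗ[ℝ] M where
  leibniz : ∀ (f : A) (m : M), toFun (f • m) = f • toFun m + X f • m

namespace DerOver

variable {X : Derivation ℝ A A}
variable {M : Type*} [AddCommGroup M] [Module A M] [Module ℝ M]
variable {L : Type*} [AddCommGroup L] [Module A L] [Module ℝ L]

/-- A derivation over `X`, applied to a section. -/
def op (T : DerOver X M) : M →ₗ[ℝ] M := T.toLinearMap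

theorem op_smul (T : DerOver X M) (f : A) (m : M) : T.op (f • m) = f • T.op m + X f • m :=
  T.leibniz f m

variable [IsScalarTower ℝ A M] [IsScalarTower ℝ A L]

variable (X) in
/-- The vector field `X` acting on functions. -/
def base : DerOver X A where
  toLinearMap := (X : A →ₗ[ℝ] A)
  leibniz f m := by simp [mul_comm]

variable (X) in
/-- The vector field `X` acting on vector fields by `Y ↦ [X, Y]`. -/
def lie : DerOver X (Derivation ℝ A A) where
  toFun Y := ⁅X, Y⁆
  map_add' := lie_add X
  map_smul' c Y := by simp
  leibniz f Y := by
    ext g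
    simp [Derivation.commutator_apply]

/-- The induced derivation on homomorphisms, `(T φ)(l) = T (φ l) - φ (T l)`. -/
def hom (S : DerOver X L) (T : DerOver X M) : DerOver X (L →ₗ[A] M) where
  toFun φ :=
    { toFun := fun l => T.op (φ l) - φ (S.op l)
      map_add' := fun a b => by simp; abel
      map_smul' := fun f a => by simp [op_smul, smul_sub] }
  map_add' φ ψ := by ext l; simp; abel
  map_smul' c φ := by ext l; simp [smul_sub]
  leibniz f φ := by ext l; simp [op_smul, smul_sub]; abel

/-- The induced derivation on alternating maps,
`(T c)(v₁, …, v_k) = T (c(v₁, …, v_k)) - ∑ i, c(v₁, …, T vᵢ, …, v_k)`. -/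
def alt (S : DerOver X L) (T : DerOver X M) (k : ℕ) : DerOver X (L [⋀^Fin k]→ₗ[A] M) where
  toFun c :=
    { toFun := fun v => T.op (c v) - ∑ i, c (Function.update v i (S.op (v i)))
      map_update_add' := fun {inst} v i x y => by
        rw [Subsingleton.elim inst (instDecidableEqFin k)]
        simp only [alt_aux, map_add, AlternatingMap.map_update_add, Finset.sum_add_distrib]
        abel
      map_update_smul' := fun {inst} v i f x => by
        rw [Subsingleton.elim inst (instDecidableEqFin k)]
        simp only [alt_aux, op_smul, AlternatingMap.map_update_add,
          AlternatingMap.map_update_smul, ← Finset.smul_sum, smul_sub, smul_add]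
        abel
      map_eq_zero_of_eq' := fun v i j hv hij => by
        simp only [alt_aux_zero c S.op v i j hv hij, c.map_eq_zero_of_eq v hv hij, map_zero,
          sub_zero] }
  map_add' c e := by ext v; simp [Finset.sum_add_distrib]; abel
  map_smul' r c := by ext v; simp [smul_sub, Finset.smul_sum]
  leibniz f c := by ext v; simp [op_smul, smul_sub, Finset.smul_sum]; abel

/-- The induced derivation on the tensor power `M^{⊗ m}` (Leibniz rule). -/
def tpow (T : DerOver X M) (m : ℕ) : DerOver X (⨂[A]^m M) :=
  let D : (⨂[A]^m M) →+ (⨂[A]^m M) := PiTensorProduct.liftAddHom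
    (fun p : A × (Fin m → M) => X p.1 • PiTensorProduct.tprod A p.2 +
      p.1 • ∑ i, PiTensorProduct.tprod A (Function.update p.2 i (T.op (p.2 i))))
    (fun r v i hv => by
      have h0 : PiTensorProduct.tprod A v = 0 := MultilinearMap.map_coord_zero _ i hv
      have hs : v = Function.update v i 0 := by rw [← hv]; simp
      have h1 : ∑ j, PiTensorProduct.tprod A (Function.update v j (T.op (v j))) = 0 := by
        rw [hs, tpow_aux]; simp
      simp [h0, h1])
    (fun v => by simp)
    (fun {inst} r v i x y => by
      rw [Subsingleton.elim inst (instDecidableEqFin m)]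
      simp only [tpow_aux, map_add, MultilinearMap.map_update_add, Finset.sum_add_distrib,
        smul_add]
      abel)
    (fun r s v => by simp only [map_add, add_smul]; abel)
    (fun {inst} r v i s => by
      rw [Subsingleton.elim inst (instDecidableEqFin m)]
      have hv := tpow_aux (A := A) T.op v i (v i)
      simp only [Function.update_eq_self] at hv
      simp only [tpow_aux, op_smul, MultilinearMap.map_update_add,
        MultilinearMap.map_update_smul, ← Finset.smul_sum, smul_add, hv,
        Function.update_eq_self, Derivation.leibniz, add_smul, smul_eq_mul, mul_smul]
      simp only [smul_comm s r, smul_comm s (X r)]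
      abel)
  have hφ : ∀ (r : A) (v : Fin m → M), D (r • PiTensorProduct.tprod A v) =
      X r • PiTensorProduct.tprod A v +
        r • ∑ i, PiTensorProduct.tprod A (Function.update v i (T.op (v i))) := fun r v => by
    rw [← PiTensorProduct.tprodCoeff_eq_smul_tprod]
    rfl
  have hD : ∀ (f : A) (t : ⨂[A]^m M), D (f • t) = f • D t + X f • t := fun f t => by
    induction t using PiTensorProduct.induction_on with
    | smul_tprod r v =>
      rw [smul_smul, hφ, hφ]
      simp only [Derivation.leibniz, smul_eq_mul, add_smul, smul_add, mul_smul,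
        smul_comm r (X f)]
      abel
    | add x y hx hy => rw [smul_add, map_add, map_add, hx, hy]; simp only [smul_add]; abel
  { toFun := D
    map_add' := map_add D
    map_smul' := fun c t => by
      have := hD (algebraMap ℝ A c) t
      simpa using this
    leibniz := hD }

end DerOver

/-- The `N`-th power of a module of sections `K` of a line bundle: the tensor power `K^{⊗ N}` for
`N ≥ 0`, and the dual of `K^{⊗ (-N)}` for `N < 0`. -/
def LinePow (A : Type*) [CommRing A] (K : Type*) [AddCommGroup K] [Module A K] : ℤ → Type _
  | Int.ofNat m => ⨂[A]^m K
  | Int.negSucc m => Module.Dual A (⨂[A]^(m + 1) K)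

namespace LinePow

variable {K : Type*} [AddCommGroup K] [Module A K]

instance instAddCommGroup : ∀ N, AddCommGroup (LinePow A K N)
  | Int.ofNat m => inferInstanceAs (AddCommGroup (⨂[A]^m K))
  | Int.negSucc m => inferInstanceAs (AddCommGroup (Module.Dual A (⨂[A]^(m + 1) K)))

instance instModule : ∀ N, Module A (LinePow A K N)
  | Int.ofNat m => inferInstanceAs (Module A (⨂[A]^m K))
  | Int.negSucc m => inferInstanceAs (Module A (Module.Dual A (⨂[A]^(m + 1) K)))

instance instModuleReal : ∀ N, Module ℝ (LinePow A K N)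
  | Int.ofNat m => inferInstanceAs (Module ℝ (⨂[A]^m K))
  | Int.negSucc m => inferInstanceAs (Module ℝ (Module.Dual A (⨂[A]^(m + 1) K)))

instance instTower : ∀ N, IsScalarTower ℝ A (LinePow A K N)
  | Int.ofNat m => inferInstanceAs (IsScalarTower ℝ A (⨂[A]^m K))
  | Int.negSucc m => inferInstanceAs (IsScalarTower ℝ A (Module.Dual A (⨂[A]^(m + 1) K)))

end LinePow

/-- The powers of a derivation of `K`: the Leibniz rule on tensor powers, and the dual derivation
`(T φ)(t) = X (φ t) - φ (T t)` on their duals. -/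
def DerOver.linePow {X : Derivation ℝ A A} {K : Type*} [AddCommGroup K] [Module A K] [Module ℝ K]
    [IsScalarTower ℝ A K] (T : DerOver X K) : ∀ N : ℤ, DerOver X (LinePow A K N)
  | Int.ofNat m => T.tpow m
  | Int.negSucc m => (T.tpow (m + 1)).hom (DerOver.base X)

/-- The right-hand side of the Chevalley-Eilenberg formula
`∑ i, (-1)^i D_{v i} c(v 0, …, omit v i, …, v k)
  + ∑_{i < j} (-1)^(i + j) c([v i, v j], v 0, …, omit v i, …, omit v j, …, v k)`.
In the second sum the pair `(i, j)` with `i ≤ j` stands for the indices `(i.castSucc, j.succ)`,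
that is for the pair `i < j + 1`; this shift accounts for the minus sign. -/
def ceFormula {L M : Type*} [AddCommGroup M] (br : L → L → L) (D : L → M → M) :
    (k : ℕ) → ((Fin k → L) → M) → (Fin (k + 1) → L) → M
  | 0, c, v => D (v 0) (c (Fin.removeNth 0 v))
  | k + 1, c, v =>
    ∑ i : Fin (k + 2), (-1 : ℤ) ^ (i : ℕ) • D (v i) (c (i.removeNth v)) -
      ∑ i : Fin (k + 1), ∑ j ≥ i, (-1 : ℤ) ^ (i + j : ℕ) •
        c (Matrix.vecCons (br (v i.castSucc) (v j.succ)) (j.removeNth (i.castSucc.removeNth v)))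

variable (A) in
/-- Vector fields, as derivations of the algebra of functions. -/
abbrev Vect := Derivation ℝ A A

variable (A) in
/-- Differential `k`-forms, as `A`-multilinear alternating functions of `k` vector fields. -/
abbrev Form (k : ℕ) := Vect A [⋀^Fin k]→ₗ[A] A

variable (A) in
/-- One-forms, as `A`-linear functions of a vector field. -/
abbrev OneForm := Module.Dual A (Vect A)

variable (A) in
/-- `k`-vector fields (sections of `∧^k T`, the dual bundle of `∧^k T^*`), as `A`-linear functions
of a `k`-form. -/
abbrev MultiVect (k : ℕ) := Form A k →ₗ[A] A

def toReal {k : ℕ} (c : Form A k) : Vect A [⋀^Fin k]→ₗ[ℝ] A where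
  toMultilinearMap := c.toMultilinearMap.restrictScalars ℝ
  map_eq_zero_of_eq' := c.map_eq_zero_of_eq'

theorem toReal_apply {k : ℕ} (c : Form A k) (v : Fin k → Vect A) :
    toReal c v = c v := rfl

def brCurry {m : ℕ} (c : Form A (m + 1)) :
    Vect A →ₗ[ℝ] Vect A →ₗ[ℝ] Vect A [⋀^Fin m]→ₗ[ℝ] A :=
  LinearMap.mk₂ ℝ (fun a b => (toReal c).curryLeft ⁅a, b⁆)
    (by simp) (by simp) (by simp) (by simp)

def actCurry {m : ℕ} (c : Form A m) :
    Vect A →ₗ[ℝ] Vect A [⋀^Fin m]→ₗ[ℝ] A where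
  toFun a := (a : A →ₗ[ℝ] A).compAlternatingMap (toReal c)
  map_add' a b := by ext; simp
  map_smul' a b := by ext; simp

def extDerivReal : (k : ℕ) → (Form A k) → Vect A [⋀^Fin (k + 1)]→ₗ[ℝ] A
  | 0, c => AlternatingMap.alternatizeUncurryFin (actCurry c)
  | _ + 1, c => AlternatingMap.alternatizeUncurryFin (actCurry c) -
    (2⁻¹ : ℝ) • AlternatingMap.alternatizeUncurryFin
      (AlternatingMap.alternatizeUncurryFinLM ∘ₗ brCurry c)

theorem extDerivReal_apply (k : ℕ) (c : Form A k) (v : Fin (k + 1) → Vect A) :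
    extDerivReal k c v = ceFormula (fun X Y => ⁅X, Y⁆) (fun X f => X f) k c v := by
  cases k with
  | zero => simp [extDerivReal, ceFormula, AlternatingMap.alternatizeUncurryFin_apply, actCurry, toReal_apply]
  | succ k =>
    simp only [extDerivReal, ceFormula, AlternatingMap.sub_apply, AlternatingMap.smul_apply,
      AlternatingMap.alternatizeUncurryFin_alternatizeUncurryFinLM_comp_apply]
    rw [AlternatingMap.alternatizeUncurryFin_apply]
    have h1 : ∀ i, actCurry c (v i) (i.removeNth v) = v i (c (i.removeNth v)) := fun i => rfl
    have h2 : ∀ a b w, brCurry c a b w - brCurry c b a w =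
        (2 : ℝ) • c (Matrix.vecCons ⁅a, b⁆ w) := fun a b w => by
      have h3 : ∀ a b, brCurry c a b w = (toReal c).curryLeft ⁅a, b⁆ w := fun a b => rfl
      rw [h3, h3, ← lie_skew b a, map_neg, AlternatingMap.neg_apply, two_smul,
        sub_neg_eq_add]
      rfl
    simp only [h1, h2]
    congr 1
    simp only [Finset.smul_sum]
    refine Finset.sum_congr rfl fun i _ => Finset.sum_congr rfl fun j _ => ?_
    rw [smul_comm, smul_smul]
    norm_num

theorem removeNth_succ_vecCons {L : Type*} {m : ℕ} (y : L) (v : Fin (m + 1) → L)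
    (i : Fin (m + 1)) :
    i.succ.removeNth (Matrix.vecCons y v) = Matrix.vecCons y (i.removeNth v) := by
  funext l
  refine Fin.cases ?_ (fun l => ?_) l <;> simp [Fin.removeNth]

theorem map_vecCons_smul {m : ℕ} (c : Form A (m + 1)) (f : A) (x : Vect A)
    (u : Fin m → Vect A) : c (Matrix.vecCons (f • x) u) = f * c (Matrix.vecCons x u) := by
  exact congrArg (fun e => e u) (map_smul c.curryLeft f x)

theorem map_vecCons_add {m : ℕ} (c : Form A (m + 1)) (x y : Vect A)
    (u : Fin m → Vect A) : c (Matrix.vecCons (x + y) u) =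
      c (Matrix.vecCons x u) + c (Matrix.vecCons y u) := by
  exact congrArg (fun e => e u) (map_add c.curryLeft x y)

theorem extDerivReal_smul_zero (k : ℕ) (c : Form A k) (f : A) (x : Vect A)
    (v : Fin k → Vect A) :
    extDerivReal k c (Matrix.vecCons (f • x) v) = f • extDerivReal k c (Matrix.vecCons x v) := by
  rw [extDerivReal_apply, extDerivReal_apply]
  cases k with
  | zero => simp [ceFormula]
  | succ k =>
    have h0 : ∀ y, Fin.removeNth 0 (Matrix.vecCons y v) = v := fun y => rfl
    have hbr : ∀ j, ⁅f • x, v j⁆ = f • ⁅x, v j⁆ + (-(v j f)) • x := fun j => by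
      ext g
      simp [Derivation.commutator_apply]
      ring
    have hc : ∀ j u, c (Matrix.vecCons ⁅f • x, v j⁆ u) =
        f * c (Matrix.vecCons ⁅x, v j⁆ u) - v j f * c (Matrix.vecCons x u) := fun j u => by
      rw [hbr, map_vecCons_add, map_vecCons_smul, map_vecCons_smul]
      ring
    have hrest : ∀ (i : Fin (k + 1)) (j : Fin (k + 1)), i ≠ 0 → i ≤ j →
        c (Matrix.vecCons ⁅Matrix.vecCons (f • x) v i.castSucc, v j⁆
          (j.removeNth (i.castSucc.removeNth (Matrix.vecCons (f • x) v)))) =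
        f * c (Matrix.vecCons ⁅Matrix.vecCons x v i.castSucc, v j⁆
          (j.removeNth (i.castSucc.removeNth (Matrix.vecCons x v)))) := by
      intro i j hi hij
      obtain ⟨i, rfl⟩ := Fin.exists_succ_eq.2 hi
      have hj : j ≠ 0 := by
        rintro rfl
        simp at hij
      obtain ⟨j, rfl⟩ := Fin.exists_succ_eq.2 hj
      obtain ⟨k, rfl⟩ : ∃ m, k = m + 1 := ⟨k - 1, by have := i.pos; omega⟩
      rw [← Fin.succ_castSucc]
      simp only [removeNth_succ_vecCons, Matrix.cons_val_succ]
      exact map_vecCons_smul (c.curryLeft _) f x _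
    simp only [ceFormula]
    rw [Fin.sum_univ_succ, Fin.sum_univ_succ (n := k + 1)]
    have hsplit : ∀ g : Fin (k + 1) → Fin (k + 1) → A,
        ∑ i, ∑ j ≥ i, g i j = ∑ j, g 0 j + ∑ i ∈ Finset.univ.erase 0, ∑ j ≥ i, g i j := by
      intro g
      rw [← Finset.add_sum_erase _ _ (Finset.mem_univ 0)]
      congr 2
      ext j; simp
    rw [hsplit, hsplit]
    have h2 : ∑ i ∈ Finset.univ.erase (0 : Fin (k + 1)), ∑ j ≥ i, (-1 : ℤ) ^ (i + j : ℕ) •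
        c (Matrix.vecCons ⁅Matrix.vecCons (f • x) v i.castSucc, Matrix.vecCons (f • x) v j.succ⁆
          (j.removeNth (i.castSucc.removeNth (Matrix.vecCons (f • x) v)))) =
        f * ∑ i ∈ Finset.univ.erase (0 : Fin (k + 1)), ∑ j ≥ i, (-1 : ℤ) ^ (i + j : ℕ) •
        c (Matrix.vecCons ⁅Matrix.vecCons x v i.castSucc, Matrix.vecCons x v j.succ⁆
          (j.removeNth (i.castSucc.removeNth (Matrix.vecCons x v)))) := by
      rw [Finset.mul_sum]
      refine Finset.sum_congr rfl fun i hi => ?_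
      rw [Finset.mul_sum]
      refine Finset.sum_congr rfl fun j hj => ?_
      rw [Matrix.cons_val_succ, Matrix.cons_val_succ,
        hrest i j (Finset.ne_of_mem_erase hi) (by simpa using hj), mul_smul_comm]
    rw [h2]
    simp only [h0, removeNth_succ_vecCons, Matrix.cons_val_succ, Matrix.cons_val_zero,
      Fin.castSucc_zero, hc, map_vecCons_smul, Derivation.leibniz, smul_eq_mul,
      Fin.val_succ, Fin.val_zero, pow_succ, pow_zero, zero_add, one_smul, Derivation.smul_apply,
      mul_neg, mul_one, neg_smul, smul_add, smul_sub, Finset.sum_sub_distrib, Finset.sum_add_distrib,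
      Finset.sum_neg_distrib, mul_add, mul_sub, Finset.mul_sum, mul_smul_comm]
    have h3 : ∀ j, c (Matrix.vecCons x (j.removeNth v)) * v j f =
      v j f * c (Matrix.vecCons x (j.removeNth v)) := fun j => mul_comm _ _
    simp only [h3]
    abel

theorem extDerivReal_smul (k : ℕ) (c : Form A k) (v : Fin (k + 1) → Vect A) (i : Fin (k + 1)) (f : A) (x : Vect A)  :
    extDerivReal k c (Function.update v i (f • x)) = f • extDerivReal k c (Function.update v i x) := by
  have key : ∀ y, extDerivReal k c (Function.update v i y) = (-1 : ℤ) ^ (i : ℕ) • extDerivReal k c (Matrix.vecCons y (i.removeNth v)) := by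
    intro y
    rw [← Fin.insertNth_removeNth, AlternatingMap.map_insertNth]
  rw [key, key, extDerivReal_smul_zero, smul_comm]
instance Form.instIsScalarTower (k : ℕ) : IsScalarTower ℝ A (Form A k) where
  smul_assoc r f η := by ext v; simp

/-- The de Rham differential of a `k`-form. -/
def deRham (k : ℕ) : Form A k →ₗ[ℝ] Form A (k + 1) where
  toFun η :=
    { toFun := ceFormula (fun X Y => ⁅X, Y⁆) (fun X f => X f) k η
      map_update_add' := fun {inst} v i x y => by
        rw [Subsingleton.elim inst (instDecidableEqFin (k + 1))]
        simp only [← extDerivReal_apply, AlternatingMap.map_update_add]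
      map_update_smul' := fun {inst} v i f x => by
        rw [Subsingleton.elim inst (instDecidableEqFin (k + 1))]
        simp only [← extDerivReal_apply, extDerivReal_smul]
      map_eq_zero_of_eq' := fun v i j hv hij => by
        simp only [← extDerivReal_apply]
        exact AlternatingMap.map_eq_zero_of_eq _ v hv hij }
  map_add' η ζ := by
    ext v
    cases k with
    | zero => simp [ceFormula]
    | succ k => simp [ceFormula, Finset.sum_add_distrib]; abel
  map_smul' r η := by
    ext v
    cases k with
    | zero => simp [ceFormula]
    | succ k =>
      simp [ceFormula, Finset.smul_sum, smul_sub]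

/-- The differential `df` of a function. -/
def dFun (f : A) : OneForm A where
  toFun Y := Y f
  map_add' _ _ := rfl
  map_smul' _ _ := rfl

/-- A one-form as an element of `Form A 1`. -/
def OneForm.toForm (α : OneForm A) : Form A 1 :=
  AlternatingMap.ofSubsingleton A (Vect A) A (0 : Fin 1) α

/-- The wedge product `α₁ ∧ ⋯ ∧ α_k` of one-forms, `(X₁, …, X_k) ↦ det (α_j (X_i))`. -/
def wedge {k : ℕ} (α : Fin k → OneForm A) : Form A k :=
  (Matrix.detRowAlternating (n := Fin k) (R := A)).compLinearMap (LinearMap.pi α)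

/-- Lie derivative of `k`-forms along `X`. -/
def lieForm (X : Vect A) (k : ℕ) : DerOver X (Form A k) :=
  (DerOver.lie X).alt (DerOver.base X) k

/-- Lie derivative of `k`-vector fields along `X`. -/
def lieMultiVect (X : Vect A) (k : ℕ) : DerOver X (MultiVect A k) :=
  (lieForm X k).hom (DerOver.base X)

/-- The form `(X₁, …, X_k) ↦ η(X₁, …, X_k, Y₁, …, Y_m)`. -/
def slice {k m n : ℕ} (h : k + m = n) (η : Form A n) (Y : Fin m → Vect A) : Form A k where
  toFun X := η.domDomCongr ((finCongr h.symm).trans finSumFinEquiv.symm) (Sum.elim X Y)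
  map_update_add' := fun {inst} X i x y => by
    rw [Subsingleton.elim inst (instDecidableEqFin k)]
    simp only [← Sum.update_elim_inl, AlternatingMap.map_update_add]
  map_update_smul' := fun {inst} X i f x => by
    rw [Subsingleton.elim inst (instDecidableEqFin k)]
    simp only [← Sum.update_elim_inl, AlternatingMap.map_update_smul]
  map_eq_zero_of_eq' := fun X i j hX hij =>
    AlternatingMap.map_eq_zero_of_eq _ _ (i := Sum.inl i) (j := Sum.inl j) hX (by simpa using hij)

/-- The interior product `ι_V η` of a form with a `k`-vector field; for `V = X₁ ∧ ⋯ ∧ X_k` it is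
`(ι_V η)(Y₁, …, Y_m) = η(X₁, …, X_k, Y₁, …, Y_m)`. -/
def interior {k m n : ℕ} (h : k + m = n) (V : MultiVect A k) (η : Form A n) : Form A m where
  toFun Y := V (slice h η Y)
  map_update_add' := fun {inst} Y i x y => by
    rw [Subsingleton.elim inst (instDecidableEqFin m), ← map_add]
    congr 1
    ext X
    simp only [slice, AlternatingMap.coe_mk, MultilinearMap.coe_mk, AlternatingMap.add_apply,
      ← Sum.update_elim_inr, AlternatingMap.map_update_add]
  map_update_smul' := fun {inst} Y i f x => by
    rw [Subsingleton.elim inst (instDecidableEqFin m), ← map_smul]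
    congr 1
    ext X
    simp only [slice, AlternatingMap.coe_mk, MultilinearMap.coe_mk, AlternatingMap.smul_apply,
      ← Sum.update_elim_inr, AlternatingMap.map_update_smul]
  map_eq_zero_of_eq' := fun Y i j hY hij => by
    rw [← map_zero V]
    congr 1
    ext X
    simp only [slice, AlternatingMap.coe_mk, MultilinearMap.coe_mk, AlternatingMap.zero_apply]
    exact AlternatingMap.map_eq_zero_of_eq _ _ (i := Sum.inr i) (j := Sum.inr j) hY
      (by simpa using hij)

/-- The contraction `ι_X η`, a one-form, of a two-form with a vector field. -/
def contract (X : Vect A) (η : Form A 2) : OneForm A where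
  toFun Y := η ![X, Y]
  map_add' Y Z := by
    have h : ∀ Z, ![X, Z] = Function.update ![X, 0] 1 Z := fun Z => by
      funext l; fin_cases l <;> rfl
    have h' := η.map_update_add ![X, 0] 1 Y Z
    rwa [← h, ← h, ← h] at h'
  map_smul' f Y := by
    have h : ∀ Z, ![X, Z] = Function.update ![X, 0] 1 Z := fun Z => by
      funext l; fin_cases l <;> rfl
    have h' := η.map_update_smul ![X, 0] 1 f Y
    rwa [← h, ← h] at h'

/-! ### The cotangent bundle Lie algebroid of a bivector field -/

/-- The Poisson bracket `{f, g} = π(df, dg)`. -/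
def poissonBracket (π : MultiVect A 2) (f g : A) : A := π (wedge ![dFun f, dFun g])

/-- A bivector field is Poisson if its bracket of functions satisfies the Jacobi identity. -/
def IsPoisson (π : MultiVect A 2) : Prop :=
  ∀ f g h : A, poissonBracket π f (poissonBracket π g h) +
    poissonBracket π g (poissonBracket π h f) + poissonBracket π h (poissonBracket π f g) = 0

theorem wedge_two_apply (α β : OneForm A) (X : Fin 2 → Vect A) :
    wedge ![α, β] X = α (X 0) * β (X 1) - β (X 0) * α (X 1) := by
  refine (Matrix.det_fin_two (Matrix.of fun i => LinearMap.pi ![α, β] (X i))).trans ?_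
  simp

/-- The anchor map: `anchor π α` is the vector field with `β ↦ π(α, β)`. -/
def anchor (π : MultiVect A 2) (α : OneForm A) : Vect A :=
  Derivation.mk'
    { toFun := fun f => π (wedge ![α, dFun f])
      map_add' := fun f g => by
        rw [← map_add]
        congr 1
        ext X
        simp only [wedge_two_apply, AlternatingMap.add_apply, dFun, LinearMap.coe_mk,
          AddHom.coe_mk, map_add]
        ring
      map_smul' := fun r f => by
        rw [RingHom.id_apply, ← LinearMap.map_smul_of_tower]
        congr 1
        ext X
        simp [wedge_two_apply, dFun, smul_sub] }
    (fun f g => by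
      simp only [LinearMap.coe_mk, AddHom.coe_mk]
      rw [← map_smul, ← map_smul, ← map_add]
      congr 1
      ext X
      simp only [wedge_two_apply, AlternatingMap.add_apply, AlternatingMap.smul_apply, dFun,
        LinearMap.coe_mk, AddHom.coe_mk, Derivation.leibniz, smul_eq_mul]
      ring)

/-- The bracket `{α, β}_π = d(π(α, β)) + ι_{anchor α} dβ - ι_{anchor β} dα` of one-forms. -/
def koszulBracket (π : MultiVect A 2) (α β : OneForm A) : OneForm A :=
  dFun (π (wedge ![α, β])) + contract (anchor π α) (deRham 1 β.toForm) -
    contract (anchor π β) (deRham 1 α.toForm)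

/-- The operator `D_α ν = L_{anchor α} ν + (π, dα) ν` on `n`-forms. For `n` the dimension of the
manifold this is the canonical representation on the canonical line bundle. -/
def canonicalRep (π : MultiVect A 2) (n : ℕ) (α : OneForm A) :
    DerOver (anchor π α) (Form A n) where
  toFun ν := (lieForm (anchor π α) n).op ν + π (deRham 1 α.toForm) • ν
  map_add' ν ξ := by simp only [map_add, smul_add]; abel
  map_smul' r ν := by
    simp only [map_smul, smul_add, RingHom.id_apply, smul_comm (π (deRham 1 α.toForm)) r]
  leibniz f ν := by
    simp only [DerOver.op_smul, smul_add, smul_comm f (π (deRham 1 α.toForm))]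
    abel

variable (A) in
/-- Sections of `Hom(∧^k T^*, K^N)`, where `K = ∧^n T^*` is the canonical line bundle. -/
abbrev Cochain (n : ℕ) (N : ℤ) (k : ℕ) := Form A k →ₗ[A] LinePow A (Form A n) N

/-- `d` is the family of Lie algebroid differentials of the cotangent Lie algebroid with
coefficients in `K^N`. -/
def IsAlgebroidDifferential (π : MultiVect A 2) (n : ℕ) (N : ℤ)
    (d : ∀ k, Cochain A n N k →ₗ[ℝ] Cochain A n N (k + 1)) : Prop :=
  ∀ (k : ℕ) (φ : Cochain A n N k) (α : Fin (k + 1) → OneForm A),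
    d k φ (wedge α) = ceFormula (koszulBracket π)
      (fun β => ((canonicalRep π n β).linePow N).op) k (fun γ => φ (wedge γ)) α

/-- Lie derivative along `X` on sections of `Hom(∧^k T^*, K^N)`. -/
def lieCochain (X : Vect A) (n : ℕ) (N : ℤ) (k : ℕ) : DerOver X (Cochain A n N k) :=
  (lieForm X k).hom ((lieForm X n).linePow N)

/-- `θ` is the modular vector field of `π` with respect to `μ`: `D_α μ = α(θ) μ` for all `α`. -/
def IsModularVectorField {n : ℕ} (π : MultiVect A 2) (μ : Form A n) (θ : Vect A) : Prop :=
  ∀ α : OneForm A, (canonicalRep π n α).op μ = α θ • μ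

/-- `s` is the section `μ^N` of `K^N`; for `N < 0` it is the dual element of `μ^{-N}`. -/
def IsVolumePower {n : ℕ} (μ : Form A n) : ∀ N : ℤ, LinePow A (Form A n) N → Prop
  | Int.ofNat m, s => s = PiTensorProduct.tprod A (fun _ : Fin m => μ)
  | Int.negSucc m, s => (show Module.Dual A (⨂[A]^(m + 1) (Form A n)) from s)
      (PiTensorProduct.tprod A (fun _ : Fin (m + 1) => μ)) = 1

/-- `b` is the family of operators `b_μ`, in degrees `k + 1 → k`, given by
`ι_{b V} μ = (-1)^(k + 1) d (ι_V μ)`. (On functions `b_μ` is zero.) -/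
def IsDivergence {n : ℕ} (μ : Form A n)
    (b : ∀ k, MultiVect A (k + 1) →ₗ[ℝ] MultiVect A k) : Prop :=
  ∀ (k m : ℕ) (h : k + 1 + m = n) (h' : k + (m + 1) = n) (V : MultiVect A (k + 1)),
    interior h' (b k V) μ = (-1 : ℤ) ^ (k + 1) • deRham m (interior h V μ)

end Algebra

/-! ### Cohomology -/

section Cohomology

variable {C : ℕ → Type*} [∀ k, AddCommGroup (C k)] [∀ k, Module ℝ (C k)]

/-- The image of the incoming differential (zero in degree `0`). -/
def coboundaries (d : ∀ k, C k →ₗ[ℝ] C (k + 1)) : ∀ k, Submodule ℝ (C k)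
  | 0 => ⊥
  | k + 1 => LinearMap.range (d k)

/-- The `k`-th cohomology: cocycles modulo coboundaries. -/
abbrev Cohomology (d : ∀ k, C k →ₗ[ℝ] C (k + 1)) (k : ℕ) :=
  LinearMap.ker (d k) ⧸ (coboundaries d k).submoduleOf (LinearMap.ker (d k))

end Cohomology

/-! ### Smooth manifolds -/

/-- Smooth real functions on an `n`-dimensional manifold. -/
abbrev Fn (n : ℕ) (P : Type*) [TopologicalSpace P] [ChartedSpace (EuclideanSpace ℝ (Fin n)) P] :=
  C^∞⟮𝓡 n, P; 𝓘(ℝ, ℝ), ℝ⟯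

/-- A volume form: a nowhere vanishing form of top degree. -/
def IsVolumeForm {n : ℕ} {P : Type*} [TopologicalSpace P]
    [ChartedSpace (EuclideanSpace ℝ (Fin n)) P] (μ : Form (Fn n P) n) : Prop :=
  ∀ p : P, ∃ X : Fin n → Vect (Fn n P), (μ X : Fn n P) p ≠ 0

end PoissonCohomology

end

open PoissonCohomology

/-! Everything is carried over to differential forms by the volume form. The map `star`, which sends
a k-vector field V to ±ι_V μ, identifies k-vector fields with (n-k)-forms. With the sign
(-1)^(k(k-1)/2) it turns the contraction V(α ∧ ·) into exterior multiplication by α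
(`IsVolume.extOp_star`). In this picture b_μ is -d (`IsVolume.isDivergence_iff`), and d_N,
trivialized by μ^N, is T_N = [d, ι_π] + (N - 1) ι_θ (`twistedOp`, `IsVolume.delta_wedge`).

The second claim rests on an analogue of the Cartan formula in which α ∧ · takes the role of
contraction. The anticommutator of α ∧ · with [d, ι_π] is an operator R_α (`repOp`). It acts on
exterior multiplications through the Koszul bracket (`Framed.repOp_extOp`) and on top-degree forms
as D_α (`IsVolume.repOp_top`). In particular R_α μ = α(θ) μ, and the summand (N - 1) ι_θ raises this
to N α(θ) μ, as coefficients in K^N require. The resulting recursion in the first argument is that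
of the Chevalley-Eilenberg formula (`ceFormula_succ`).

Since d² = 0, the operator d anticommutes with [d, ι_π], so d T_N + T_N d = (N - 1) L_θ
(`dOp_twistedOp`); a change of sign gives the homotopy identity. Moreover ι_θ μ = d ι_π μ
(`IsVolume.insOp_modular`), hence L_θ μ = 0, and the Jacobi identity gives L_θ π = 0
(`IsVolume.lieMultiVect_modular`), so L_θ commutes with d_N. For N ≠ 1 the operator b_μ / (1 - N) is
a homotopy that makes L_θ zero on cohomology.

Operator identities are proved by `FormOp.eq_zero`: commuting with contractions reduces them to
degree zero. The manifold enters only through `framed_fn` (cut-off coordinate frames detect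
vanishing of functions) and `IsVolumeForm.isVolume` (μ freely generates the top-degree forms); the
rest is algebra over the ring of functions. -/

noncomputable section

namespace PoissonCohomology

/-! ### Operators on differential forms and their commutation with contractions. -/

section Operators

variable {A : Type*} [CommRing A] [Algebra ℝ A]

/-- The space of all families of differential forms, one in each degree. -/
def Forms (A : Type*) [CommRing A] [Algebra ℝ A] := ∀ k, Form A k

namespace Forms

instance : AddCommGroup (Forms A) := inferInstanceAs (AddCommGroup (∀ k, Form A k))
instance : Module A (Forms A) := inferInstanceAs (Module A (∀ k, Form A k))
instance : Module ℝ (Forms A) := inferInstanceAs (Module ℝ (∀ k, Form A k))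
instance : IsScalarTower ℝ A (Forms A) := inferInstanceAs (IsScalarTower ℝ A (∀ k, Form A k))

@[ext] theorem ext {η ζ : Forms A} (h : ∀ k, η k = ζ k) : η = ζ := funext h
@[simp] theorem zero_apply (k : ℕ) : (0 : Forms A) k = 0 := rfl
@[simp] theorem add_apply (η ζ : Forms A) (k : ℕ) : (η + ζ) k = η k + ζ k := rfl
@[simp] theorem sub_apply (η ζ : Forms A) (k : ℕ) : (η - ζ) k = η k - ζ k := rfl
@[simp] theorem neg_apply (η : Forms A) (k : ℕ) : (-η) k = -η k := rfl
@[simp] theorem smul_apply (f : A) (η : Forms A) (k : ℕ) : (f • η) k = f • η k := rfl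
@[simp] theorem real_smul_apply (r : ℝ) (η : Forms A) (k : ℕ) : (r • η) k = r • η k := rfl
@[simp] theorem zsmul_apply (r : ℤ) (η : Forms A) (k : ℕ) : (r • η) k = r • η k := rfl

end Forms

/-- Operators on families of differential forms. -/
abbrev FormOp (A : Type*) [CommRing A] [Algebra ℝ A] := Module.End ℝ (Forms A)

/-- Multiplication by a function. -/
def mulOp (f : A) : FormOp A where
  toFun η := f • η
  map_add' := smul_add f
  map_smul' r η := by
    ext k v; simp

/-- Contraction with a vector field. -/
def insOp (X : Vect A) : FormOp A where
  toFun η k := (η (k + 1)).curryLeft X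
  map_add' _ _ := rfl
  map_smul' _ _ := rfl

/-- Exterior product of a one-form with a form. -/
def extForm (α : OneForm A) (k : ℕ) : Form A k →ₗ[A] Form A (k + 1) where
  toFun η := AlternatingMap.alternatizeUncurryFin (α.smulRight η)
  map_add' η ζ := by
    rw [← AlternatingMap.alternatizeUncurryFin_add]; congr 1; ext; simp
  map_smul' f η := by
    rw [RingHom.id_apply, ← AlternatingMap.alternatizeUncurryFin_smul]; congr 1; ext; simp
    ring

theorem extForm_apply (α : OneForm A) (k : ℕ) (η : Form A k) (v : Fin (k + 1) → Vect A) :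
    extForm α k η v = ∑ i : Fin (k + 1), (-1 : ℤ) ^ (i : ℕ) • (α (v i) * η (i.removeNth v)) := by
  simp [extForm, AlternatingMap.alternatizeUncurryFin_apply]

/-- Exterior multiplication by a one-form. -/
def extOp (α : OneForm A) : FormOp A where
  toFun η
    | 0 => 0
    | k + 1 => extForm α k (η k)
  map_add' η ζ := by
    ext1 k
    cases k with
    | zero => exact (add_zero 0).symm
    | succ k => exact map_add (extForm α k) (η k) (ζ k)
  map_smul' r η := by
    ext1 k
    cases k with
    | zero => exact (smul_zero r).symm
    | succ k => exact (extForm α k).map_smul_of_tower r (η k)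

/-- The de Rham differential. -/
def dOp : FormOp A where
  toFun η
    | 0 => 0
    | k + 1 => deRham k (η k)
  map_add' η ζ := by
    ext1 k
    cases k with
    | zero => exact (add_zero 0).symm
    | succ k => exact map_add (deRham k) (η k) (ζ k)
  map_smul' r η := by
    ext1 k
    cases k with
    | zero => exact (smul_zero r).symm
    | succ k => exact map_smul (deRham k) r (η k)

/-- The Lie derivative. -/
def lieOp (X : Vect A) : FormOp A where
  toFun η k := (lieForm X k).op (η k)
  map_add' η ζ := Forms.ext fun k => map_add (lieForm X k).op (η k) (ζ k)
  map_smul' r η := Forms.ext fun k => map_smul (lieForm X k).op r (η k)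

/-- Contraction with a multivector field. -/
def mvOp {k : ℕ} (V : MultiVect A k) : FormOp A where
  toFun η m := interior rfl V (η (k + m))
  map_add' η ζ := by
    ext m v
    exact map_add V (slice rfl (η (k + m)) v) (slice rfl (ζ (k + m)) v)
  map_smul' r η := by
    ext m v
    exact V.map_smul_of_tower r (slice rfl (η (k + m)) v)

theorem mulOp_apply (f : A) (η : Forms A) : mulOp f η = f • η := rfl
theorem insOp_apply (X : Vect A) (η : Forms A) (k : ℕ) (v : Fin k → Vect A) :
    insOp X η k v = η (k + 1) (Matrix.vecCons X v) := rfl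
theorem extOp_zero (α : OneForm A) (η : Forms A) : extOp α η 0 = 0 := rfl
theorem extOp_succ (α : OneForm A) (η : Forms A) (k : ℕ) :
    extOp α η (k + 1) = extForm α k (η k) := rfl
theorem dOp_zero (η : Forms A) : dOp η 0 = 0 := rfl
theorem dOp_succ (η : Forms A) (k : ℕ) : dOp η (k + 1) = deRham k (η k) := rfl
theorem lieOp_apply (X : Vect A) (η : Forms A) (k : ℕ) :
    lieOp X η k = (lieForm X k).op (η k) := rfl
theorem mvOp_apply {k : ℕ} (V : MultiVect A k) (η : Forms A) (m : ℕ) :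
    mvOp V η m = interior rfl V (η (k + m)) := rfl

theorem lieForm_op_apply (X : Vect A) (k : ℕ) (η : Form A k) (v : Fin k → Vect A) :
    (lieForm X k).op η v = X (η v) - ∑ i, η (Function.update v i ⁅X, v i⁆) := rfl

theorem insOp_ext {η ζ : Forms A} {k : ℕ}
    (h : ∀ X, insOp X η k = insOp X ζ k) : η (k + 1) = ζ (k + 1) := by
  ext v
  have := congrArg (fun e => e (Matrix.vecTail v)) (h (v 0))
  simp only [insOp_apply] at this
  rwa [show Matrix.vecCons (v 0) (Matrix.vecTail v) = v from Matrix.cons_head_tail v] at this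

/-- An operator which commutes with all contractions up to a constant and has no component in
degree `0` vanishes. -/
theorem FormOp.eq_zero {T : FormOp A} (c : ℤ)
    (h : ∀ X, insOp X * T = c • (T * insOp X)) (h0 : ∀ η, T η 0 = 0) : T = 0 := by
  have : ∀ k η, T η k = 0 := by
    intro k
    induction k with
    | zero => exact h0
    | succ k ih =>
      intro η
      -- A form of positive degree is determined by its contractions, and `h` moves the contraction
      -- past `T` into degree `k`, where the induction hypothesis holds for all forms.
      refine insOp_ext (ζ := 0) fun X => ?_
      have := congrArg (fun S : FormOp A => S η k) (h X)
      simp only [Module.End.mul_apply, LinearMap.smul_apply, Forms.zsmul_apply, ih] at this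
      rw [this, map_zero]; simp
  ext1 η; ext1 k; exact this k η

theorem mulOp_mul (f g : A) : (mulOp (f * g) : FormOp A) = mulOp f * mulOp g := by
  ext1 η; exact mul_smul f g η

theorem mulOp_add (f g : A) : (mulOp (f + g) : FormOp A) = mulOp f + mulOp g := by
  ext1 η; exact add_smul f g η

theorem mulOp_sub (f g : A) : (mulOp (f - g) : FormOp A) = mulOp f - mulOp g := by
  ext1 η; exact sub_smul f g η

theorem insOp_mulOp (X : Vect A) (f : A) : insOp X * mulOp f = mulOp f * insOp X := rfl

theorem insOp_smul (X : Vect A) (f : A) : insOp (f • X) = mulOp f * insOp X := by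
  ext1 η; ext1 k
  exact map_smul (η (k + 1)).curryLeft f X

theorem insOp_mul_self (X : Vect A) : insOp X * insOp X = 0 := by
  ext1 η; ext1 k
  exact AlternatingMap.curryLeft_same (η (k + 2)) X

theorem insOp_add (X Y : Vect A) : insOp (X + Y) = insOp X + insOp Y := by
  ext1 η; ext1 k
  exact map_add (η (k + 1)).curryLeft X Y

theorem insOp_zero : insOp (0 : Vect A) = 0 := by
  ext1 η; ext1 k
  exact map_zero (η (k + 1)).curryLeft

theorem insOp_insOp (X Y : Vect A) : insOp X * insOp Y = - (insOp Y * insOp X) := by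
  have := insOp_mul_self (X + Y)
  simp only [insOp_add, add_mul, mul_add, insOp_mul_self] at this
  rw [eq_neg_iff_add_eq_zero]
  simpa [add_comm] using this

theorem insOp_extOp (X : Vect A) (α : OneForm A) :
    insOp X * extOp α = mulOp (α X) - extOp α * insOp X := by
  ext1 η; ext k v
  change extForm α k (η k) (Matrix.vecCons X v) = α X • η k v - extOp α (insOp X η) k v
  rw [extForm_apply, Fin.sum_univ_succ]
  cases k with
  | zero => simp [extOp_zero]
  | succ k =>
    rw [extOp_succ, extForm_apply, sub_eq_add_neg, ← Finset.sum_neg_distrib]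
    congr 1
    · simp
    · refine Finset.sum_congr rfl fun i _ => ?_
      rw [removeNth_succ_vecCons]
      simp [pow_succ, insOp_apply]

/-- The form in which `FormOp.eq_zero` is applied to operator identities. The commutation with
contractions is then a noncommutative linear combination of identities already known, with `c` the
sign given by the parity of the operators, and only degree zero is computed by hand. -/
theorem FormOp.sub_mul_ins {T S : FormOp A} (c : ℤ)
    (h : ∀ X, insOp X * (T - S) = c • ((T - S) * insOp X)) (h0 : ∀ η, T η 0 = S η 0) :
    T = S :=
  sub_eq_zero.1 <| FormOp.eq_zero c h fun η => by simp [h0]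

theorem extOp_mulOp (α : OneForm A) (f : A) : extOp α * mulOp f = mulOp f * extOp α := by
  ext1 η; ext1 k
  cases k with
  | zero => exact (smul_zero f).symm
  | succ k => exact map_smul (extForm α k) f (η k)

theorem extOp_extOp (α β : OneForm A) : extOp α * extOp β = - (extOp β * extOp α) := by
  refine FormOp.sub_mul_ins 1 (fun X => ?_) fun η => by simp [extOp_zero]
  have h1 := insOp_extOp X α
  have h2 := insOp_extOp X β
  have h3 := extOp_mulOp α (β X)
  have h4 := extOp_mulOp β (α X)
  linear_combination (norm := noncomm_ring) h1 * extOp β - extOp α * h2 + h2 * extOp α -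
    extOp β * h1 - h3 - h4

theorem lieOp_mulOp (X : Vect A) (f : A) :
    lieOp X * mulOp f = mulOp f * lieOp X + mulOp (X f) := by
  ext1 η; ext1 k
  exact (lieForm X k).op_smul f (η k)

theorem lieOp_insOp (X Y : Vect A) :
    lieOp X * insOp Y = insOp Y * lieOp X + insOp ⁅X, Y⁆ := by
  ext1 η; ext k v
  change (lieForm X k).op (insOp Y η k) v = (lieForm X (k + 1)).op (η (k + 1)) (Matrix.vecCons Y v) +
    η (k + 1) (Matrix.vecCons ⁅X, Y⁆ v)
  rw [lieForm_op_apply, lieForm_op_apply, Fin.sum_univ_succ]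
  have : ∀ i : Fin k, Function.update (Matrix.vecCons Y v) i.succ ⁅X, v i⁆ =
    Matrix.vecCons Y (Function.update v i ⁅X, v i⁆) := fun i => (Fin.cons_update ..).symm
  have h0 : Function.update (Matrix.vecCons Y v) 0 ⁅X, Y⁆ = Matrix.vecCons ⁅X, Y⁆ v :=
    Fin.update_cons_zero ..
  simp [insOp_apply, this, h0]
  abel

end Operators

/-! ### The Chevalley-Eilenberg formula as a recursion. -/

section ChevalleyEilenberg

/-- This is ι_x d = L_x - d ι_x for an arbitrary bracket and action: pairs containing the first
index give the brackets with `x`, all other pairs reassemble to the formula for `c(x, ·)`. It serves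
both the de Rham differential and the algebroid differential; `hc` is all the antisymmetry that is
needed. -/
theorem ceFormula_succ {L M : Type*} [AddCommGroup M] (br : L → L → L) (D : L → M →+ M) (k : ℕ)
    (c : (Fin (k + 1) → L) → M)
    (hc : ∀ (i : Fin (k + 1)) (x : L) (w : Fin k → L),
      c (i.insertNth x w) = (-1 : ℤ) ^ (i : ℕ) • c (Matrix.vecCons x w))
    (x : L) (v : Fin (k + 1) → L) :
    ceFormula br (fun a => D a) (k + 1) c (Matrix.vecCons x v) =
      D x (c v) - ∑ j, c (Function.update v j (br x (v j))) -
        ceFormula br (fun a => D a) k (fun w => c (Matrix.vecCons x w)) v := by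
  have h0 : Fin.removeNth 0 (Matrix.vecCons x v) = v := rfl
  have hupd : ∀ (j : Fin (k + 1)) y, c (Function.update v j y) =
      (-1 : ℤ) ^ (j : ℕ) • c (Matrix.vecCons y (j.removeNth v)) := fun j y => by
    rw [← Fin.insertNth_removeNth, hc]
  have hsplit : ∀ g : Fin (k + 1) → Fin (k + 1) → M,
      ∑ i, ∑ j ≥ i, g i j = ∑ j, g 0 j + ∑ i ∈ Finset.univ.erase 0, ∑ j ≥ i, g i j := by
    intro g
    rw [← Finset.add_sum_erase _ _ (Finset.mem_univ 0)]
    congr 2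
    ext j; simp
  simp only [ceFormula]
  rw [Fin.sum_univ_succ, hsplit]
  simp only [Fin.castSucc_zero, Matrix.cons_val_zero, Matrix.cons_val_succ, h0, Fin.val_zero,
    pow_zero, one_smul, zero_add, removeNth_succ_vecCons, hupd, Fin.val_succ]
  cases k with
  | zero => simp; abel
  | succ k =>
    have hswap : ∀ y (w : Fin k → L), c (Matrix.vecCons y (Matrix.vecCons x w)) =
        - c (Matrix.vecCons x (Matrix.vecCons y w)) := fun y w => by
      have := hc 1 x (Matrix.vecCons y w)
      simp only [Fin.val_one, pow_one, neg_smul, one_smul] at this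
      rw [← this]
      congr 1
      funext l
      refine Fin.cases ?_ (fun l => Fin.cases ?_ (fun l => ?_) l) l
      · rfl
      · rfl
      · rfl
    -- For pairs that avoid `x`, interchanging `x` and the bracket costs the minus sign; shifting
    -- both indices by one leaves the sign `(-1)^(i + j)` unchanged.
    have hsum : ∑ i ∈ Finset.univ.erase (0 : Fin (k + 2)), ∑ j ≥ i, (-1 : ℤ) ^ (i + j : ℕ) •
        c (Matrix.vecCons (br (Matrix.vecCons x v i.castSucc) (v j))
          (j.removeNth (i.castSucc.removeNth (Matrix.vecCons x v)))) =
        - ∑ i : Fin (k + 1), ∑ j ≥ i, (-1 : ℤ) ^ (i + j : ℕ) •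
        c (Matrix.vecCons x (Matrix.vecCons (br (v i.castSucc) (v j.succ))
          (j.removeNth (i.castSucc.removeNth v)))) := by
      rw [← Finset.sum_neg_distrib]
      have e1 : Finset.univ.erase (0 : Fin (k + 2)) = Finset.univ.map (Fin.succEmb (k + 1)) := by
        ext i
        simp only [Finset.mem_erase, Finset.mem_univ, and_true, Finset.mem_map, true_and,
          Fin.coe_succEmb]
        exact Fin.exists_succ_eq.symm
      rw [e1, Finset.sum_map]
      refine Finset.sum_congr rfl fun i _ => ?_
      have e2 : Finset.univ.filter (fun j => j ≥ (Fin.succEmb (k + 1)) i) =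
          (Finset.univ.filter (fun j => j ≥ i)).map (Fin.succEmb (k + 1)) := by
        ext j
        simp only [Finset.mem_filter, Finset.mem_univ, true_and, Finset.mem_map, Fin.coe_succEmb]
        constructor
        · intro h
          obtain ⟨j, rfl⟩ := Fin.exists_succ_eq.2 (show j ≠ 0 by rintro rfl; simp at h)
          exact ⟨j, by simpa using h, rfl⟩
        · rintro ⟨j, h, rfl⟩
          simpa using h
      have e3 : ∀ i : Fin (k + 2), Finset.Ici i = Finset.univ.filter (fun j => j ≥ i) := by
        intro i; ext j; simp
      have e4 : ∀ i : Fin (k + 1), Finset.Ici i = Finset.univ.filter (fun j => j ≥ i) := by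
        intro i; ext j; simp
      simp only [e3, e4] at e2 ⊢
      rw [e2, Finset.sum_map, ← Finset.sum_neg_distrib]
      refine Finset.sum_congr rfl fun j _ => ?_
      simp only [Fin.coe_succEmb, ← Fin.succ_castSucc, Matrix.cons_val_succ,
        removeNth_succ_vecCons, hswap, Fin.val_succ]
      rw [smul_neg, show (i : ℕ) + 1 + (j + 1) = i + j + 2 by ring, pow_add]
      simp
    rw [hsum]
    simp only [pow_succ, mul_neg, mul_one, neg_smul, Finset.sum_neg_distrib]
    abel

end ChevalleyEilenberg

/-! ### Cartan calculus over an algebra of functions. -/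

section Cartan

variable {A : Type*} [CommRing A] [Algebra ℝ A]

@[simp] theorem dFun_apply (f : A) (X : Vect A) : dFun f X = X f := rfl

/-- Lie derivative of a one-form. -/
def lieOneForm (X : Vect A) : DerOver X (OneForm A) := (DerOver.lie X).hom (DerOver.base X)

theorem lieOneForm_apply (X : Vect A) (α : OneForm A) (Y : Vect A) :
    (lieOneForm X).op α Y = X (α Y) - α ⁅X, Y⁆ := rfl

theorem OneForm.toForm_apply (α : OneForm A) (v : Fin 1 → Vect A) : α.toForm v = α (v 0) := rfl

theorem deRham_apply (k : ℕ) (η : Form A k) (v : Fin (k + 1) → Vect A) :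
    deRham k η v = ceFormula (fun X Y => ⁅X, Y⁆) (fun X f => X f) k η v := rfl

theorem deRham_succ_vecCons (k : ℕ) (η : Form A (k + 1)) (X : Vect A)
    (v : Fin (k + 1) → Vect A) :
    deRham (k + 1) η (Matrix.vecCons X v) =
      (lieForm X (k + 1)).op η v - deRham k (η.curryLeft X) v :=
  ceFormula_succ (fun X Y : Vect A => ⁅X, Y⁆)
    (fun X : Vect A => ((X : A →ₗ[ℝ] A) : A →+ A)) k η
    (fun i x w => η.map_insertNth i x w) X v

theorem lieOp_eq (X : Vect A) : lieOp X = dOp * insOp X + insOp X * dOp := by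
  ext1 η; ext k v
  change (lieForm X k).op (η k) v = dOp (insOp X η) k v + deRham k (η k) (Matrix.vecCons X v)
  cases k with
  | zero =>
    rw [deRham_apply, dOp_zero]
    simp [ceFormula, lieForm_op_apply]
  | succ k =>
    rw [deRham_succ_vecCons]
    change _ = deRham k ((η (k + 1)).curryLeft X) v + _
    abel

theorem dOp_mulOp (f : A) : dOp * mulOp f = mulOp f * dOp + extOp (dFun f) := by
  refine FormOp.sub_mul_ins (-1) (fun X => ?_) fun η => by
    simp [mulOp_apply, dOp_zero, extOp_zero]
  have h1 := lieOp_eq X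
  have h2 := insOp_mulOp X f
  have h3 := insOp_extOp X (dFun f)
  have h4 := lieOp_mulOp X f
  rw [dFun_apply] at h3
  rw [h1] at h4
  linear_combination (norm := noncomm_ring) h4 - dOp * h2 - h2 * dOp - h3

theorem lieOp_lieOp (X Y : Vect A) :
    lieOp X * lieOp Y = lieOp Y * lieOp X + lieOp ⁅X, Y⁆ := by
  refine FormOp.sub_mul_ins 1 (fun Z => ?_) fun η => ?_
  · have h1 := lieOp_insOp X Z
    have h2 := lieOp_insOp Y Z
    have h3 := lieOp_insOp ⁅X, Y⁆ Z
    have h4 := lieOp_insOp X ⁅Y, Z⁆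
    have h5 := lieOp_insOp Y ⁅X, Z⁆
    have h6 : insOp ⁅⁅X, Y⁆, Z⁆ = insOp ⁅X, ⁅Y, Z⁆⁆ - insOp ⁅Y, ⁅X, Z⁆⁆ := by
      rw [lie_lie]
      have := insOp_add (⁅X, ⁅Y, Z⁆⁆ - ⁅Y, ⁅X, Z⁆⁆) ⁅Y, ⁅X, Z⁆⁆
      rw [sub_add_cancel] at this
      rw [this, add_sub_cancel_right]
    linear_combination (norm := noncomm_ring) h2 * lieOp X - lieOp X * h2 - h1 * lieOp Y +
      lieOp Y * h1 - h4 + h5 + h3 + h6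
  · ext v
    change X (Y _ - _) - _ = Y (X _ - _) - _ + (⁅X, Y⁆ _ - _)
    simp [lieOp_apply, Derivation.commutator_apply]

theorem lieOp_dOp (X : Vect A) : lieOp X * dOp = dOp * lieOp X := by
  refine FormOp.sub_mul_ins (-1) (fun Y => ?_) fun η => ?_
  · have h1 := lieOp_lieOp X Y
    have h2 := lieOp_insOp X Y
    have h3 := lieOp_eq Y
    have h4 := lieOp_eq ⁅X, Y⁆
    rw [h3, h4] at h1
    linear_combination (norm := noncomm_ring) h1 - h2 * dOp - dOp * h2
  · change (lieForm X 0).op 0 = 0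
    exact map_zero _

/-- Because L_Y = d ι_Y + ι_Y d commutes with d, the operator d² commutes with every contraction,
and `FormOp.eq_zero` applies. -/
theorem dOp_dOp : (dOp * dOp : FormOp A) = 0 := by
  refine FormOp.eq_zero 1 (fun Y => ?_) fun η => rfl
  have h1 := lieOp_dOp Y
  have h3 := lieOp_eq Y
  rw [h3] at h1
  linear_combination (norm := noncomm_ring) h1

theorem lieOp_extOp (X : Vect A) (α : OneForm A) :
    lieOp X * extOp α = extOp α * lieOp X + extOp ((lieOneForm X).op α) := by
  refine FormOp.sub_mul_ins (-1) (fun Y => ?_) fun η => ?_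
  · have h1 := lieOp_insOp X Y
    have h2 := insOp_extOp Y α
    have h3 := insOp_extOp Y ((lieOneForm X).op α)
    have h4 := lieOp_mulOp X (α Y)
    have h5 := insOp_extOp ⁅X, Y⁆ α
    rw [lieOneForm_apply, mulOp_sub] at h3
    linear_combination (norm := noncomm_ring) lieOp X * h2 - h2 * lieOp X - h1 * extOp α -
      extOp α * h1 - h3 + h4 - h5
  · simp [extOp_zero]
    change (lieForm X 0).op 0 = 0
    exact map_zero _

theorem extOp_add (α β : OneForm A) : extOp (α + β) = extOp α + extOp β := by
  refine FormOp.sub_mul_ins (-1) (fun Y => ?_) fun η => by simp [extOp_zero]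
  have h1 := insOp_extOp Y α
  have h2 := insOp_extOp Y β
  have h3 := insOp_extOp Y (α + β)
  rw [LinearMap.add_apply, mulOp_add] at h3
  linear_combination (norm := noncomm_ring) h3 - h1 - h2

theorem extOp_smul (f : A) (α : OneForm A) : extOp (f • α) = mulOp f * extOp α := by
  refine FormOp.sub_mul_ins (-1) (fun Y => ?_) fun η => by simp [extOp_zero, mulOp_apply]
  have h1 := insOp_extOp Y α
  have h2 := insOp_mulOp Y f
  have h3 := insOp_extOp Y (f • α)
  rw [LinearMap.smul_apply, smul_eq_mul, mulOp_mul] at h3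
  linear_combination (norm := noncomm_ring) h3 - mulOp f * h1 - h2 * extOp α

theorem extOp_sub (α β : OneForm A) : extOp (α - β) = extOp α - extOp β := by
  rw [eq_sub_iff_add_eq, ← extOp_add, sub_add_cancel]

/-- Exterior multiplication by the differential of a one-form. -/
def extDOp (α : OneForm A) : FormOp A := dOp * extOp α + extOp α * dOp

theorem contract_deRham_apply (α : OneForm A) (X Y : Vect A) :
    contract X (deRham 1 α.toForm) Y = X (α Y) - Y (α X) - α ⁅X, Y⁆ := by
  change deRham 1 α.toForm ![X, Y] = _
  rw [deRham_succ_vecCons, lieForm_op_apply, deRham_apply]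
  simp [ceFormula, OneForm.toForm_apply]
  ring

theorem lieOneForm_eq (X : Vect A) (α : OneForm A) :
    (lieOneForm X).op α = dFun (α X) + contract X (deRham 1 α.toForm) := by
  ext Y
  rw [lieOneForm_apply, LinearMap.add_apply, contract_deRham_apply, dFun_apply]
  ring

theorem insOp_extDOp (X : Vect A) (α : OneForm A) :
    insOp X * extDOp α = extDOp α * insOp X + extOp (contract X (deRham 1 α.toForm)) := by
  have h1 := lieOp_eq X
  have h2 := insOp_extOp X α
  have h3 := lieOp_extOp X α
  have h4 := dOp_mulOp (α X)
  rw [lieOneForm_eq, extOp_add, h1] at h3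
  rw [extDOp]
  linear_combination (norm := noncomm_ring) h3 - dOp * h2 + h2 * dOp - h4

theorem extDOp_mulOp (α : OneForm A) (f : A) : extDOp α * mulOp f = mulOp f * extDOp α := by
  have h1 := dOp_mulOp f
  have h2 := extOp_mulOp α f
  have h3 := extOp_extOp α (dFun f)
  rw [extDOp]
  linear_combination (norm := noncomm_ring) dOp * h2 + h1 * extOp α + extOp α * h1 + h2 * dOp + h3

theorem extDOp_extOp (α β : OneForm A) : extDOp α * extOp β = extOp β * extDOp α := by
  refine FormOp.sub_mul_ins (-1) (fun X => ?_) fun η => by simp [extDOp, extOp_zero, dOp_zero]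
  have h1 := insOp_extDOp X α
  have h2 := insOp_extOp X β
  have h3 := extDOp_mulOp α (β X)
  have h4 := extOp_extOp (contract X (deRham 1 α.toForm)) β
  linear_combination (norm := noncomm_ring) h1 * extOp β + extDOp α * h2 - h2 * extDOp α +
    extOp β * h1 + h3 + h4

theorem extDOp_dFun (f : A) : extDOp (dFun f) = 0 := by
  have h1 := dOp_mulOp f
  have h2 : extOp (dFun f) = dOp * mulOp f - mulOp f * dOp := by rw [h1]; abel
  have h3 := dOp_dOp (A := A)
  rw [extDOp, h2]
  linear_combination (norm := noncomm_ring) h3 * mulOp f - mulOp f * h3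

theorem extDOp_add (α β : OneForm A) : extDOp (α + β) = extDOp α + extDOp β := by
  simp only [extDOp, extOp_add, mul_add, add_mul]; abel

theorem extDOp_smul (f : A) (α : OneForm A) :
    extDOp (f • α) = mulOp f * extDOp α + extOp (dFun f) * extOp α := by
  have h1 := dOp_mulOp f
  simp only [extDOp, extOp_smul]
  linear_combination (norm := noncomm_ring) h1 * extOp α

end Cartan

/-! ### Contraction with multivector fields. -/

section Multivector

variable {A : Type*} [CommRing A] [Algebra ℝ A]

theorem slice_rfl_apply {k m : ℕ} (η : Form A (k + m)) (X : Fin k → Vect A) (Y : Fin m → Vect A) :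
    slice rfl η Y X = η (Fin.append X Y) := by
  change η _ = _
  congr 1
  funext i
  refine Fin.addCases (fun i => ?_) (fun i => ?_) i <;> simp

theorem mvOp_apply_apply {k : ℕ} (V : MultiVect A k) (η : Forms A) (m : ℕ) (Y : Fin m → Vect A) :
    mvOp V η m Y = V (slice rfl (η (k + m)) Y) := rfl

theorem mvOp_zero_apply {k : ℕ} (V : MultiVect A k) (η : Forms A) (Y : Fin 0 → Vect A) :
    mvOp V η 0 Y = V (η k) := by
  rw [mvOp_apply_apply]
  congr 1
  ext X
  rw [slice_rfl_apply]
  congr 1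
  funext i
  exact congrArg X (Fin.ext rfl) ▸ Fin.append_left X Y i

theorem append_vecCons {L : Type*} {k m : ℕ} (Z : Fin k → L) (X : L) (Y : Fin m → L) :
    @Fin.append k (m + 1) L Z (Matrix.vecCons X Y) =
      (⟨k, by omega⟩ : Fin (k + m + 1)).insertNth X (Fin.append Z Y) := by
  refine Fin.eq_insertNth_iff.2 ⟨?_, ?_⟩
  · exact Fin.append_right Z (Matrix.vecCons X Y) 0
  · funext i
    refine Fin.addCases (fun j => ?_) (fun j => ?_) i
    · rw [Fin.append_left, Fin.removeNth, Fin.succAbove_of_castSucc_lt _ _ (by simp [Fin.lt_def])]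
      exact Fin.append_left Z (Matrix.vecCons X Y) j
    · rw [Fin.append_right, Fin.removeNth, Fin.succAbove_of_le_castSucc _ _ (by simp [Fin.le_def])]
      exact Fin.append_right Z (Matrix.vecCons X Y) j.succ

/-- The arguments fed to `V` come first, so the vector `X` stands in position `k`; bringing it to
the front costs (-1)^k. -/
theorem insOp_mvOp {k : ℕ} (V : MultiVect A k) (X : Vect A) :
    insOp X * mvOp V = (-1 : ℤ) ^ k • (mvOp V * insOp X) := by
  ext1 η; ext m Y
  simp only [Module.End.mul_apply, LinearMap.smul_apply, Forms.zsmul_apply, insOp_apply,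
    mvOp_apply_apply, AlternatingMap.smul_apply]
  rw [← map_zsmul]
  congr 1
  ext Z
  rw [slice_rfl_apply, AlternatingMap.smul_apply, slice_rfl_apply]
  have h := (η (k + m + 1)).map_insertNth ⟨k, by omega⟩ X (Fin.append Z Y)
  change _ = (-1 : ℤ) ^ k • (η (k + m + 1)) (Matrix.vecCons X (Fin.append Z Y))
  rw [← h]
  exact congrArg (η (k + m + 1)) (append_vecCons Z X Y)

theorem mvOp_mulOp {k : ℕ} (V : MultiVect A k) (f : A) : mvOp V * mulOp f = mulOp f * mvOp V := by
  ext1 η; ext m Y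
  exact map_smul V f (slice rfl (η (k + m)) Y)

theorem lieOp_mvOp {k : ℕ} (V : MultiVect A k) (X : Vect A) :
    lieOp X * mvOp V = mvOp V * lieOp X + mvOp ((lieMultiVect X k).op V) := by
  refine FormOp.sub_mul_ins ((-1) ^ k) (fun Y => ?_) fun η => ?_
  · have h1 := lieOp_insOp X Y
    have h2 := insOp_mvOp V Y
    have h3 := insOp_mvOp V ⁅X, Y⁆
    have h4 := insOp_mvOp ((lieMultiVect X k).op V) Y
    rcases neg_one_pow_eq_or ℤ k with h | h <;> rw [h] at h2 h3 h4 ⊢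
    · linear_combination (norm := noncomm_ring) lieOp X * h2 - h1 * mvOp V - h2 * lieOp X - h4
        - h3 + mvOp V * h1
    · linear_combination (norm := noncomm_ring) lieOp X * h2 - h1 * mvOp V - h2 * lieOp X - h4
        - h3 - mvOp V * h1
  · ext v
    rw [Module.End.mul_apply, lieOp_apply, lieForm_op_apply, mvOp_zero_apply]
    simp only [LinearMap.add_apply, Module.End.mul_apply, Forms.add_apply,
      AlternatingMap.add_apply, mvOp_zero_apply]
    change _ = V ((lieForm X k).op (η k)) + (X (V (η k)) - V ((lieForm X k).op (η k)))
    simp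

/-- Contraction of a multivector field with a one-form: `V(α ∧ ·)`. -/
def cut {k : ℕ} (V : MultiVect A (k + 1)) (α : OneForm A) : MultiVect A k := V ∘ₗ extForm α k

theorem cut_apply {k : ℕ} (V : MultiVect A (k + 1)) (α : OneForm A) (ξ : Form A k) :
    cut V α ξ = V (extForm α k ξ) := rfl

/-- Both sides have the same graded commutators with contractions, and in degree zero the identity
is the definition of `cut`. For a bivector field it produces the anchor; applied to a top-degree
form, where α ∧ · vanishes, it makes `star` compatible with exterior multiplication. -/
theorem mvOp_extOp {k : ℕ} (V : MultiVect A (k + 1)) (α : OneForm A) :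
    mvOp V * extOp α = (-1 : ℤ) ^ (k + 1) • (extOp α * mvOp V) + mvOp (cut V α) := by
  refine FormOp.sub_mul_ins ((-1) ^ k) (fun X => ?_) fun η => ?_
  · have h1 := insOp_extOp X α
    have h2 := insOp_mvOp V X
    have h3 := insOp_mvOp (cut V α) X
    have h4 := mvOp_mulOp V (α X)
    rw [pow_succ] at h2 ⊢
    rcases neg_one_pow_eq_or ℤ k with h | h <;> rw [h] at h2 h3 ⊢
    · linear_combination (norm := noncomm_ring) h2 * extOp α - mvOp V * h1 + h1 * mvOp V -
        extOp α * h2 - h3 - h4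
    · linear_combination (norm := noncomm_ring) h2 * extOp α + mvOp V * h1 - h1 * mvOp V +
        extOp α * h2 - h3 + h4
  · ext v
    simp only [LinearMap.add_apply, LinearMap.smul_apply, Module.End.mul_apply, Forms.add_apply,
      Forms.zsmul_apply, extOp_zero, smul_zero, zero_add, mvOp_zero_apply, extOp_succ, cut_apply]

theorem mvOp_one_eq {V : MultiVect A 1} {X : Vect A} (h : ∀ η : Forms A, V (η 1) = η 1 ![X]) :
    mvOp V = insOp X := by
  refine FormOp.sub_mul_ins (-1) (fun Y => ?_) fun η => ?_
  · have h1 := insOp_mvOp V Y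
    have h2 := insOp_insOp X Y
    linear_combination (norm := noncomm_ring) h1 - h2
  · ext v
    rw [mvOp_zero_apply, h, insOp_apply]
    congr 1
    funext i; fin_cases i; rfl

end Multivector

/-! ### Coordinate frames in algebraic form. -/

section Frames

variable {A : Type*} [CommRing A] [Algebra ℝ A] {n : ℕ}

/-- The functions `x i` and the vector fields `X i` are dual coordinates and frame of the tangent
bundle wherever the function `χ` does not vanish. -/
structure IsFrame (χ : A) (x : Fin n → A) (X : Fin n → Vect A) : Prop where
  expand : ∀ Y : Vect A, χ • Y = χ • ∑ i, Y (x i) • X i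
  dual : ∀ i, χ * X i (x i) = χ

variable (A n) in
/-- Coordinate frames of length `n` detect whether a function is zero. -/
def Framed : Prop :=
  ∀ a : A, (∀ (χ : A) (x : Fin n → A) (X : Fin n → Vect A), IsFrame χ x X → ∃ m : ℕ, χ ^ m * a = 0) →
    a = 0

theorem IsFrame.oneForm_expand {χ : A} {x : Fin n → A} {X : Fin n → Vect A} (h : IsFrame χ x X)
    (α : OneForm A) : χ • α = χ • ∑ i, α (X i) • dFun (x i) := by
  ext Y
  have := congrArg α (h.expand Y)
  simp only [map_smul, map_sum, smul_eq_mul] at this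
  simp only [LinearMap.smul_apply, LinearMap.sum_apply, smul_eq_mul, dFun_apply, this]
  congr 1
  exact Finset.sum_congr rfl fun i _ => mul_comm _ _

/-- After multiplication by χ a one-form is a combination of exact ones, and `Framed` removes the
factor χ. -/
theorem Framed.oneForm_hom_ext (hA : Framed A n) {c e : OneForm A →ₗ[A] A}
    (h : ∀ f, c (dFun f) = e (dFun f)) : c = e := by
  rw [← sub_eq_zero]
  ext1 α
  refine hA _ fun χ x X hX => ⟨1, ?_⟩
  have h1 : χ • (c - e) α = (c - e) (χ • α) := (map_smul _ _ _).symm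
  rw [pow_one, ← smul_eq_mul, h1, hX.oneForm_expand]
  simp [h]

/-- Each of the `k` arguments needs its own factor χ to be expanded, which is why `Framed` allows a
power of χ. -/
theorem IsFrame.form_expand {χ : A} {x : Fin n → A} {X : Fin n → Vect A} (h : IsFrame χ x X)
    {k : ℕ} (η : Form A k) (Y : Fin k → Vect A) :
    χ ^ k * η Y = ∑ r : Fin k → Fin n, (∏ j, χ * Y j (x (r j))) * η fun j => X (r j) := by
  have h1 := η.toMultilinearMap.map_smul_univ (fun _ => χ) Y
  simp only [Finset.prod_const, Finset.card_univ, Fintype.card_fin] at h1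
  have h2 : (fun i => χ • Y i) = fun i => ∑ j, (χ * Y i (x j)) • X j := by
    funext i
    rw [h.expand, Finset.smul_sum]
    simp only [smul_smul]
  rw [h2, MultilinearMap.map_sum] at h1
  rw [← smul_eq_mul, ← AlternatingMap.coe_multilinearMap, ← h1]
  exact Finset.sum_congr rfl fun r _ => η.toMultilinearMap.map_smul_univ _ _

theorem Framed.form_eq_zero (hA : Framed A n) {k : ℕ} (hk : n < k) (η : Form A k) : η = 0 := by
  ext Y
  refine hA _ fun χ x X hX => ⟨k, ?_⟩
  rw [hX.form_expand]
  refine Finset.sum_eq_zero fun r _ => ?_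
  obtain ⟨i, j, hij, hr⟩ := Fintype.exists_ne_map_eq_of_card_lt r (by simpa using hk)
  rw [η.map_eq_zero_of_eq _ (congrArg X hr) hij, mul_zero]

/-- Top-degree forms have rank one: in a frame the value of a form on any selection of frame vectors
is a factor, independent of the form, times its value on the frame itself. The factor is a sign for
a permutation and zero for a selection with repetitions. -/
theorem Framed.mul_comm_apply (hA : Framed A n) (η ζ : Form A n) (Y Z : Fin n → Vect A) :
    η Y * ζ Z = ζ Y * η Z := by
  rw [← sub_eq_zero]
  refine hA _ fun χ x X hX => ⟨n + n, ?_⟩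
  rw [mul_sub, sub_eq_zero, pow_add, mul_mul_mul_comm _ _ (η Y), mul_mul_mul_comm _ _ (ζ Y), hX.form_expand,
    hX.form_expand, hX.form_expand, hX.form_expand, Finset.sum_mul_sum, Finset.sum_mul_sum]
  refine Finset.sum_congr rfl fun r _ => Finset.sum_congr rfl fun s _ => ?_
  have key : ∀ r : Fin n → Fin n, ∃ c : A, ∀ η : Form A n, (η fun j => X (r j)) = c * η X := by
    intro r
    by_cases hr : Function.Injective r
    · have hb : Function.Bijective r := Finite.injective_iff_bijective.1 hr
      refine ⟨((Equiv.Perm.sign (Equiv.ofBijective r hb) : ℤ) : A), fun η => ?_⟩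
      have := η.map_perm X (Equiv.ofBijective r hb)
      rw [Units.smul_def, zsmul_eq_mul] at this
      exact this
    · obtain ⟨i, j, hr, hij⟩ : ∃ i j, r i = r j ∧ i ≠ j := by
        simpa [Function.Injective] using hr
      exact ⟨0, fun η => by
        rw [η.map_eq_zero_of_eq (fun j => X (r j)) (congrArg X hr) hij, zero_mul]⟩
  obtain ⟨a, ha⟩ := key r
  obtain ⟨b, hb⟩ := key s
  rw [ha, ha, hb, hb]
  ring

/-- Multiplication of a form by its degree. -/
def degOp : FormOp A where
  toFun η k := (k : ℕ) • η k
  map_add' η ζ := Forms.ext fun k => smul_add k (η k) (ζ k)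
  map_smul' r η := Forms.ext fun k => smul_comm k r (η k)

theorem insOp_degOp (X : Vect A) : insOp X * degOp = degOp * insOp X + insOp X := by
  ext1 η; ext k v
  change ((k + 1 : ℕ) • η (k + 1)) (Matrix.vecCons X v) = (k • (η (k + 1))) (Matrix.vecCons X v) +
    (η (k + 1)) (Matrix.vecCons X v)
  rw [add_smul, one_smul, AlternatingMap.add_apply]

theorem insOp_sum {ι : Type*} (s : Finset ι) (X : ι → Vect A) :
    insOp (∑ i ∈ s, X i) = ∑ i ∈ s, insOp (X i) := by
  classical
  induction s using Finset.induction_on with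
  | empty => simp [insOp_zero]
  | insert i s hi ih => rw [Finset.sum_insert hi, Finset.sum_insert hi, insOp_add, ih]

/-- Euler's identity: ∑ dx_i ∧ ι_{X_i} multiplies a form by its degree. Up to the factor χ both
sides have commutator ι_Y with ι_Y, by the expansion of Y in the frame, and both vanish in degree
zero. Since degrees are invertible over ℝ, it recovers multivector fields from their cuts and forms
from their exterior products with one-forms. -/
theorem IsFrame.sum_extOp_insOp {χ : A} {x : Fin n → A} {X : Fin n → Vect A} (h : IsFrame χ x X) :
    mulOp χ * ∑ i, extOp (dFun (x i)) * insOp (X i) = mulOp χ * degOp := by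
  refine FormOp.sub_mul_ins 1 (fun Y => ?_) fun η => ?_
  · have h1 : mulOp χ * ∑ i, mulOp (Y (x i)) * insOp (X i) = mulOp χ * insOp Y := by
      rw [← insOp_smul Y χ, h.expand, insOp_smul, insOp_sum]
      simp only [insOp_smul]
    have h2 : insOp Y * ∑ i, extOp (dFun (x i)) * insOp (X i) =
        ∑ i, mulOp (Y (x i)) * insOp (X i) + (∑ i, extOp (dFun (x i)) * insOp (X i)) * insOp Y := by
      rw [Finset.mul_sum, Finset.sum_mul, ← Finset.sum_add_distrib]
      refine Finset.sum_congr rfl fun i _ => ?_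
      have h3 := insOp_extOp Y (dFun (x i))
      have h4 := insOp_insOp (X i) Y
      rw [dFun_apply] at h3
      linear_combination (norm := noncomm_ring) h3 * insOp (X i) - extOp (dFun (x i)) * h4
    have h5 := insOp_mulOp Y χ
    have h6 := insOp_degOp Y
    generalize (∑ i, extOp (dFun (x i)) * insOp (X i)) = S at *
    linear_combination (norm := noncomm_ring) h5 * S + mulOp χ * h2 + h1 - h5 * degOp -
      mulOp χ * h6
  · rw [Module.End.mul_apply, Module.End.mul_apply, mulOp_apply, mulOp_apply, Forms.smul_apply,
      Forms.smul_apply, LinearMap.sum_apply]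
    congr 1
    have : ∀ s : Finset (Fin n), (∑ i ∈ s, (extOp (dFun (x i)) * insOp (X i)) η) 0 = 0 := by
      intro s
      induction s using Finset.induction_on with
      | empty => simp
      | insert i s hi ih => rw [Finset.sum_insert hi, Forms.add_apply, ih, add_zero]; rfl
    rw [this]
    exact (zero_smul ℕ (η 0)).symm

theorem Forms.sum_apply {ι : Type*} (s : Finset ι) (η : ι → Forms A) (k : ℕ) :
    (∑ i ∈ s, η i) k = ∑ i ∈ s, η i k := by
  classical
  induction s using Finset.induction_on with
  | empty => simp
  | insert i s hi ih => rw [Finset.sum_insert hi, Finset.sum_insert hi, Forms.add_apply, ih]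

/-- A form as an element of the space of families of forms. -/
def Forms.single (k : ℕ) (η : Form A k) : Forms A := Pi.single (M := fun k => Form A k) k η

theorem Forms.single_same (k : ℕ) (η : Form A k) : Forms.single k η k = η := Pi.single_eq_same ..

theorem Forms.single_of_ne {k m : ℕ} (h : m ≠ k) (η : Form A k) : Forms.single k η m = 0 :=
  Pi.single_eq_of_ne h _

theorem IsFrame.sum_extForm {χ : A} {x : Fin n → A} {X : Fin n → Vect A} (h : IsFrame χ x X)
    {k : ℕ} (η : Form A (k + 1)) :
    χ • ∑ i, extForm (dFun (x i)) k (η.curryLeft (X i)) = χ • (k + 1 : ℕ) • η := by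
  have := congrArg (fun T : FormOp A => T (Forms.single (k + 1) η) (k + 1)) h.sum_extOp_insOp
  simp only [Module.End.mul_apply, mulOp_apply, Forms.smul_apply, LinearMap.sum_apply,
    Forms.sum_apply, extOp_succ] at this
  change _ = χ • (k + 1 : ℕ) • Forms.single (k + 1) η (k + 1) at this
  rw [Forms.single_same] at this
  rw [← this]
  congr 1
  refine Finset.sum_congr rfl fun i _ => ?_
  congr 1
  change _ = (Forms.single (k + 1) η (k + 1)).curryLeft (X i)
  rw [Forms.single_same]

theorem eq_zero_of_nsmul {M : Type*} [AddCommGroup M] [Module ℝ M] {k : ℕ} (hk : k ≠ 0) {a : M}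
    (h : k • a = 0) : a = 0 := by
  rw [← Nat.cast_smul_eq_nsmul ℝ] at h
  exact (smul_eq_zero.1 h).resolve_left (by exact_mod_cast hk)

theorem Framed.multiVect_eq_zero_of_cut (hA : Framed A n) {k : ℕ} {V : MultiVect A (k + 1)}
    (h : ∀ f, cut V (dFun f) = 0) : V = 0 := by
  ext1 ξ
  refine hA _ fun χ x X hX => ⟨1, eq_zero_of_nsmul k.succ_ne_zero ?_⟩
  have := congrArg V (hX.sum_extForm ξ)
  rw [map_smul, map_sum, map_smul, map_nsmul] at this
  rw [pow_one, ← smul_eq_mul, ← smul_comm, ← this]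
  refine (congrArg (χ • ·) (Finset.sum_eq_zero fun i _ => ?_)).trans (smul_zero χ)
  rw [← cut_apply, h, LinearMap.zero_apply]

/-- Contracting dx_i ∧ η = 0 with X_i gives χ dx_i ∧ ι_{X_i} η = χ η for each i, which uses only the
diagonal relation X_i(x_i) = 1. Summation and Euler's identity give n χ η = m χ η with m < n. -/
theorem Framed.form_eq_zero_of_extOp (hA : Framed A n) {m : ℕ} (hm : m < n) {η : Forms A}
    (h : ∀ α, extOp α η (m + 1) = 0) : η m = 0 := by
  ext v
  refine hA _ fun χ x X hX => ⟨1, eq_zero_of_nsmul (Nat.sub_pos_of_lt hm).ne' ?_⟩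
  have h1 := congrArg (fun T : FormOp A => T η m) hX.sum_extOp_insOp
  simp only [Module.End.mul_apply, mulOp_apply, Forms.smul_apply, LinearMap.sum_apply,
    Forms.sum_apply] at h1
  have h2 : ∀ i, χ • extOp (dFun (x i)) (insOp (X i) η) m = χ • η m := fun i => by
    have h3 := congrArg (fun T : FormOp A => T η m) (insOp_extOp (X i) (dFun (x i)))
    have h4 : insOp (X i) (extOp (dFun (x i)) η) m = 0 := by
      ext v
      rw [insOp_apply, h]
      rfl
    simp only [Module.End.mul_apply, LinearMap.sub_apply, Forms.sub_apply, h4, mulOp_apply] at h3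
    rw [← sub_eq_zero.1 h3.symm, Forms.smul_apply, smul_smul, dFun_apply, hX.dual]
  rw [Finset.smul_sum, Finset.sum_congr rfl fun i _ => h2 i, Finset.sum_const, Finset.card_univ,
    Fintype.card_fin] at h1
  change n • χ • η m = χ • (m : ℕ) • η m at h1
  have h5 := congrArg (fun ζ : Form A m => ζ v) h1
  simp only [AlternatingMap.smul_apply, smul_eq_mul, nsmul_eq_mul] at h5
  rw [pow_one, nsmul_eq_mul, Nat.cast_sub hm.le]
  linear_combination h5

end Frames

/-! ### Wedge products of one-forms. -/

section Alternation

variable {A : Type*} [CommRing A] [Algebra ℝ A]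

/-- Laplace expansion of the determinant along the first column. -/
theorem wedge_vecCons {k : ℕ} (α : OneForm A) (β : Fin k → OneForm A) :
    wedge (Matrix.vecCons α β) = extForm α k (wedge β) := by
  ext v
  rw [extForm_apply]
  refine (Matrix.det_succ_column_zero
    (Matrix.of fun i => LinearMap.pi (Matrix.vecCons α β) (v i))).trans ?_
  refine Finset.sum_congr rfl fun i _ => ?_
  rw [zsmul_eq_mul, mul_assoc]
  push_cast
  rfl

/-- Supplies the antisymmetry hypothesis of `ceFormula_succ` for cochains evaluated on wedge
products. -/
theorem wedge_insertNth {k : ℕ} (i : Fin (k + 1)) (α : OneForm A) (β : Fin k → OneForm A) :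
    wedge (i.insertNth α β : Fin (k + 1) → OneForm A) =
      (-1 : ℤ) ^ (i : ℕ) • wedge (Matrix.vecCons α β) := by
  induction k with
  | zero =>
    obtain rfl : i = 0 := Fin.fin_one_eq_zero i
    rw [Fin.insertNth_zero']; simp; rfl
  | succ k ih =>
    refine Fin.cases ?_ (fun i => ?_) i
    · rw [Fin.insertNth_zero']; simp; rfl
    · have hb : β = Matrix.vecCons (β 0) (Matrix.vecTail β) := (Matrix.cons_head_tail β).symm
      have h1 : (i.succ.insertNth α β : Fin (k + 2) → OneForm A) =
          Matrix.vecCons (β 0) (i.insertNth α (Matrix.vecTail β)) := by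
        nth_rw 1 [hb]
        exact Fin.insertNth_succ_cons ..
      rw [h1, wedge_vecCons, ih]
      nth_rw 3 [hb]
      rw [wedge_vecCons, wedge_vecCons, wedge_vecCons, map_zsmul]
      have h2 := congrArg (fun T : FormOp A =>
        T (Forms.single k (wedge (Matrix.vecTail β))) (k + 2)) (extOp_extOp (β 0) α)
      simp only [Module.End.mul_apply, LinearMap.neg_apply, Forms.neg_apply, extOp_succ,
        Forms.single_same] at h2
      rw [h2, Fin.val_succ, pow_succ]
      simp

theorem wedge_zero_apply (β : Fin 0 → OneForm A) (v : Fin 0 → Vect A) : wedge β v = 1 :=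
  Matrix.det_isEmpty (A := Matrix.of fun i => LinearMap.pi β (v i))

end Alternation

/-! ### Exterior multiplication by forms of arbitrary degree. -/

section Alternatization

variable {A : Type*} [CommRing A] [Algebra ℝ A]

theorem FormOp.map_smul_of_mulOp {T : FormOp A} (hT : ∀ f, T * mulOp f = mulOp f * T) (f : A)
    (η : Forms A) : T (f • η) = f • T η :=
  congrArg (fun S : FormOp A => S η) (hT f)

/-- Exterior multiplication by a one-form, as an `A`-linear map. -/
def extLin (α : OneForm A) : Forms A →ₗ[A] Forms A where
  toFun := extOp α
  map_add' := map_add _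
  map_smul' := FormOp.map_smul_of_mulOp (extOp_mulOp α)

/-- Contraction with a vector field, as an `A`-linear map. -/
def insLin (X : Vect A) : Forms A →ₗ[A] Forms A where
  toFun := insOp X
  map_add' := map_add _
  map_smul' := FormOp.map_smul_of_mulOp (insOp_mulOp X)

/-- The component of degree `k`. -/
def Forms.proj (k : ℕ) : Forms A →ₗ[A] Form A k where
  toFun η := η k
  map_add' _ _ := rfl
  map_smul' _ _ := rfl

/-- The components of `alternation`. -/
def alternationAux (G : Vect A →ₗ[A] Forms A) : Forms A
  | 0 => 0
  | k + 1 => AlternatingMap.alternatizeUncurryFin (Forms.proj k ∘ₗ G)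

theorem alternationAux_succ_apply (G : Vect A →ₗ[A] Forms A) (k : ℕ)
    (v : Fin (k + 1) → Vect A) :
    alternationAux G (k + 1) v =
      ∑ i : Fin (k + 1), (-1 : ℤ) ^ (i : ℕ) • G (v i) k (i.removeNth v) :=
  AlternatingMap.alternatizeUncurryFin_apply _ _

/-- The form `∑ i, eⁱ ∧ G(eᵢ)` obtained from a form-valued one-form `G` by alternation. -/
def alternation : (Vect A →ₗ[A] Forms A) →ₗ[A] Forms A where
  toFun G := alternationAux G
  map_add' G H := by
    refine Forms.ext fun k => ?_
    rw [Forms.add_apply]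
    cases k with
    | zero => exact (add_zero 0).symm
    | succ k =>
      ext v
      simp [alternationAux_succ_apply, Finset.sum_add_distrib]
  map_smul' f G := by
    refine Forms.ext fun k => ?_
    rw [Forms.smul_apply]
    cases k with
    | zero => exact (smul_zero f).symm
    | succ k =>
      ext v
      simp [alternationAux_succ_apply, Finset.mul_sum, mul_left_comm]

theorem alternation_zero (G : Vect A →ₗ[A] Forms A) : alternation G 0 = 0 := rfl

theorem alternation_succ_apply (G : Vect A →ₗ[A] Forms A) (k : ℕ) (v : Fin (k + 1) → Vect A) :
    alternation G (k + 1) v = ∑ i : Fin (k + 1), (-1 : ℤ) ^ (i : ℕ) • G (v i) k (i.removeNth v) :=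
  alternationAux_succ_apply G k v

theorem insOp_alternation (G : Vect A →ₗ[A] Forms A) (X : Vect A) :
    insOp X (alternation G) = G X - alternation (insLin X ∘ₗ G) := by
  ext k v
  rw [insOp_apply, alternation_succ_apply, Fin.sum_univ_succ, Forms.sub_apply,
    AlternatingMap.sub_apply, sub_eq_add_neg]
  congr 1
  · simp
  · cases k with
    | zero => simp [alternation_zero]
    | succ k =>
      rw [alternation_succ_apply, ← Finset.sum_neg_distrib]
      refine Finset.sum_congr rfl fun i _ => ?_
      rw [removeNth_succ_vecCons]
      simp only [Fin.val_succ, pow_succ, mul_neg, mul_one, neg_smul, Matrix.cons_val_succ]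
      rfl

theorem alternation_smulRight (α : OneForm A) (η : Forms A) :
    alternation (α.smulRight η) = extOp α η := by
  ext1 k
  cases k <;> rfl

theorem extOp_alternation (α : OneForm A) (G : Vect A →ₗ[A] Forms A) :
    extOp α (alternation G) = - alternation (extLin α ∘ₗ G) := by
  rw [eq_neg_iff_add_eq_zero]
  have : ∀ (k : ℕ) (G : Vect A →ₗ[A] Forms A),
      (extOp α (alternation G) + alternation (extLin α ∘ₗ G)) k = 0 := by
    intro k
    induction k with
    | zero =>
      intro G
      rw [Forms.add_apply, extOp_zero, alternation_zero, add_zero]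
    | succ k ih =>
      intro G
      refine insOp_ext (ζ := 0) fun X => ?_
      have h1 := congrArg (fun T : FormOp A => T (alternation G)) (insOp_extOp X α)
      have h2 : insLin X ∘ₗ extLin α ∘ₗ G = α X • G - extLin α ∘ₗ insLin X ∘ₗ G := by
        ext1 Y
        exact congrArg (fun T : FormOp A => T (G Y)) (insOp_extOp X α)
      simp only [Module.End.mul_apply, LinearMap.sub_apply, mulOp_apply] at h1
      have h3 := ih (insLin X ∘ₗ G)
      rw [map_add, h1, insOp_alternation, insOp_alternation, h2, map_sub, map_sub, map_smul,
        map_zero]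
      simp only [Forms.add_apply, Forms.sub_apply, Forms.smul_apply, Forms.zero_apply] at h3 ⊢
      have h4 : (extLin α ∘ₗ G) X = extOp α (G X) := rfl
      rw [h4, ← h3]
      abel
  ext1 k
  exact this k G

theorem curryLeft_extForm_zero (α : OneForm A) (η : Form A 0) (X : Vect A) :
    (extForm α 0 η).curryLeft X = α X • η := by
  ext v
  rw [AlternatingMap.curryLeft_apply_apply, extForm_apply]
  simp

theorem curryLeft_extForm_succ (α : OneForm A) {k : ℕ} (η : Form A (k + 1)) (X : Vect A) :
    (extForm α (k + 1) η).curryLeft X = α X • η - extForm α k (η.curryLeft X) := by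
  have h := congrArg (fun T : FormOp A => T (Forms.single (k + 1) η) (k + 1)) (insOp_extOp X α)
  simp only [Module.End.mul_apply, LinearMap.sub_apply, mulOp_apply, Forms.sub_apply,
    Forms.smul_apply, extOp_succ, Forms.single_same] at h
  have h1 : insOp X (extOp α (Forms.single (k + 1) η)) (k + 1) =
      (extForm α (k + 1) (Forms.single (k + 1) η (k + 1))).curryLeft X := rfl
  have h2 : insOp X (Forms.single (k + 1) η) k =
      (Forms.single (k + 1) η (k + 1)).curryLeft X := rfl
  rwa [h1, h2, Forms.single_same] at h

/-- Exterior multiplication of `η` by a `k`-form: `α₁ ∧ ⋯ ∧ α_k ↦ α_k ∧ ⋯ ∧ α₁ ∧ η`. -/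
def extRev (η : Forms A) : (k : ℕ) → Form A k →ₗ[A] Forms A
  | 0 => { toFun := fun ξ => ξ ![] • η
           map_add' := fun ξ ζ => add_smul (ξ ![]) (ζ ![]) η
           map_smul' := fun f ξ => mul_smul f (ξ ![]) η }
  | k + 1 =>
    -- On a product of `k + 1` one-forms the alternation has `k + 1` equal terms, hence the
    -- division. In the term that splits off the first factor, this factor stands in front of `k`
    -- others instead of behind them, hence the sign.
    { toFun := fun ξ => ((-1) ^ k * ((k + 1 : ℕ) : ℝ)⁻¹) •
        alternation (extRev η k ∘ₗ ξ.curryLeft)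
      map_add' := fun ξ ζ => by
        rw [AlternatingMap.curryLeft_add, LinearMap.comp_add, map_add, smul_add]
      map_smul' := fun f ξ => by
        rw [AlternatingMap.curryLeft_smul, LinearMap.comp_smul, map_smul, smul_comm,
          RingHom.id_apply] }

theorem extRev_succ (η : Forms A) (k : ℕ) (ξ : Form A (k + 1)) :
    extRev η (k + 1) ξ = ((-1) ^ k * ((k + 1 : ℕ) : ℝ)⁻¹) •
        alternation (extRev η k ∘ₗ ξ.curryLeft) := rfl

theorem extOp_extRev (α : OneForm A) (η : Forms A) (k : ℕ) (ξ : Form A k) :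
    extOp α (extRev η k ξ) = (-1 : ℝ) ^ k • extRev (extOp α η) k ξ := by
  induction k with
  | zero =>
    rw [pow_zero, one_smul]
    exact (extLin α).map_smul (ξ ![]) η
  | succ k ih =>
    have h : extLin α ∘ₗ extRev η k ∘ₗ ξ.curryLeft =
        (-1 : ℝ) ^ k • (extRev (extOp α η) k ∘ₗ ξ.curryLeft) := by
      ext1 X
      exact ih (ξ.curryLeft X)
    rw [extRev_succ, extRev_succ, map_smul, extOp_alternation, h,
      (alternation (A := A)).map_smul_of_tower, pow_succ]
    module

/-- The recursion that characterizes `extRev`: the first factor of the product is the one that acts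
on `η` first. It translates cutting a multivector field into exterior multiplication of the form, as
needed to invert `star`. -/
theorem extRev_extForm (α : OneForm A) (η : Forms A) (k : ℕ) (ξ : Form A k) :
    extRev η (k + 1) (extForm α k ξ) = extRev (extOp α η) k ξ := by
  induction k with
  | zero =>
    have h : extRev η 0 ∘ₗ (extForm α 0 ξ).curryLeft = α.smulRight (extRev η 0 ξ) := by
      ext1 X
      change extRev η 0 ((extForm α 0 ξ).curryLeft X) = α X • extRev η 0 ξ
      rw [curryLeft_extForm_zero, map_smul]
    rw [extRev_succ, h, alternation_smulRight, extOp_extRev]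
    simp
  | succ k ih =>
    have h : extRev η (k + 1) ∘ₗ (extForm α (k + 1) ξ).curryLeft =
        α.smulRight (extRev η (k + 1) ξ) - extRev (extOp α η) k ∘ₗ ξ.curryLeft := by
      ext1 X
      change extRev η (k + 1) ((extForm α (k + 1) ξ).curryLeft X) =
        α X • extRev η (k + 1) ξ - extRev (extOp α η) k (ξ.curryLeft X)
      rw [curryLeft_extForm_succ, map_sub, map_smul, ih]
    have h2 : alternation (extRev (extOp α η) k ∘ₗ ξ.curryLeft) =
        ((-1) ^ k * ((k + 1 : ℕ) : ℝ)) • extRev (extOp α η) (k + 1) ξ := by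
      rw [extRev_succ, smul_smul, mul_mul_mul_comm, mul_inv_cancel₀ (by positivity), ← pow_add,
        Even.neg_one_pow ⟨k, rfl⟩, mul_one, one_smul]
    rw [extRev_succ, h, map_sub, alternation_smulRight, extOp_extRev, h2, ← sub_smul, smul_smul]
    -- Splitting off `α` contributes one and splitting off the factors of `ξ` contributes `k + 1`,
    -- which together cancel the denominator `k + 2`.
    have h3 : (-1 : ℝ) ^ (k + 1) * ((k + 1 + 1 : ℕ) : ℝ)⁻¹ *
        ((-1) ^ (k + 1) - (-1) ^ k * ((k + 1 : ℕ) : ℝ)) = 1 := by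
      have h4 : (((k + 1 + 1 : ℕ) : ℝ)) ≠ 0 := by positivity
      have h5 : ((-1 : ℝ) ^ k) ^ 2 = 1 := by rw [← pow_mul, mul_comm, pow_mul]; simp
      field_simp
      push_cast
      linear_combination (k + 2 : ℝ) * h5
    rw [h3, one_smul]

end Alternatization

/-! ### Multivector fields as forms by means of the volume form. -/

section Star

variable {A : Type*} [CommRing A] [Algebra ℝ A] {n : ℕ}

/-- `μ` freely generates the top degree forms, on an algebra of functions with frames. -/
structure IsVolume (μ : Form A n) : Prop where
  framed : Framed A n
  bij : Function.Bijective fun a : A => a • μ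

/-- The signs `(-1)^(k (k - 1) / 2)`. -/
def starSign : ℕ → ℤ
  | 0 => 1
  | k + 1 => (-1) ^ k * starSign k

theorem starSign_mul_self (k : ℕ) : starSign k * starSign k = 1 := by
  induction k with
  | zero => rfl
  | succ k ih => rw [starSign, mul_mul_mul_comm, ih, ← pow_add, Even.neg_one_pow ⟨k, rfl⟩, one_mul]

/-- Contraction of `μ` with a multivector field, with the sign for which contraction with one-forms
becomes exterior multiplication. -/
def star (μ : Form A n) (k : ℕ) : MultiVect A k →ₗ[A] Forms A where
  toFun V := starSign k • mvOp V (Forms.single n μ)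
  map_add' V W := smul_add (starSign k) (mvOp V (Forms.single n μ)) (mvOp W (Forms.single n μ))
  map_smul' f V := smul_comm (starSign k) f (mvOp V (Forms.single n μ))

theorem star_apply (μ : Form A n) {k : ℕ} (V : MultiVect A k) :
    star μ k V = starSign k • mvOp V (Forms.single n μ) := rfl

theorem mvOp_zero_eq (V : MultiVect A 0) : mvOp V = mulOp (V (wedge ![])) := by
  refine FormOp.sub_mul_ins 1 (fun X => ?_) fun η => ?_
  · have h1 := insOp_mvOp V X
    have h2 := insOp_mulOp X (V (wedge ![]))
    rw [pow_zero] at h1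
    linear_combination (norm := noncomm_ring) h1 - h2
  · ext v
    rw [mvOp_zero_apply, mulOp_apply, Forms.smul_apply, AlternatingMap.smul_apply, smul_eq_mul,
      mul_comm, ← smul_eq_mul, ← map_smul]
    congr 1
    ext w
    rw [AlternatingMap.smul_apply, wedge_zero_apply, smul_eq_mul, mul_one]
    congr 1
    exact Subsingleton.elim _ _

theorem star_zero (μ : Form A n) (V : MultiVect A 0) :
    star μ 0 V = V (wedge ![]) • Forms.single n μ := by
  rw [star_apply, mvOp_zero_eq]
  exact one_smul ℤ _

theorem star_eq_zero_of_ne (μ : Form A n) {k m : ℕ} (h : k + m ≠ n) (V : MultiVect A k) :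
    star μ k V m = 0 := by
  rw [star_apply, Forms.zsmul_apply]
  convert smul_zero _
  ext v
  rw [mvOp_apply_apply, Forms.single_of_ne h]
  exact map_zero V

namespace IsVolume

variable {μ : Form A n}

theorem forms_apply_eq_zero (hμ : IsVolume μ) (η : Forms A) {k : ℕ} (hk : n < k) : η k = 0 :=
  hμ.framed.form_eq_zero hk _

theorem extOp_top (hμ : IsVolume μ) (α : OneForm A) (ν : Form A n) :
    extOp α (Forms.single n ν) = 0 := by
  ext1 k
  rcases Nat.lt_or_ge n k with hk | hk
  · exact hμ.forms_apply_eq_zero _ hk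
  · cases k with
    | zero => rfl
    | succ k => rw [extOp_succ, Forms.single_of_ne (by omega), map_zero]; rfl

theorem dOp_top (hμ : IsVolume μ) (ν : Form A n) : dOp (Forms.single n ν) = 0 := by
  ext1 k
  rcases Nat.lt_or_ge n k with hk | hk
  · exact hμ.forms_apply_eq_zero _ hk
  · cases k with
    | zero => rfl
    | succ k => rw [dOp_succ, Forms.single_of_ne (by omega), map_zero]; rfl

/-- Since α ∧ μ = 0, `mvOp_extOp` leaves ι_{cut V α} μ = (-1)^k α ∧ ι_V μ, and (-1)^k is the ratio
of consecutive values of `starSign`. -/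
theorem extOp_star (hμ : IsVolume μ) {k : ℕ} (V : MultiVect A (k + 1)) (α : OneForm A) :
    extOp α (star μ (k + 1) V) = star μ k (cut V α) := by
  have h := congrArg (fun T : FormOp A => T (Forms.single n μ)) (mvOp_extOp V α)
  simp only [Module.End.mul_apply, LinearMap.add_apply, hμ.extOp_top, map_zero,
    LinearMap.smul_apply] at h
  rw [eq_comm, add_comm, ← eq_neg_iff_add_eq_zero] at h
  rw [star_apply, star_apply, h, starSign, map_zsmul, ← neg_smul, smul_smul]
  congr 1
  ring

theorem extOp_star_zero (hμ : IsVolume μ) (V : MultiVect A 0) (α : OneForm A) :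
    extOp α (star μ 0 V) = 0 := by
  rw [star_zero, FormOp.map_smul_of_mulOp (extOp_mulOp α), hμ.extOp_top, smul_zero]

theorem smul_single_eq_zero (hμ : IsVolume μ) {f : A} (h : f • Forms.single n μ = 0) : f = 0 := by
  refine hμ.bij.1 ?_
  have := congrArg (fun η : Forms A => η n) h
  simpa [Forms.single_same] using this

theorem star_injective (hμ : IsVolume μ) (k : ℕ) : Function.Injective (star μ k) := by
  rw [injective_iff_map_eq_zero]
  induction k with
  | zero =>
    intro V hV
    rw [star_zero] at hV
    ext ξ
    have h : ξ = ξ ![] • wedge ![] := by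
      ext v
      rw [AlternatingMap.smul_apply, wedge_zero_apply, smul_eq_mul, mul_one]
      congr 1
      exact Subsingleton.elim _ _
    rw [h, map_smul, hμ.smul_single_eq_zero hV, smul_zero]; rfl
  | succ k ih =>
    intro V hV
    refine hμ.framed.multiVect_eq_zero_of_cut fun f => ih _ ?_
    rw [← hμ.extOp_star, hV, map_zero]

/-- The coefficient of a top degree form with respect to `μ`. -/
def coeff (hμ : IsVolume μ) : Form A n →ₗ[A] A :=
  (LinearEquiv.ofBijective (LinearMap.toSpanSingleton A (Form A n) μ) hμ.bij).symm

theorem coeff_smul (hμ : IsVolume μ) (ν : Form A n) : hμ.coeff ν • μ = ν :=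
  (LinearEquiv.ofBijective (LinearMap.toSpanSingleton A (Form A n) μ) hμ.bij).apply_symm_apply ν

/-- The preimage of `η` sends ξ to the coefficient of (ξ reversed) ∧ η with respect to μ.
Multiplying both sides by an arbitrary one-form lowers `k` by one, and forms below top degree are
determined by such products. -/
theorem star_coeff_extRev (hμ : IsVolume μ) (k : ℕ) (η : Forms A)
    (hη : ∀ m, k + m ≠ n → η m = 0) :
    star μ k (hμ.coeff ∘ₗ Forms.proj n ∘ₗ extRev η k) = η := by
  induction k generalizing η with
  | zero =>
    have h : (hμ.coeff ∘ₗ Forms.proj n ∘ₗ extRev η 0) (wedge ![]) = hμ.coeff (η n) := by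
      change hμ.coeff (((wedge ![] : Form A 0) ![] • η) n) = _
      rw [wedge_zero_apply, one_smul]
    rw [star_zero, h]
    ext1 m
    rw [Forms.smul_apply]
    by_cases hm : m = n
    · subst hm
      rw [Forms.single_same, coeff_smul]
    · rw [Forms.single_of_ne hm, hη m (by omega), smul_zero]
  | succ k ih =>
    set V : MultiVect A (k + 1) := hμ.coeff ∘ₗ Forms.proj n ∘ₗ extRev η (k + 1)
    have hcut : ∀ α, cut V α = hμ.coeff ∘ₗ Forms.proj n ∘ₗ extRev (extOp α η) k := fun α => by
      ext1 ξ
      exact congrArg (fun ζ : Forms A => hμ.coeff (ζ n)) (extRev_extForm α η k ξ)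
    ext1 m
    by_cases hm : k + 1 + m = n
    · rw [← sub_eq_zero, ← Forms.sub_apply]
      refine hμ.framed.form_eq_zero_of_extOp (by omega) fun α => ?_
      rw [map_sub, hμ.extOp_star, hcut, ih, sub_self, Forms.zero_apply]
      intro j hj
      cases j with
      | zero => rfl
      | succ j => rw [extOp_succ, hη j (by omega), map_zero]
    · rw [star_eq_zero_of_ne μ hm, hη m hm]

theorem exists_star_eq (hμ : IsVolume μ) {k : ℕ} {η : Forms A} (hη : ∀ m, k + m ≠ n → η m = 0) :
    ∃ V, star μ k V = η :=
  ⟨_, hμ.star_coeff_extRev k η hη⟩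

/-- Surjectivity of `star` onto forms of the right degree gives the values of the transported
operator, injectivity its linearity. -/
theorem exists_lift (hμ : IsVolume μ) {j k : ℕ} (T : FormOp A)
    (hT : ∀ η : Forms A, (∀ m, j + m ≠ n → η m = 0) → ∀ m, k + m ≠ n → T η m = 0) :
    ∃ B : MultiVect A j →ₗ[ℝ] MultiVect A k, ∀ V, star μ k (B V) = T (star μ j V) := by
  choose B hB using fun V => hμ.exists_star_eq (hT (star μ j V) fun m hm =>
    star_eq_zero_of_ne μ hm V)
  refine ⟨⟨⟨B, fun V W => hμ.star_injective k ?_⟩, fun r V => hμ.star_injective k ?_⟩, hB⟩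
  · rw [map_add, hB, hB, hB, map_add, map_add]
  · rw [hB, RingHom.id_apply, (star μ k).map_smul_of_tower, (star μ j).map_smul_of_tower, hB,
      map_smul]

end IsVolume
end Star

/-! ### The operator [d, ι_π], the canonical representation and the modular vector field. -/

section Poisson

variable {A : Type*} [CommRing A] [Algebra ℝ A] {n : ℕ}

theorem anchor_apply (π : MultiVect A 2) (α : OneForm A) (f : A) :
    anchor π α f = π (wedge ![α, dFun f]) := rfl

theorem wedge_one (β : OneForm A) : wedge ![β] = β.toForm := by
  ext v
  rw [wedge_vecCons, extForm_apply]
  simp [wedge_zero_apply, OneForm.toForm_apply]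

theorem wedge_two (α β : OneForm A) : wedge ![α, β] = extForm α 1 β.toForm := by
  rw [wedge_vecCons, wedge_one]

theorem wedge_two_swap (α β : OneForm A) : wedge ![α, β] = - wedge ![β, α] := by
  ext v
  rw [AlternatingMap.neg_apply, wedge_two_apply, wedge_two_apply]
  ring

theorem OneForm.toForm_add (α β : OneForm A) : (α + β).toForm = α.toForm + β.toForm := rfl

theorem OneForm.toForm_smul (f : A) (α : OneForm A) :
    OneForm.toForm (f • α) = f • α.toForm := rfl

theorem Framed.apply_anchor (hA : Framed A n) (π : MultiVect A 2) (α β : OneForm A) :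
    β (anchor π α) = π (wedge ![α, β]) := by
  have := hA.oneForm_hom_ext
    (c := { toFun := fun β => β (anchor π α), map_add' := fun _ _ => rfl
            map_smul' := fun _ _ => rfl })
    (e := { toFun := fun β => π (wedge ![α, β])
            map_add' := fun β γ => by simp only [wedge_two, OneForm.toForm_add, map_add]
            map_smul' := fun f β => by
              simp only [wedge_two, OneForm.toForm_smul, map_smul, RingHom.id_apply] })
    fun f => anchor_apply π α f
  exact LinearMap.congr_fun this β

theorem Framed.poisson_extOp (hA : Framed A n) (π : MultiVect A 2) (α : OneForm A) :
    mvOp π * extOp α = extOp α * mvOp π + insOp (anchor π α) := by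
  have h : mvOp (cut π α) = insOp (anchor π α) := by
    refine mvOp_one_eq fun η => ?_
    obtain ⟨β, hβ⟩ : ∃ β : OneForm A, η 1 = β.toForm :=
      ⟨(AlternatingMap.ofSubsingleton A (Vect A) A (0 : Fin 1)).symm (η 1),
        (Equiv.apply_symm_apply _ _).symm⟩
    rw [hβ, cut_apply, ← wedge_two, ← hA.apply_anchor]
    rfl
  rw [mvOp_extOp, h]
  simp

/-- The Koszul-Brylinski operator `[d, ι_π]`. -/
def brylinski (π : MultiVect A 2) : FormOp A := dOp * mvOp π - mvOp π * dOp

/-- The extension of the canonical representation to an operator on all forms. -/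
def repOp (π : MultiVect A 2) (α : OneForm A) : FormOp A :=
  lieOp (anchor π α) - (mvOp π * extDOp α - extDOp α * mvOp π)

/-- The commutator of ι_π with α ∧ · is contraction with the anchor of α; commuting further with d
produces its Lie derivative by Cartan's formula, and the terms with dα form the rest of `repOp`. -/
theorem Framed.brylinski_extOp (hA : Framed A n) (π : MultiVect A 2) (α : OneForm A) :
    extOp α * brylinski π = repOp π α - brylinski π * extOp α := by
  have h1 := hA.poisson_extOp π α
  have h2 := lieOp_eq (anchor π α)
  rw [repOp, brylinski, extDOp]
  linear_combination (norm := noncomm_ring) dOp * h1 + h1 * dOp - h2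

/-- The Lie derivative of β along the anchor of α gives the first two terms of the Koszul bracket.
Commuting β ∧ · with the bracket of ι_π and dα ∧ · contracts dα with the anchor of β, which gives
the third. -/
theorem Framed.repOp_extOp (hA : Framed A n) (π : MultiVect A 2) (α β : OneForm A) :
    repOp π α * extOp β = extOp β * repOp π α + extOp (koszulBracket π α β) := by
  have h1 := hA.poisson_extOp π β
  have h2 := lieOp_extOp (anchor π α) β
  have h3 := insOp_extDOp (anchor π β) α
  have h4 := extDOp_extOp α β
  rw [lieOneForm_eq, hA.apply_anchor, extOp_add] at h2
  rw [koszulBracket, extOp_sub, extOp_add, repOp]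
  linear_combination (norm := noncomm_ring) h2 - mvOp π * h4 - h1 * extDOp α + extDOp α * h1 - h3 +
    h4 * mvOp π

theorem repOp_mulOp (π : MultiVect A 2) (α : OneForm A) (f : A) :
    repOp π α * mulOp f = mulOp f * repOp π α + mulOp (anchor π α f) := by
  have h1 := lieOp_mulOp (anchor π α) f
  have h2 := mvOp_mulOp π f
  have h3 := extDOp_mulOp α f
  rw [repOp]
  linear_combination (norm := noncomm_ring) h1 - mvOp π * h3 - h2 * extDOp α + extDOp α * h2 +
    h3 * mvOp π

/-- The form `η` is concentrated in degree `n - k`. -/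
def HasCodegree (n k : ℕ) (η : Forms A) : Prop := ∀ m, k + m ≠ n → η m = 0

theorem HasCodegree.sub {k : ℕ} {η ζ : Forms A} (hη : HasCodegree n k η)
    (hζ : HasCodegree n k ζ) : HasCodegree n k (η - ζ) := fun m hm => by
  rw [Forms.sub_apply, hη m hm, hζ m hm, sub_zero]

theorem HasCodegree.dOp {k : ℕ} {η : Forms A} (hη : HasCodegree n (k + 1) η) :
    HasCodegree n k (dOp η) := fun m hm => by
  cases m with
  | zero => rfl
  | succ m => rw [dOp_succ, hη m (by omega), map_zero]

theorem HasCodegree.insOp {k : ℕ} {η : Forms A} (hη : HasCodegree n k η) (X : Vect A) :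
    HasCodegree n (k + 1) (insOp X η) := fun m hm => by
  change (η (m + 1)).curryLeft X = 0
  rw [hη (m + 1) (by omega)]; rfl

theorem HasCodegree.mvOp {j k : ℕ} {η : Forms A} (hη : HasCodegree n k η) (V : MultiVect A j) :
    HasCodegree n (k + j) (mvOp V η) := fun m hm => by
  ext v
  rw [mvOp_apply_apply, hη (j + m) (by omega)]
  exact map_zero V

theorem HasCodegree.single (ν : Form A n) : HasCodegree n 0 (Forms.single n ν) := fun m hm =>
  Forms.single_of_ne (by omega) ν

theorem HasCodegree.brylinski {k : ℕ} {η : Forms A} (hη : HasCodegree n k η) (π : MultiVect A 2)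
    (hA : Framed A n) : HasCodegree n (k + 1) (brylinski π η) := by
  refine HasCodegree.sub (hη.mvOp π).dOp ?_
  cases k with
  -- In codegree zero the form dη has degree n + 1, hence vanishes; there is no codegree -1 to
  -- express this.
  | zero =>
    have : HasCodegree n (0 + 1) (PoissonCohomology.mvOp π 0 : Forms A) := fun m _ => by simp
    have h0 : PoissonCohomology.dOp η = 0 := by
      ext1 m
      rcases Nat.lt_or_ge n m with hm | hm
      · exact hA.form_eq_zero hm _
      · cases m with
        | zero => rfl
        | succ m => rw [dOp_succ, hη m (by omega), map_zero]; rfl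
    rw [Module.End.mul_apply, h0]
    exact this
  | succ k => exact hη.dOp.mvOp π

theorem HasCodegree.eq_zero {k : ℕ} {η : Forms A} (hη : HasCodegree n (k + 1) η)
    (hA : Framed A n) (h : ∀ α, PoissonCohomology.extOp α η = 0) : η = 0 := by
  ext1 m
  by_cases hm : k + 1 + m = n
  · exact hA.form_eq_zero_of_extOp (by omega) fun α => by rw [h]; rfl
  · exact hη m hm

theorem deRham_smul (f : A) (k : ℕ) (η : Form A k) :
    deRham k (f • η) = f • deRham k η + extForm (dFun f) k η := by
  have h := congrArg (fun T : FormOp A => T (Forms.single k η) (k + 1)) (dOp_mulOp f)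
  simpa only [Module.End.mul_apply, LinearMap.add_apply, mulOp_apply, Forms.add_apply,
    Forms.smul_apply, dOp_succ, extOp_succ, Forms.single_same] using h

theorem lieForm_extForm (X : Vect A) (α : OneForm A) (k : ℕ) (η : Form A k) :
    (lieForm X (k + 1)).op (extForm α k η) =
      extForm α k ((lieForm X k).op η) + extForm ((lieOneForm X).op α) k η := by
  have h := congrArg (fun T : FormOp A => T (Forms.single k η) (k + 1)) (lieOp_extOp X α)
  simpa only [Module.End.mul_apply, LinearMap.add_apply, Forms.add_apply, lieOp_apply, extOp_succ,
    Forms.single_same] using h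

theorem deRham_dFun (f : A) : deRham 1 (dFun f).toForm = 0 := by
  ext v
  have h := contract_deRham_apply (dFun f) (v 0) (v 1)
  have hv : v = ![v 0, v 1] := by funext i; fin_cases i <;> rfl
  rw [hv]
  refine h.trans ?_
  simp [Derivation.commutator_apply]

theorem lieOneForm_dFun (X : Vect A) (f : A) : (lieOneForm X).op (dFun f) = dFun (X f) := by
  ext Y
  simp [lieOneForm_apply, Derivation.commutator_apply]

theorem lieOp_single (X : Vect A) (ν : Form A n) :
    lieOp X (Forms.single n ν) = Forms.single n ((lieForm X n).op ν) := by
  ext1 m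
  rw [lieOp_apply]
  by_cases hm : m = n
  · subst hm; rw [Forms.single_same, Forms.single_same]
  · rw [Forms.single_of_ne hm, Forms.single_of_ne hm, map_zero]

theorem Forms.smul_single (f : A) (ν : Form A n) :
    f • Forms.single n ν = Forms.single n (f • ν) := by
  ext1 m
  rw [Forms.smul_apply]
  by_cases hm : m = n
  · subst hm; rw [Forms.single_same, Forms.single_same]
  · rw [Forms.single_of_ne hm, Forms.single_of_ne hm, smul_zero]

namespace IsVolume

variable {μ : Form A n}

theorem extDOp_top (hμ : IsVolume μ) (α : OneForm A) (ν : Form A n) :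
    extDOp α (Forms.single n ν) = 0 := by
  simp [extDOp, hμ.extOp_top, hμ.dOp_top]

/-- The difference of the two sides is linear over functions in α: the term df ∧ α ∧ ι_π ν arising
from d(fα) equals π(df ∧ α) ν. It vanishes on exact one-forms, hence on all. -/
theorem extDOp_mvOp_top (hμ : IsVolume μ) (π : MultiVect A 2) (α : OneForm A) (ν : Form A n) :
    extDOp α (mvOp π (Forms.single n ν)) = π (deRham 1 α.toForm) • Forms.single n ν := by
  have hee : ∀ (α : OneForm A) f, extOp (dFun f) (extOp α (mvOp π (Forms.single n ν))) =
      - (anchor π α f • Forms.single n ν) := fun α f => by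
    have h1 := congrArg (fun T : FormOp A => T (Forms.single n ν)) (hμ.framed.poisson_extOp π α)
    have h2 := congrArg (fun T : FormOp A => T (Forms.single n ν))
      (insOp_extOp (anchor π α) (dFun f))
    simp only [Module.End.mul_apply, LinearMap.add_apply, LinearMap.sub_apply, hμ.extOp_top,
      map_zero, mulOp_apply, dFun_apply] at h1 h2
    rw [eq_neg_of_add_eq_zero_left h1.symm, map_neg, ← sub_eq_zero.1 h2.symm]
  let G : OneForm A →ₗ[A] Forms A :=
    { toFun := fun α => extDOp α (mvOp π (Forms.single n ν)) -
        π (deRham 1 α.toForm) • Forms.single n ν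
      map_add' := fun α β => by
        rw [extDOp_add, OneForm.toForm_add, map_add, map_add, LinearMap.add_apply, add_smul]
        abel
      map_smul' := fun f α => by
        have h1 : anchor π α f = - π (extForm (dFun f) 1 α.toForm) := by
          rw [anchor_apply, wedge_two_swap, map_neg, wedge_two]
        rw [extDOp_smul, OneForm.toForm_smul, deRham_smul, map_add, map_smul, LinearMap.add_apply,
          Module.End.mul_apply, Module.End.mul_apply, hee, h1, mulOp_apply, RingHom.id_apply,
          smul_eq_mul]
        module }
  have hG : G = 0 := by
    ext α k v
    have := hμ.framed.oneForm_hom_ext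
      (c := { toFun := fun α => G α k v
              map_add' := fun α β => by rw [map_add]; rfl
              map_smul' := fun f α => by rw [map_smul]; rfl })
      (e := 0) fun f => by
        change (extDOp (dFun f) (mvOp π (Forms.single n ν)) -
          π (deRham 1 (dFun f).toForm) • Forms.single n ν) k v = 0
        rw [extDOp_dFun, deRham_dFun, map_zero, zero_smul, LinearMap.zero_apply, sub_zero]
        rfl
    exact LinearMap.congr_fun this α
  exact sub_eq_zero.1 (LinearMap.congr_fun hG α)

/-- For a top-degree form dα ∧ ν = 0, so the commutator in `repOp` contributes exactly (π, dα) ν. -/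
theorem repOp_top (hμ : IsVolume μ) (π : MultiVect A 2) (α : OneForm A) (ν : Form A n) :
    repOp π α (Forms.single n ν) = Forms.single n ((canonicalRep π n α).op ν) := by
  have h : (canonicalRep π n α).op ν =
      (lieForm (anchor π α) n).op ν + π (deRham 1 α.toForm) • ν := rfl
  rw [repOp, h]
  simp only [LinearMap.sub_apply, Module.End.mul_apply, hμ.extDOp_top, map_zero,
    hμ.extDOp_mvOp_top, lieOp_single, Forms.smul_single, zero_sub, sub_neg_eq_add]
  exact (map_add (LinearMap.single A (fun k => Form A k) n) _ _).symm

theorem extOp_brylinski (hμ : IsVolume μ) (π : MultiVect A 2) (α : OneForm A) :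
    extOp α (brylinski π (Forms.single n μ)) =
      Forms.single n ((canonicalRep π n α).op μ) := by
  have h := congrArg (fun T : FormOp A => T (Forms.single n μ))
    (hμ.framed.brylinski_extOp π α)
  simpa only [Module.End.mul_apply, LinearMap.sub_apply, hμ.extOp_top, map_zero, sub_zero,
    hμ.repOp_top] using h

theorem smul_cancel (hμ : IsVolume μ) {f g : A} (h : f • μ = g • μ) : f = g := hμ.bij.1 h

/-- As D_α μ = α ∧ [d, ι_π] μ, its coefficient is linear over functions in α. Restricted to exact
one-forms such a functional is a derivation, which is θ. -/
theorem existsUnique_modularVectorField (hμ : IsVolume μ) (π : MultiVect A 2) :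
    ∃! θ, IsModularVectorField π μ θ := by
  let c : OneForm A →ₗ[A] A :=
    { toFun := fun α => hμ.coeff (extOp α (brylinski π (Forms.single n μ)) n)
      map_add' := fun α β => by
        rw [extOp_add, LinearMap.add_apply, Forms.add_apply, map_add]
      map_smul' := fun f α => by
        rw [extOp_smul, Module.End.mul_apply, mulOp_apply, Forms.smul_apply, map_smul]
        rfl }
  have hc : ∀ α, (canonicalRep π n α).op μ = c α • μ := fun α => by
    change _ = hμ.coeff (extOp α (brylinski π (Forms.single n μ)) n) • μ
    rw [hμ.coeff_smul, hμ.extOp_brylinski, Forms.single_same]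
  have hd : ∀ f g : A, dFun (f * g) = f • dFun g + g • dFun f := fun f g => by
    ext X; simp
  let θ : Vect A := Derivation.mk'
    { toFun := fun f => c (dFun f)
      map_add' := fun f g => by
        rw [← map_add]; congr 1; ext X; simp
      map_smul' := fun r f => by
        rw [RingHom.id_apply, ← LinearMap.map_smul_of_tower]; congr 1; ext X; simp }
    fun f g => by
      change c (dFun (f * g)) = f • c (dFun g) + g • c (dFun f)
      rw [hd, map_add, map_smul, map_smul]
  have hθ : ∀ α : OneForm A, c α = α θ := LinearMap.congr_fun (hμ.framed.oneForm_hom_ext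
    (c := c) (e := { toFun := fun α => α θ, map_add' := fun _ _ => rfl
                     map_smul' := fun _ _ => rfl }) fun f => rfl)
  refine ⟨θ, fun α => by rw [hc, hθ], fun θ' hθ' => ?_⟩
  ext1 f
  refine hμ.smul_cancel ?_
  have := hθ' (dFun f)
  rw [hc, hθ] at this
  exact this.symm

section Modular

variable {π : MultiVect A 2} {θ : Vect A}

theorem repOp_vol (hμ : IsVolume μ) (hθ : IsModularVectorField π μ θ) (α : OneForm A) :
    repOp π α (Forms.single n μ) = α θ • Forms.single n μ := by
  rw [hμ.repOp_top, hθ, Forms.smul_single]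

/-- Both sides have degree n - 1 and become α(θ) μ after exterior multiplication by any α. -/
theorem insOp_modular (hμ : IsVolume μ) (hθ : IsModularVectorField π μ θ) :
    insOp θ (Forms.single n μ) = brylinski π (Forms.single n μ) := by
  rw [← sub_eq_zero]
  refine HasCodegree.eq_zero (n := n) (k := 0)
    (((HasCodegree.single μ).insOp θ).sub ((HasCodegree.single μ).brylinski π hμ.framed))
    hμ.framed fun α => ?_
  have h := congrArg (fun T : FormOp A => T (Forms.single n μ)) (insOp_extOp θ α)
  simp only [Module.End.mul_apply, LinearMap.sub_apply, hμ.extOp_top, map_zero, mulOp_apply] at h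
  rw [map_sub, hμ.extOp_brylinski, hθ, ← Forms.smul_single, ← sub_eq_zero.1 h.symm, sub_self]

/-- L_θ μ = d ι_θ μ = d d ι_π μ = 0. -/
theorem lieOp_modular (hμ : IsVolume μ) (hθ : IsModularVectorField π μ θ) :
    lieOp θ (Forms.single n μ) = 0 := by
  have h : ∀ η : Forms A, dOp (dOp η) = 0 := fun η =>
    congrArg (fun T : FormOp A => T η) dOp_dOp
  simp only [lieOp_eq, LinearMap.add_apply, Module.End.mul_apply, hμ.dOp_top, map_zero, add_zero,
    hμ.insOp_modular hθ, brylinski, LinearMap.sub_apply, h, sub_zero]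

theorem lieForm_modular (hμ : IsVolume μ) (hθ : IsModularVectorField π μ θ) :
    (lieForm θ n).op μ = 0 := by
  have h := hμ.lieOp_modular hθ
  rw [lieOp_single] at h
  have := congrArg (fun η : Forms A => η n) h
  simpa [Forms.single_same] using this

end Modular
end IsVolume

theorem Framed.multiVect_ext (hA : Framed A n) {k : ℕ} {V W : MultiVect A k}
    (h : ∀ f : Fin k → A, V (wedge fun i => dFun (f i)) = W (wedge fun i => dFun (f i))) :
    V = W := by
  rw [← sub_eq_zero]
  have key : ∀ (k : ℕ) (V : MultiVect A k), (∀ f : Fin k → A, V (wedge fun i => dFun (f i)) = 0) →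
      V = 0 := by
    intro k
    induction k with
    | zero =>
      intro V hV
      ext ξ
      have h : ξ = ξ ![] • wedge fun i => dFun ((![] : Fin 0 → A) i) := by
        ext v
        rw [AlternatingMap.smul_apply, wedge_zero_apply, smul_eq_mul, mul_one]
        congr 1
        exact Subsingleton.elim _ _
      rw [h, map_smul, hV, smul_zero]; rfl
    | succ k ih =>
      intro V hV
      refine hA.multiVect_eq_zero_of_cut fun f => ih _ fun g => ?_
      rw [cut_apply, ← wedge_vecCons, ← hV (Matrix.vecCons f g)]
      congr 2
      funext i
      refine Fin.cases ?_ (fun i => ?_) i <;> rfl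
  exact key k _ fun f => by rw [LinearMap.sub_apply, h, sub_self]

section Invariance

variable {π : MultiVect A 2}

/-- The Jacobi identity, restated for Hamiltonian vector fields; it enters the proof only here. -/
theorem anchor_poissonBracket (hπ : IsPoisson π) (f g : A) :
    anchor π (dFun (poissonBracket π f g)) = ⁅anchor π (dFun f), anchor π (dFun g)⁆ := by
  have hs : ∀ f g, poissonBracket π f g = - poissonBracket π g f := fun f g => by
    rw [poissonBracket, wedge_two_swap, map_neg]; rfl
  ext h
  rw [Derivation.commutator_apply]
  change poissonBracket π (poissonBracket π f g) h =
    poissonBracket π f (poissonBracket π g h) - poissonBracket π g (poissonBracket π f h)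
  have h1 := hπ f g h
  have h2 : poissonBracket π g (poissonBracket π f h) =
      - poissonBracket π g (poissonBracket π h f) := by
    rw [hs f h]
    change anchor π (dFun g) (- _) = - anchor π (dFun g) _
    rw [map_neg]
  rw [hs (poissonBracket π f g) h, h2]
  linear_combination -h1

/-- For the Hamiltonian field X_f = `anchor π (dFun f)` one has L_{X_f} μ = θ(f) μ. Applying the Lie
derivative along X_{{f,g}} = [X_f, X_g] to μ gives θ{f,g} = {f, θg} + {θf, g}, which is L_θ π = 0 on
pairs of exact one-forms. -/
theorem IsVolume.lieMultiVect_modular {μ : Form A n} (hμ : IsVolume μ) (hπ : IsPoisson π)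
    {θ : Vect A} (hθ : IsModularVectorField π μ θ) : (lieMultiVect θ 2).op π = 0 := by
  have hL : ∀ f, (lieForm (anchor π (dFun f)) n).op μ = θ f • μ := fun f => by
    have h := hθ (dFun f)
    change (lieForm (anchor π (dFun f)) n).op μ + π (deRham 1 (dFun f).toForm) • μ = _ at h
    rwa [deRham_dFun, map_zero, zero_smul, add_zero] at h
  have hLL : ∀ X Y : Vect A, (lieForm ⁅X, Y⁆ n).op μ =
      (lieForm X n).op ((lieForm Y n).op μ) - (lieForm Y n).op ((lieForm X n).op μ) :=
    fun X Y => by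
      have h := congrArg (fun T : FormOp A => T (Forms.single n μ) n) (lieOp_lieOp X Y)
      simp only [Module.End.mul_apply, LinearMap.add_apply, Forms.add_apply, lieOp_apply,
        Forms.single_same] at h
      rw [h]; abel
  have hbr : ∀ f g, θ (poissonBracket π f g) =
      anchor π (dFun f) (θ g) - anchor π (dFun g) (θ f) := fun f g => by
    refine hμ.smul_cancel ?_
    rw [← hL, anchor_poissonBracket hπ, hLL, hL, hL, DerOver.op_smul, DerOver.op_smul, hL, hL]
    module
  refine hμ.framed.multiVect_ext fun f => ?_
  have hf : (fun i => dFun (f i)) = ![dFun (f 0), dFun (f 1)] := by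
    funext i; fin_cases i <;> rfl
  have hw : (lieForm θ 2).op (wedge ![dFun (f 0), dFun (f 1)]) =
      wedge ![dFun (f 0), dFun (θ (f 1))] + wedge ![dFun (θ (f 0)), dFun (f 1)] := by
    have h1 : ∀ β : OneForm A, (lieForm θ 1).op β.toForm = ((lieOneForm θ).op β).toForm := by
      intro β
      ext v
      rw [lieForm_op_apply]
      simp [OneForm.toForm_apply, lieOneForm_apply]
    rw [wedge_two, lieForm_extForm, h1, lieOneForm_dFun, lieOneForm_dFun, wedge_two, wedge_two]
  rw [hf]
  change θ (π (wedge ![dFun (f 0), dFun (f 1)])) -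
    π ((lieForm θ 2).op (wedge ![dFun (f 0), dFun (f 1)])) = 0
  rw [hw, map_add, wedge_two_swap (dFun (θ (f 0))), map_neg]
  have := hbr (f 0) (f 1)
  rw [anchor_apply, anchor_apply] at this
  rw [← sub_eq_add_neg, ← this]
  exact sub_self _

end Invariance
end Poisson

/-! ### The differential d_N on forms and the homotopy identity. -/

section Twisted

variable {A : Type*} [CommRing A] [Algebra ℝ A] {n : ℕ}

/-- The operator on forms which corresponds to the differential with coefficients in `K^N`. -/
def twistedOp (π : MultiVect A 2) (θ : Vect A) (N : ℤ) : FormOp A :=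
  brylinski π + (N - 1) • insOp θ

/-- The anticommutator of `twistedOp` with exterior multiplication by `α`. -/
def twistedRepOp (π : MultiVect A 2) (θ : Vect A) (N : ℤ) (α : OneForm A) : FormOp A :=
  repOp π α + (N - 1) • mulOp (α θ)

/-- The representation on `K^N` in the trivialization given by a volume form with modular vector
field `θ`. -/
def twistedRep (π : MultiVect A 2) (θ : Vect A) (N : ℤ) (α : OneForm A) : A →+ A where
  toFun f := anchor π α f + N • (α θ * f)
  map_zero' := by simp
  map_add' f g := by simp [mul_add]; ring

theorem twistedRep_apply (π : MultiVect A 2) (θ : Vect A) (N : ℤ) (α : OneForm A) (f : A) :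
    twistedRep π θ N α f = anchor π α f + N • (α θ * f) := rfl

variable {π : MultiVect A 2} {θ : Vect A} {N : ℤ}

theorem Framed.extOp_twistedOp (hA : Framed A n) (α : OneForm A) :
    extOp α * twistedOp π θ N = twistedRepOp π θ N α - twistedOp π θ N * extOp α := by
  have h1 := hA.brylinski_extOp π α
  have h2 := insOp_extOp θ α
  rw [twistedOp, twistedRepOp]
  generalize N - 1 = c
  simp only [mul_add, add_mul, mul_smul_comm, smul_mul_assoc, h1, h2, smul_sub]
  abel

theorem Framed.twistedRepOp_extOp (hA : Framed A n) (α β : OneForm A) :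
    twistedRepOp π θ N α * extOp β =
      extOp β * twistedRepOp π θ N α + extOp (koszulBracket π α β) := by
  have h1 := hA.repOp_extOp π α β
  have h2 := extOp_mulOp β (α θ)
  rw [twistedRepOp]
  generalize N - 1 = c
  simp only [mul_add, add_mul, mul_smul_comm, smul_mul_assoc, h1, h2]
  abel

/-- Because d² = 0, d anticommutes with [d, ι_π]; only the Cartan formula for ι_θ remains. Up to
sign this is the homotopy identity. -/
theorem dOp_twistedOp :
    dOp * twistedOp π θ N + twistedOp π θ N * dOp = (N - 1) • lieOp θ := by
  have h1 : dOp * brylinski π + brylinski π * dOp = 0 := by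
    have h := dOp_dOp (A := A)
    rw [brylinski]
    linear_combination (norm := noncomm_ring) h * mvOp π - mvOp π * h
  rw [twistedOp, lieOp_eq]
  generalize N - 1 = c
  simp only [mul_add, add_mul, mul_smul_comm, smul_mul_assoc, smul_add]
  rw [add_add_add_comm, h1, zero_add]

theorem lieOp_twistedOp (h : (lieMultiVect θ 2).op π = 0) :
    lieOp θ * twistedOp π θ N = twistedOp π θ N * lieOp θ := by
  have h1 := lieOp_dOp θ
  have h2 := lieOp_mvOp π θ
  have h3 : mvOp (0 : MultiVect A 2) = 0 := by ext η m v; rfl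
  rw [h, h3, add_zero] at h2
  have h4 := lieOp_insOp θ θ
  rw [lie_self, insOp_zero, add_zero] at h4
  have h5 : lieOp θ * brylinski π = brylinski π * lieOp θ := by
    rw [brylinski]
    linear_combination (norm := noncomm_ring) h1 * mvOp π + dOp * h2 - h2 * dOp - mvOp π * h1
  rw [twistedOp]
  simp only [mul_add, add_mul, mul_smul_comm, smul_mul_assoc, h5, h4]

variable {μ : Form A n}

/-- `repOp` already contributes α(θ) on μ, so the extra N - 1 makes the coefficient N. -/
theorem IsVolume.twistedRepOp_vol (hμ : IsVolume μ) (hθ : IsModularVectorField π μ θ)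
    (α : OneForm A) (f : A) : twistedRepOp π θ N α (f • Forms.single n μ) =
      twistedRep π θ N α f • Forms.single n μ := by
  have h1 := congrArg (fun T : FormOp A => T (Forms.single n μ)) (repOp_mulOp π α f)
  simp only [Module.End.mul_apply, LinearMap.add_apply, mulOp_apply, hμ.repOp_vol hθ] at h1
  rw [twistedRepOp, LinearMap.add_apply, h1, LinearMap.smul_apply, mulOp_apply, twistedRep_apply]
  module

theorem IsVolume.twistedRepOp_wedge (hμ : IsVolume μ) (hθ : IsModularVectorField π μ θ)
    (α : OneForm A) {k : ℕ} (V W : MultiVect A k)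
    (h : star μ k W = twistedRepOp π θ N α (star μ k V)) (β : Fin k → OneForm A) :
    W (wedge β) = twistedRep π θ N α (V (wedge β)) -
      ∑ j, V (wedge (Function.update β j (koszulBracket π α (β j)))) := by
  induction k with
  | zero =>
    obtain rfl : β = ![] := Subsingleton.elim _ _
    rw [star_zero, star_zero, hμ.twistedRepOp_vol hθ, ← sub_eq_zero, ← sub_smul] at h
    simpa using sub_eq_zero.1 (hμ.smul_single_eq_zero h)
  | succ k ih =>
    have hβ : β = Matrix.vecCons (β 0) (Matrix.vecTail β) := (Matrix.cons_head_tail β).symm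
    generalize β 0 = γ at hβ
    generalize Matrix.vecTail β = β' at hβ
    subst hβ
    have h1 : star μ k (cut W γ + cut V (koszulBracket π α γ)) =
        twistedRepOp π θ N α (star μ k (cut V γ)) := by
      have h2 := congrArg (fun T : FormOp A => T (star μ (k + 1) V))
        (hμ.framed.twistedRepOp_extOp (π := π) (θ := θ) (N := N) α γ)
      simp only [Module.End.mul_apply, LinearMap.add_apply] at h2
      rw [map_add, ← hμ.extOp_star, ← hμ.extOp_star, ← hμ.extOp_star, h2, h]
    have h3 := ih _ _ h1 β'
    have h0 : Function.update (Matrix.vecCons γ β') 0 (koszulBracket π α γ) =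
      Matrix.vecCons (koszulBracket π α γ) β' := Fin.update_cons_zero ..
    have hs : ∀ j : Fin k, Function.update (Matrix.vecCons γ β') j.succ (koszulBracket π α (β' j)) =
      Matrix.vecCons γ (Function.update β' j (koszulBracket π α (β' j))) :=
      fun j => (Fin.cons_update ..).symm
    rw [Fin.sum_univ_succ]
    simp only [Matrix.cons_val_zero, Matrix.cons_val_succ, h0, hs, wedge_vecCons]
    simp only [LinearMap.add_apply, cut_apply] at h3
    rw [eq_sub_of_add_eq h3]
    ring

theorem IsVolume.extOp_twistedOp_star (hμ : IsVolume μ) (a : OneForm A) {k : ℕ}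
    (V : MultiVect A k) : extOp a (twistedOp π θ N (star μ k V)) =
      twistedRepOp π θ N a (star μ k V) - twistedOp π θ N (extOp a (star μ k V)) := by
  have h := congrArg (fun T : FormOp A => T (star μ k V))
    (hμ.framed.extOp_twistedOp (π := π) (θ := θ) (N := N) a)
  simpa only [Module.End.mul_apply, LinearMap.sub_apply] using h

theorem IsVolume.delta_wedge_zero (hμ : IsVolume μ) (hθ : IsModularVectorField π μ θ)
    {V : MultiVect A 0} {W : MultiVect A 1} (h : star μ 1 W = twistedOp π θ N (star μ 0 V))
    (a : OneForm A) (α : Fin 0 → OneForm A) :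
    W (wedge (Matrix.vecCons a α)) = twistedRep π θ N a (V (wedge α)) := by
  have h1 : star μ 0 (cut W a) = twistedRepOp π θ N a (star μ 0 V) := by
    rw [← hμ.extOp_star, h, hμ.extOp_twistedOp_star, hμ.extOp_star_zero, map_zero, sub_zero]
  have h2 := hμ.twistedRepOp_wedge hθ a _ _ h1 α
  rw [Finset.univ_eq_empty, Finset.sum_empty, sub_zero, cut_apply, ← wedge_vecCons] at h2
  exact h2

theorem IsVolume.delta_wedge_succ (hμ : IsVolume μ) (hθ : IsModularVectorField π μ θ) {k : ℕ}
    {V : MultiVect A (k + 1)} {W : MultiVect A (k + 2)} (a : OneForm A) {U : MultiVect A (k + 1)}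
    (h : star μ (k + 2) W = twistedOp π θ N (star μ (k + 1) V))
    (hU : star μ (k + 1) U = twistedOp π θ N (star μ k (cut V a)))
    (α : Fin (k + 1) → OneForm A) :
    W (wedge (Matrix.vecCons a α)) = twistedRep π θ N a (V (wedge α)) -
      ∑ j, V (wedge (Function.update α j (koszulBracket π a (α j)))) - U (wedge α) := by
  have h1 : star μ (k + 1) (cut W a + U) = twistedRepOp π θ N a (star μ (k + 1) V) := by
    rw [map_add, ← hμ.extOp_star, h, hU, hμ.extOp_twistedOp_star, ← hμ.extOp_star, sub_add_cancel]
  have h2 := hμ.twistedRepOp_wedge hθ a _ _ h1 α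
  rw [← h2, LinearMap.add_apply, cut_apply, wedge_vecCons, add_sub_cancel_right]

/-- Both sides obey the same recursion in the first argument: on the left it comes from the
anticommutator with α ∧ ·, on the right from `ceFormula_succ`. The induction passes from `V` to its
cut by the first one-form. -/
theorem IsVolume.delta_wedge (hμ : IsVolume μ) (hθ : IsModularVectorField π μ θ)
    {δ : ∀ k, MultiVect A k →ₗ[ℝ] MultiVect A (k + 1)}
    (hδ : ∀ k V, star μ (k + 1) (δ k V) = twistedOp π θ N (star μ k V)) (k : ℕ)
    (V : MultiVect A k) (α : Fin (k + 1) → OneForm A) :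
    δ k V (wedge α) = ceFormula (koszulBracket π) (fun β => twistedRep π θ N β) k
      (fun γ => V (wedge γ)) α := by
  induction k with
  | zero =>
    have h := hμ.delta_wedge_zero hθ (hδ 0 V) (α 0) (Matrix.vecTail α)
    rw [show Matrix.vecCons (α 0) (Matrix.vecTail α) = α from Matrix.cons_head_tail α] at h
    exact h
  | succ k ih =>
    have h := hμ.delta_wedge_succ hθ (α 0) (hδ _ V) (hδ _ (cut V (α 0))) (Matrix.vecTail α)
    have h1 := ceFormula_succ (koszulBracket π) (fun β => twistedRep π θ N β) k
      (fun γ => V (wedge γ)) (fun i x w => by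
        rw [wedge_insertNth, map_zsmul]) (α 0) (Matrix.vecTail α)
    rw [show Matrix.vecCons (α 0) (Matrix.vecTail α) = α from Matrix.cons_head_tail α] at h h1
    rw [h, h1, ih]
    simp only [cut_apply, wedge_vecCons]

theorem IsVolume.exists_delta (hμ : IsVolume μ) (π : MultiVect A 2) (θ : Vect A) (N : ℤ) :
    ∃ δ : ∀ k, MultiVect A k →ₗ[ℝ] MultiVect A (k + 1),
      ∀ k V, star μ (k + 1) (δ k V) = twistedOp π θ N (star μ k V) := by
  have := fun k => hμ.exists_lift (j := k) (k := k + 1) (twistedOp π θ N) fun η hη => by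
    have h1 : HasCodegree n (k + 1) (brylinski π η) := HasCodegree.brylinski hη π hμ.framed
    have h2 : HasCodegree n (k + 1) (insOp θ η) := HasCodegree.insOp hη θ
    intro m hm
    rw [twistedOp, LinearMap.add_apply, Forms.add_apply, LinearMap.smul_apply, Forms.zsmul_apply,
      h1 m hm, h2 m hm, smul_zero, add_zero]
  choose δ hδ using this
  exact ⟨δ, hδ⟩

theorem IsVolume.lieOp_star (hμ : IsVolume μ) (hθ : IsModularVectorField π μ θ) {k : ℕ}
    (V : MultiVect A k) : lieOp θ (star μ k V) = star μ k ((lieMultiVect θ k).op V) := by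
  have h := congrArg (fun T : FormOp A => T (Forms.single n μ)) (lieOp_mvOp V θ)
  simp only [Module.End.mul_apply, LinearMap.add_apply, hμ.lieOp_modular hθ, map_zero,
    zero_add] at h
  rw [star_apply, star_apply, map_zsmul, h]

theorem IsVolume.lie_delta (hμ : IsVolume μ) (hπ : IsPoisson π) (hθ : IsModularVectorField π μ θ)
    {δ : ∀ k, MultiVect A k →ₗ[ℝ] MultiVect A (k + 1)}
    (hδ : ∀ k V, star μ (k + 1) (δ k V) = twistedOp π θ N (star μ k V)) (k : ℕ)
    (V : MultiVect A k) :
    (lieMultiVect θ (k + 1)).op (δ k V) = δ k ((lieMultiVect θ k).op V) := by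
  refine hμ.star_injective _ ?_
  rw [hδ, ← hμ.lieOp_star hθ, ← hμ.lieOp_star hθ, hδ]
  exact congrArg (fun T : FormOp A => T (star μ k V))
    (lieOp_twistedOp (hμ.lieMultiVect_modular hπ hθ))

theorem mvOp_single_apply {k m : ℕ} (h : k + m = n) (V : MultiVect A k) (ν : Form A n) :
    mvOp V (Forms.single n ν) m = interior h V ν := by
  subst h
  rw [mvOp_apply, Forms.single_same]

/-- The factor (-1)^(k + 1) in the definition of the divergence is minus the ratio of `starSign (k +
1)` and `starSign k`. -/
theorem IsVolume.isDivergence_iff (hμ : IsVolume μ)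
    (b : ∀ k, MultiVect A (k + 1) →ₗ[ℝ] MultiVect A k) :
    IsDivergence μ b ↔ ∀ k V, star μ k (b k V) = - dOp (star μ (k + 1) V) := by
  have hs : ∀ k, starSign (k + 1) = - (starSign k * (-1) ^ (k + 1)) := fun k => by
    rw [starSign]; ring
  have hd : ∀ (k m : ℕ) (h : k + 1 + m = n) (V : MultiVect A (k + 1)),
      (-dOp (star μ (k + 1) V)) (m + 1) =
        starSign k • (-1 : ℤ) ^ (k + 1) • deRham m (interior h V μ) := fun k m h V => by
    rw [Forms.neg_apply, dOp_succ, star_apply, Forms.zsmul_apply, mvOp_single_apply h, map_zsmul,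
      hs, neg_smul, neg_neg, mul_smul]
  have hb : ∀ (k m : ℕ) (h : k + m = n) (V : MultiVect A k),
      star μ k V m = starSign k • interior h V μ := fun k m h V => by
    rw [star_apply, Forms.zsmul_apply, mvOp_single_apply h]
  constructor
  · intro H k V
    ext1 m
    by_cases hm : k + m = n
    · cases m with
      | zero =>
        -- Here `k = n`. `IsDivergence` imposes nothing in this degree, but `V` has degree n + 1 and
        -- vanishes.
        have hV : V = 0 := hμ.star_injective _ (by
          ext1 j
          rw [star_eq_zero_of_ne μ (by omega), map_zero]; rfl)
        rw [hV, map_zero, map_zero, map_zero, map_zero, neg_zero]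
      | succ m =>
        rw [hd k m (by omega), hb k (m + 1) hm, H k m (by omega) hm]
    · have h1 : HasCodegree n (k + 1) (star μ (k + 1) V) := fun j hj =>
        star_eq_zero_of_ne μ hj V
      rw [star_eq_zero_of_ne μ hm, Forms.neg_apply, h1.dOp m hm, neg_zero]
  · intro H k m h h' V
    have h1 := congrArg (fun η : Forms A => starSign k • η (m + 1)) (H k V)
    simp only [hd k m h, hb k (m + 1) h', smul_smul _ _ (interior _ _ _),
      starSign_mul_self, one_smul] at h1
    rw [h1, smul_smul (starSign k), starSign_mul_self, one_smul]

theorem IsVolume.existsUnique_divergence (hμ : IsVolume μ) : ∃! b, IsDivergence μ b := by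
  have := fun k => hμ.exists_lift (j := k + 1) (k := k) (-dOp) fun η hη m hm => by
    have h1 : HasCodegree n (k + 1) η := hη
    rw [LinearMap.neg_apply, Forms.neg_apply, h1.dOp m hm, neg_zero]
  choose b hb using this
  refine ⟨b, (hμ.isDivergence_iff b).2 hb, fun b' hb' => ?_⟩
  funext k
  ext1 V
  refine hμ.star_injective _ ?_
  rw [(hμ.isDivergence_iff b').1 hb', hb]
  rfl

/-- Separate because the family `b` has no member on functions; the missing term corresponds to
d(fμ) = 0. -/
theorem IsVolume.homotopy_zero (hμ : IsVolume μ) (hθ : IsModularVectorField π μ θ)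
    {δ : ∀ k, MultiVect A k →ₗ[ℝ] MultiVect A (k + 1)}
    (hδ : ∀ k V, star μ (k + 1) (δ k V) = twistedOp π θ N (star μ k V))
    {b : ∀ k, MultiVect A (k + 1) →ₗ[ℝ] MultiVect A k} (hb : IsDivergence μ b)
    (V : MultiVect A 0) : b 0 (δ 0 V) = (1 - (N : ℝ)) • (lieMultiVect θ 0).op V := by
  have hb := (hμ.isDivergence_iff b).1 hb
  have h := congrArg (fun T : FormOp A => T (star μ 0 V))
    (dOp_twistedOp (π := π) (θ := θ) (N := N))
  have h0 : dOp (star μ 0 V) = 0 := by rw [star_zero, Forms.smul_single, hμ.dOp_top]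
  simp only [Module.End.mul_apply, LinearMap.add_apply, LinearMap.smul_apply, h0, map_zero,
    add_zero] at h
  refine hμ.star_injective _ ?_
  rw [hb, hδ, (star μ 0).map_smul_of_tower, ← hμ.lieOp_star hθ, h]
  module

theorem IsVolume.homotopy_succ (hμ : IsVolume μ) (hθ : IsModularVectorField π μ θ)
    {δ : ∀ k, MultiVect A k →ₗ[ℝ] MultiVect A (k + 1)}
    (hδ : ∀ k V, star μ (k + 1) (δ k V) = twistedOp π θ N (star μ k V))
    {b : ∀ k, MultiVect A (k + 1) →ₗ[ℝ] MultiVect A k} (hb : IsDivergence μ b) (k : ℕ)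
    (V : MultiVect A (k + 1)) :
    b (k + 1) (δ (k + 1) V) + δ k (b k V) = (1 - (N : ℝ)) • (lieMultiVect θ (k + 1)).op V := by
  have hb := (hμ.isDivergence_iff b).1 hb
  have h := congrArg (fun T : FormOp A => T (star μ (k + 1) V))
    (dOp_twistedOp (π := π) (θ := θ) (N := N))
  simp only [Module.End.mul_apply, LinearMap.add_apply, LinearMap.smul_apply] at h
  refine hμ.star_injective _ ?_
  rw [map_add, hb, hδ, hδ, hb, (star μ (k + 1)).map_smul_of_tower, ← hμ.lieOp_star hθ, map_neg,
    ← neg_add, h]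
  module

end Twisted

/-! ### Action of a chain map on cohomology, and change of coefficients. -/

section CohomologyAction

variable {C : ℕ → Type*} [∀ k, AddCommGroup (C k)] [∀ k, Module ℝ (C k)]

theorem exists_cohomology_action (d : ∀ k, C k →ₗ[ℝ] C (k + 1)) (L : ∀ k, C k →ₗ[ℝ] C k)
    (hL : ∀ k c, L (k + 1) (d k c) = d k (L k c)) (k : ℕ) :
    ∃ T : Cohomology d k →ₗ[ℝ] Cohomology d k,
      (∀ z : LinearMap.ker (d k), ∃ hz : L k z ∈ LinearMap.ker (d k),
        T (Submodule.Quotient.mk z) = Submodule.Quotient.mk ⟨_, hz⟩) ∧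
      ((∀ z ∈ LinearMap.ker (d k), L k z ∈ coboundaries d k) → T = 0) := by
  have hker : ∀ z ∈ LinearMap.ker (d k), L k z ∈ LinearMap.ker (d k) := fun z hz => by
    rw [LinearMap.mem_ker, ← hL, LinearMap.mem_ker.1 hz, map_zero]
  have hcob : ∀ z ∈ coboundaries d k, L k z ∈ coboundaries d k := by
    cases k with
    | zero =>
      intro z hz
      rw [(Submodule.mem_bot ℝ).1 hz, map_zero]
      exact Submodule.zero_mem _
    | succ k =>
      rintro _ ⟨c, rfl⟩
      exact ⟨L k c, (hL k c).symm⟩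
  refine ⟨Submodule.mapQ _ _ ((L k).restrict hker) fun z hz => hcob _ hz,
    fun z => ⟨hker z z.2, rfl⟩, fun h => ?_⟩
  refine LinearMap.ext fun q => ?_
  obtain ⟨z, rfl⟩ := Submodule.Quotient.mk_surjective _ q
  exact (Submodule.Quotient.mk_eq_zero _).2 (h z z.2)

end CohomologyAction

section CeMap

theorem ceFormula_map {L M M' : Type*} [AddCommGroup M] [AddCommGroup M'] (br : L → L → L)
    (D : L → M → M) (D' : L → M' → M') (g : M →+ M') (hD : ∀ a m, D' a (g m) = g (D a m)) (k : ℕ)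
    (c : (Fin k → L) → M) (v : Fin (k + 1) → L) :
    ceFormula br D' k (fun w => g (c w)) v = g (ceFormula br D k c v) := by
  cases k with
  | zero => exact hD _ _
  | succ k => simp only [ceFormula, map_sub, map_sum, map_zsmul, hD]

end CeMap

/-! ### Powers of the canonical bundle, trivialized by the volume form. -/

section LineBundle

variable {A : Type*} [CommRing A] [Algebra ℝ A] {n : ℕ}

theorem DerOver.tpow_tprod {X : Derivation ℝ A A} {K : Type*} [AddCommGroup K] [Module A K]
    [Module ℝ K] [IsScalarTower ℝ A K] (T : DerOver X K) (m : ℕ) (v : Fin m → K) :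
    (T.tpow m).op (PiTensorProduct.tprod A v) =
      ∑ i, PiTensorProduct.tprod A (Function.update v i (T.op (v i))) := by
  have h : (T.tpow m).op (PiTensorProduct.tprod A v) = X 1 • PiTensorProduct.tprod A v +
      (1 : A) • ∑ i, PiTensorProduct.tprod A (Function.update v i (T.op (v i))) := rfl
  rw [h, one_smul, Derivation.map_one_eq_zero, zero_smul, zero_add]

theorem DerOver.tpow_const {X : Derivation ℝ A A} {K : Type*} [AddCommGroup K] [Module A K]
    [Module ℝ K] [IsScalarTower ℝ A K] (T : DerOver X K) (m : ℕ) {μ : K} {c : A}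
    (h : T.op μ = c • μ) :
    (T.tpow m).op (PiTensorProduct.tprod A fun _ => μ) =
      (m * c) • PiTensorProduct.tprod A fun _ => μ := by
  rw [T.tpow_tprod]
  simp only [h, MultilinearMap.map_update_smul, Function.update_eq_self, Finset.sum_const,
    Finset.card_univ, Fintype.card_fin]
  rw [mul_smul, Nat.cast_smul_eq_nsmul]

namespace IsVolume

variable {μ : Form A n}

theorem coeff_vol (hμ : IsVolume μ) : hμ.coeff μ = 1 :=
  hμ.smul_cancel (by rw [hμ.coeff_smul, one_smul])

theorem exists_smul_tprod (hμ : IsVolume μ) (m : ℕ) (t : ⨂[A]^m (Form A n)) :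
    ∃ a : A, t = a • PiTensorProduct.tprod A fun _ : Fin m => μ := by
  induction t using PiTensorProduct.induction_on with
  | smul_tprod r v =>
    refine ⟨r * ∏ i, hμ.coeff (v i), ?_⟩
    have h := (PiTensorProduct.tprod A).map_smul_univ (fun i => hμ.coeff (v i)) (fun _ => μ)
    simp only [hμ.coeff_smul] at h
    rw [mul_smul, ← h]
  | add x y hx hy =>
    obtain ⟨a, rfl⟩ := hx
    obtain ⟨b, rfl⟩ := hy
    exact ⟨a + b, (add_smul _ _ _).symm⟩

/-- The coefficient of a tensor with respect to `μ^{⊗ m}`. -/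
def tensorCoeff (hμ : IsVolume μ) (m : ℕ) : Module.Dual A (⨂[A]^m (Form A n)) :=
  PiTensorProduct.lift ((MultilinearMap.mkPiAlgebra A (Fin m) A).compLinearMap fun _ => hμ.coeff)

theorem tensorCoeff_tprod (hμ : IsVolume μ) (m : ℕ) :
    hμ.tensorCoeff m (PiTensorProduct.tprod A fun _ => μ) = 1 := by
  simp [tensorCoeff, hμ.coeff_vol]

theorem dual_ext (hμ : IsVolume μ) {m : ℕ} {φ ψ : Module.Dual A (⨂[A]^m (Form A n))}
    (h : φ (PiTensorProduct.tprod A fun _ => μ) = ψ (PiTensorProduct.tprod A fun _ => μ)) :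
    φ = ψ := by
  refine LinearMap.ext fun t => ?_
  obtain ⟨a, rfl⟩ := hμ.exists_smul_tprod m t
  rw [map_smul, map_smul, h]

theorem existsUnique_volumePower (hμ : IsVolume μ) (N : ℤ) : ∃! s, IsVolumePower μ N s := by
  cases N with
  | ofNat m => exact existsUnique_eq
  | negSucc m =>
    exact ⟨hμ.tensorCoeff (m + 1), hμ.tensorCoeff_tprod (m + 1), fun φ hφ =>
      hμ.dual_ext (φ := φ) (ψ := hμ.tensorCoeff (m + 1))
        (Eq.trans hφ (hμ.tensorCoeff_tprod (m + 1)).symm)⟩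

theorem bijective_smul_volumePower (hμ : IsVolume μ) {N : ℤ} {s : LinePow A (Form A n) N}
    (hs : IsVolumePower μ N s) : Function.Bijective fun a : A => a • s := by
  cases N with
  | ofNat m =>
    obtain rfl : s = PiTensorProduct.tprod A fun _ => μ := hs
    refine ⟨fun a b h => ?_, fun t => ?_⟩
    · have h := congrArg (hμ.tensorCoeff m) h
      have h1 : ∀ a : A, hμ.tensorCoeff m (a • PiTensorProduct.tprod A fun _ => μ) = a := fun a => by
        rw [map_smul, tensorCoeff_tprod, smul_eq_mul, mul_one]
      exact (h1 a).symm.trans (h.trans (h1 b))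
    · obtain ⟨a, ha⟩ := hμ.exists_smul_tprod m t
      exact ⟨a, ha.symm⟩
  | negSucc m =>
    change Module.Dual A (⨂[A]^(m + 1) (Form A n)) at s
    have hs : s (PiTensorProduct.tprod A fun _ => μ) = 1 := hs
    have h1 : ∀ a : A, (a • s) (PiTensorProduct.tprod A fun _ => μ) = a := fun a => by
      rw [LinearMap.smul_apply, hs, smul_eq_mul, mul_one]
    refine ⟨fun a b h => ?_, fun φ => ?_⟩
    · have h := congrArg (fun φ : Module.Dual A (⨂[A]^(m + 1) (Form A n)) =>
        φ (PiTensorProduct.tprod A fun _ => μ)) h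
      exact (h1 a).symm.trans (h.trans (h1 b))
    · exact ⟨(show Module.Dual A (⨂[A]^(m + 1) (Form A n)) from φ)
        (PiTensorProduct.tprod A fun _ => μ), hμ.dual_ext (h1 _)⟩

theorem linePow_volumePower (hμ : IsVolume μ) {N : ℤ} {s : LinePow A (Form A n) N}
    (hs : IsVolumePower μ N s) {X : Derivation ℝ A A} (T : DerOver X (Form A n)) {c : A}
    (h : T.op μ = c • μ) : (T.linePow N).op s = (N * c) • s := by
  cases N with
  | ofNat m =>
    obtain rfl : s = PiTensorProduct.tprod A fun _ => μ := hs
    have hm : (m : A) = ((Int.ofNat m : ℤ) : A) := (Int.cast_natCast m).symm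
    exact (T.tpow_const m h).trans
      (congrArg (fun r : A => (r * c) • PiTensorProduct.tprod A fun _ : Fin m => μ) hm)
  | negSucc m =>
    change Module.Dual A (⨂[A]^(m + 1) (Form A n)) at s
    have hs : s (PiTensorProduct.tprod A fun _ => μ) = 1 := hs
    refine hμ.dual_ext ?_
    -- The first term is X(1) = 0; the second gives -(m + 1) c, and `Int.negSucc m` is -(m + 1).
    change X (s (PiTensorProduct.tprod A fun _ => μ)) -
      s ((T.tpow (m + 1)).op (PiTensorProduct.tprod A fun _ => μ)) =
      ((Int.negSucc m : ℤ) * c : A) • s (PiTensorProduct.tprod A fun _ => μ)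
    rw [T.tpow_const (m + 1) h, map_smul, hs]
    simp
    ring

theorem linePow_smul_volumePower (hμ : IsVolume μ) {N : ℤ} {s : LinePow A (Form A n) N}
    (hs : IsVolumePower μ N s) {X : Derivation ℝ A A} (T : DerOver X (Form A n)) {c : A}
    (h : T.op μ = c • μ) (f : A) : (T.linePow N).op (f • s) = (X f + N • (c * f)) • s := by
  rw [DerOver.op_smul, hμ.linePow_volumePower hs T h, smul_smul, ← add_smul]
  congr 1
  rw [zsmul_eq_mul]
  ring

theorem bijective_smulRight (hμ : IsVolume μ) {N : ℤ} {s : LinePow A (Form A n) N}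
    (hs : IsVolumePower μ N s) (k : ℕ) :
    Function.Bijective fun V : MultiVect A k => V.smulRight s := by
  have hb := hμ.bijective_smul_volumePower hs
  refine ⟨fun V W h => ?_, fun φ => ?_⟩
  · ext1 ξ
    exact hb.1 (LinearMap.congr_fun h ξ)
  · let e := LinearEquiv.ofBijective (LinearMap.toSpanSingleton A (LinePow A (Form A n) N) s) hb
    refine ⟨e.symm ∘ₗ φ, ?_⟩
    ext1 ξ
    exact e.apply_symm_apply (φ ξ)

/-- The isomorphism `V ↦ V ⊗ μ^N` from multivector fields to cochains. -/
def toCochain (hμ : IsVolume μ) {N : ℤ} {s : LinePow A (Form A n) N}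
    (hs : IsVolumePower μ N s) (k : ℕ) : MultiVect A k ≃ₗ[ℝ] Cochain A n N k :=
  LinearEquiv.ofBijective
    { toFun := fun V => V.smulRight s
      map_add' := fun V W => by ext1 ξ; exact add_smul (V ξ) (W ξ) s
      map_smul' := fun r V => by ext1 ξ; exact smul_assoc r (V ξ) s }
    (hμ.bijective_smulRight hs k)

theorem toCochain_apply (hμ : IsVolume μ) {N : ℤ} {s : LinePow A (Form A n) N}
    (hs : IsVolumePower μ N s) {k : ℕ} (V : MultiVect A k) :
    hμ.toCochain hs k V = V.smulRight s := rfl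

variable {π : MultiVect A 2} {θ : Vect A} {N : ℤ} {s : LinePow A (Form A n) N}

theorem ceFormula_smulRight (hμ : IsVolume μ) (hθ : IsModularVectorField π μ θ)
    (hs : IsVolumePower μ N s) {k : ℕ} (V : MultiVect A k) (α : Fin (k + 1) → OneForm A) :
    ceFormula (koszulBracket π) (fun β => ((canonicalRep π n β).linePow N).op) k
      (fun γ => V.smulRight s (wedge γ)) α =
    ceFormula (koszulBracket π) (fun β => twistedRep π θ N β) k (fun γ => V (wedge γ)) α • s :=
  ceFormula_map (koszulBracket π) (fun β => twistedRep π θ N β)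
    (fun β => ((canonicalRep π n β).linePow N).op)
    ((LinearMap.toSpanSingleton A (LinePow A (Form A n) N) s : A →ₗ[A] _) : A →+ _)
    (fun β f => hμ.linePow_smul_volumePower hs (canonicalRep π n β) (hθ β) f) k _ α

/-- Since L_θ μ = 0, the factor μ^N is invariant under L_θ. -/
theorem lieCochain_smulRight (hμ : IsVolume μ) (hθ : IsModularVectorField π μ θ)
    (hs : IsVolumePower μ N s) {k : ℕ} (V : MultiVect A k) :
    (lieCochain θ n N k).op (V.smulRight s) = ((lieMultiVect θ k).op V).smulRight s := by
  ext1 ξ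
  change ((lieForm θ n).linePow N).op (V ξ • s) - V ((lieForm θ k).op ξ) • s =
    (θ (V ξ) - V ((lieForm θ k).op ξ)) • s
  rw [hμ.linePow_smul_volumePower hs (lieForm θ n) (c := 0)
    (by rw [hμ.lieForm_modular hθ, zero_smul]), zero_mul, smul_zero, add_zero, sub_smul]

theorem isAlgebroidDifferential_of (hμ : IsVolume μ) (hθ : IsModularVectorField π μ θ)
    (hs : IsVolumePower μ N s) {δ : ∀ k, MultiVect A k →ₗ[ℝ] MultiVect A (k + 1)}
    (hδ : ∀ k V, star μ (k + 1) (δ k V) = twistedOp π θ N (star μ k V))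
    {d : ∀ k, Cochain A n N k →ₗ[ℝ] Cochain A n N (k + 1)}
    (hd : ∀ k V, d k (hμ.toCochain hs k V) = hμ.toCochain hs (k + 1) (δ k V)) :
    IsAlgebroidDifferential π n N d := by
  intro k φ α
  obtain ⟨V, rfl⟩ := (hμ.toCochain hs k).surjective φ
  rw [hd, toCochain_apply, toCochain_apply, hμ.ceFormula_smulRight hθ hs, ← hμ.delta_wedge hθ hδ]
  rfl

/-- The formula fixes the values on wedge products of exact one-forms, and by `Framed.multiVect_ext`
these determine a cochain. -/
theorem algebroidDifferential_unique (hμ : IsVolume μ)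
    (hs : IsVolumePower μ N s) {d d' : ∀ k, Cochain A n N k →ₗ[ℝ] Cochain A n N (k + 1)}
    (hd : IsAlgebroidDifferential π n N d) (hd' : IsAlgebroidDifferential π n N d') : d = d' := by
  funext k
  ext1 φ
  obtain ⟨V, hV⟩ := (hμ.toCochain hs (k + 1)).surjective (d k φ)
  obtain ⟨W, hW⟩ := (hμ.toCochain hs (k + 1)).surjective (d' k φ)
  rw [← hV, ← hW]
  congr 1
  refine hμ.framed.multiVect_ext fun f => (hμ.bijective_smul_volumePower hs).1 ?_
  have h := (hd k φ fun i => dFun (f i)).trans (hd' k φ fun i => dFun (f i)).symm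
  rw [← hV, ← hW] at h
  exact h

theorem existsUnique_algebroidDifferential (hμ : IsVolume μ) (π : MultiVect A 2) (N : ℤ) :
    ∃! d, IsAlgebroidDifferential π n N d := by
  obtain ⟨θ, hθ, -⟩ := hμ.existsUnique_modularVectorField π
  obtain ⟨s, hs, -⟩ := hμ.existsUnique_volumePower N
  obtain ⟨δ, hδ⟩ := hμ.exists_delta π θ N
  refine ⟨fun k => (hμ.toCochain hs (k + 1)).toLinearMap ∘ₗ δ k ∘ₗ
    (hμ.toCochain hs k).symm.toLinearMap, ?_, fun d hd => ?_⟩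
  · exact hμ.isAlgebroidDifferential_of hθ hs hδ fun k V =>
      congrArg (fun W => hμ.toCochain hs (k + 1) (δ k W)) ((hμ.toCochain hs k).symm_apply_apply V)
  · exact hμ.algebroidDifferential_unique hs hd (hμ.isAlgebroidDifferential_of hθ hs hδ fun k V =>
      congrArg (fun W => hμ.toCochain hs (k + 1) (δ k W)) ((hμ.toCochain hs k).symm_apply_apply V))

theorem exists_delta_smulRight (hμ : IsVolume μ) (hθ : IsModularVectorField π μ θ)
    (hs : IsVolumePower μ N s) {d : ∀ k, Cochain A n N k →ₗ[ℝ] Cochain A n N (k + 1)}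
    (hd : IsAlgebroidDifferential π n N d) :
    ∃ δ : ∀ k, MultiVect A k →ₗ[ℝ] MultiVect A (k + 1),
      (∀ k V, (δ k V).smulRight s = d k (V.smulRight s)) ∧
      ∀ k V, star μ (k + 1) (δ k V) = twistedOp π θ N (star μ k V) := by
  obtain ⟨δ, hδ⟩ := hμ.exists_delta π θ N
  refine ⟨δ, fun k V => ?_, hδ⟩
  have h := hμ.algebroidDifferential_unique hs hd (hμ.isAlgebroidDifferential_of hθ hs hδ
    (d := fun k => (hμ.toCochain hs (k + 1)).toLinearMap ∘ₗ δ k ∘ₗ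
      (hμ.toCochain hs k).symm.toLinearMap) fun k V =>
      congrArg (fun W => hμ.toCochain hs (k + 1) (δ k W)) ((hμ.toCochain hs k).symm_apply_apply V))
  rw [h]
  exact congrArg (fun W => hμ.toCochain hs (k + 1) (δ k W))
    ((hμ.toCochain hs k).symm_apply_apply V).symm

theorem lieCochain_differential (hμ : IsVolume μ) (hπ : IsPoisson π)
    (hθ : IsModularVectorField π μ θ) (hs : IsVolumePower μ N s)
    {d : ∀ k, Cochain A n N k →ₗ[ℝ] Cochain A n N (k + 1)}
    (hd : IsAlgebroidDifferential π n N d) (k : ℕ) (φ : Cochain A n N k) :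
    (lieCochain θ n N (k + 1)).op (d k φ) = d k ((lieCochain θ n N k).op φ) := by
  obtain ⟨δ, h1, h2⟩ := hμ.exists_delta_smulRight hθ hs hd
  obtain ⟨V, rfl⟩ := (hμ.bijective_smulRight hs k).2 φ
  change (lieCochain θ n N (k + 1)).op (d k (V.smulRight s)) =
    d k ((lieCochain θ n N k).op (V.smulRight s))
  rw [← h1, hμ.lieCochain_smulRight hθ hs, hμ.lieCochain_smulRight hθ hs, ← h1,
    hμ.lie_delta hπ hθ h2]

theorem lieCochain_mem_coboundaries (hμ : IsVolume μ) (hθ : IsModularVectorField π μ θ)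
    (hs : IsVolumePower μ N s) {d : ∀ k, Cochain A n N k →ₗ[ℝ] Cochain A n N (k + 1)}
    (hd : IsAlgebroidDifferential π n N d) (hN : N ≠ 1) (k : ℕ) (z : Cochain A n N k)
    (hz : z ∈ LinearMap.ker (d k)) : (lieCochain θ n N k).op z ∈ coboundaries d k := by
  obtain ⟨δ, h1, h2⟩ := hμ.exists_delta_smulRight hθ hs hd
  obtain ⟨b, hb, -⟩ := hμ.existsUnique_divergence
  have hN' : (1 - (N : ℝ)) ≠ 0 := sub_ne_zero.2 (by exact_mod_cast hN.symm)
  obtain ⟨V, rfl⟩ := (hμ.bijective_smulRight hs k).2 z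
  change V.smulRight s ∈ LinearMap.ker (d k) at hz
  change (lieCochain θ n N k).op (V.smulRight s) ∈ coboundaries d k
  have hV : δ k V = 0 := (hμ.bijective_smulRight hs (k + 1)).1 (by
    change (δ k V).smulRight s = (0 : MultiVect A (k + 1)).smulRight s
    rw [h1, LinearMap.mem_ker.1 hz]
    ext1 ξ
    exact (zero_smul A s).symm)
  rw [hμ.lieCochain_smulRight hθ hs]
  cases k with
  | zero =>
    have h := hμ.homotopy_zero hθ h2 hb V
    rw [hV, map_zero] at h
    rw [(smul_eq_zero.1 h.symm).resolve_left hN']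
    convert Submodule.zero_mem _
    ext1 ξ
    exact zero_smul A s
  | succ k =>
    have h := hμ.homotopy_succ hθ h2 hb k V
    rw [hV, map_zero, zero_add] at h
    -- On a cocycle the homotopy identity reads δ b V = (1 - N) L_θ V, so b V divided by 1 - N is a
    -- primitive.
    refine ⟨(1 - (N : ℝ))⁻¹ • (b k V).smulRight s, ?_⟩
    rw [map_smul, ← h1, h]
    ext1 ξ
    change (1 - (N : ℝ))⁻¹ • ((1 - (N : ℝ)) • (lieMultiVect θ (k + 1)).op V ξ) • s = _
    rw [smul_assoc, smul_smul, inv_mul_cancel₀ hN', one_smul]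
    rfl

end IsVolume
end LineBundle

/-! ### Hadamard's lemma. -/

section Hadamard

/-- The integral is the value at 0 of the convolution of the indicator of (0, 1] with u ↦ ψ(u) F(x,
-u). The bump ψ equals 1 on [-1, 1], so it changes nothing there and makes the support compact. -/
theorem contDiff_intervalIntegral {E : Type*} [NormedAddCommGroup E] [NormedSpace ℝ E]
    {F : E × ℝ → ℝ} (hF : ContDiff ℝ ∞ F) :
    ContDiff ℝ ∞ fun x => ∫ t in (0 : ℝ)..1, F (x, t) := by
  let ψ : ContDiffBump (0 : ℝ) := ⟨1, 2, one_pos, one_lt_two⟩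
  have key := MeasureTheory.contDiffOn_convolution_right_with_param_comp (n := ⊤) (𝕜 := ℝ)
    (μ := MeasureTheory.volume) (ContinuousLinearMap.mul ℝ ℝ) (s := (Set.univ : Set E))
    (v := fun _ => (0 : ℝ)) contDiffOn_const (f := (Set.Ioc (0 : ℝ) 1).indicator fun _ => 1)
    (g := fun x u => ψ u * F (x, -u)) (k := Metric.closedBall 0 2) isOpen_univ
    (isCompact_closedBall 0 2)
    (fun x u _ hu => by
      rw [ψ.zero_of_le_dist (not_le.1 hu).le, zero_mul])
    ((MeasureTheory.integrable_indicator_iff measurableSet_Ioc).2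
      (by simp)).locallyIntegrable
    (by
      refine ContDiff.contDiffOn ?_
      exact (ψ.contDiff.comp contDiff_snd).mul
        (hF.comp (contDiff_fst.prodMk contDiff_snd.neg)))
  rw [contDiffOn_univ] at key
  convert key using 1
  funext x
  rw [MeasureTheory.convolution_def, intervalIntegral.integral_of_le zero_le_one,
    ← MeasureTheory.integral_indicator measurableSet_Ioc]
  congr 1
  funext t
  by_cases ht : t ∈ Set.Ioc (0 : ℝ) 1
  · have h1 : ψ (0 - t) = 1 := ψ.one_of_mem_closedBall (by
      simp only [zero_sub, mem_closedBall_zero_iff, norm_neg, Real.norm_eq_abs]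
      rw [abs_of_pos ht.1]; exact ht.2)
    simp [Set.indicator_of_mem ht, show ψ (-t) = 1 by simpa using h1]
  · simp [Set.indicator_of_notMem ht]

variable {n : ℕ}

/-- Hadamard's lemma. -/
theorem hadamard {G : EuclideanSpace ℝ (Fin n) → ℝ} (hG : ContDiff ℝ ∞ G)
    (y₀ : EuclideanSpace ℝ (Fin n)) :
    ∃ H : Fin n → EuclideanSpace ℝ (Fin n) → ℝ, (∀ i, ContDiff ℝ ∞ (H i)) ∧
      (∀ y, G y = G y₀ + ∑ i, (y i - y₀ i) * H i y) ∧
      ∀ i, H i y₀ = fderiv ℝ G y₀ (EuclideanSpace.single i 1) := by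
  have hG' : ContDiff ℝ ∞ (fderiv ℝ G) := hG.fderiv_right (by simp)
  have hF : ∀ i, ContDiff ℝ ∞ fun q : EuclideanSpace ℝ (Fin n) × ℝ =>
      fderiv ℝ G (y₀ + q.2 • (q.1 - y₀)) (EuclideanSpace.single i 1) := fun i => by
    refine ContDiff.clm_apply (hG'.comp ?_) contDiff_const
    exact contDiff_const.add (contDiff_snd.smul (contDiff_fst.sub contDiff_const))
  refine ⟨fun i y => ∫ t in (0 : ℝ)..1,
    fderiv ℝ G (y₀ + t • (y - y₀)) (EuclideanSpace.single i 1),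
    fun i => contDiff_intervalIntegral (hF i), fun y => ?_, fun i => by simp⟩
  -- Integrate the derivative along the segment from `y₀` to `y`.
  have hd : ∀ t : ℝ, HasDerivAt (fun t : ℝ => G (y₀ + t • (y - y₀)))
      (∑ i, (y i - y₀ i) * fderiv ℝ G (y₀ + t • (y - y₀)) (EuclideanSpace.single i 1)) t := by
    intro t
    have h1 : HasDerivAt (fun t : ℝ => y₀ + t • (y - y₀)) (y - y₀) t := by
      simpa using ((hasDerivAt_id t).smul_const (y - y₀)).const_add y₀
    have h2 := ((hG.differentiable (by simp)) (y₀ + t • (y - y₀))).hasFDerivAt.comp_hasDerivAt t h1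
    have h3 : y - y₀ = ∑ i, (y i - y₀ i) • EuclideanSpace.single i (1 : ℝ) := by
      have := (EuclideanSpace.basisFun (Fin n) ℝ).sum_repr (y - y₀)
      simpa using this.symm
    have h4 : fderiv ℝ G (y₀ + t • (y - y₀)) (y - y₀) =
        ∑ i, (y i - y₀ i) * fderiv ℝ G (y₀ + t • (y - y₀)) (EuclideanSpace.single i 1) := by
      nth_rw 2 [h3]
      simp [map_sum]
    rwa [h4] at h2
  have hc : ∀ i, Continuous fun t : ℝ =>
      fderiv ℝ G (y₀ + t • (y - y₀)) (EuclideanSpace.single i 1) := fun i =>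
    (hF i).continuous.comp (continuous_const.prodMk continuous_id)
  have hI := intervalIntegral.integral_eq_sub_of_hasDerivAt (a := 0) (b := 1)
    (fun t _ => hd t) ((continuous_finsetSum _ fun i _ =>
      continuous_const.mul (hc i)).intervalIntegrable 0 1)
  have hint : ∀ i ∈ Finset.univ, IntervalIntegrable (fun t : ℝ => (y i - y₀ i) *
      fderiv ℝ G (y₀ + t • (y - y₀)) (EuclideanSpace.single i 1)) MeasureTheory.volume 0 1 :=
    fun i _ => (continuous_const.mul (hc i)).intervalIntegrable 0 1
  rw [intervalIntegral.integral_finsetSum hint] at hI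
  simp only [intervalIntegral.integral_const_mul, one_smul, zero_smul, add_zero,
    add_sub_cancel] at hI
  rw [hI]
  ring

end Hadamard

/-! ### Bump functions, coordinates and derivations in a chart. -/

section Charts

open Topology

variable {n : ℕ} {P : Type*} [TopologicalSpace P] [ChartedSpace (EuclideanSpace ℝ (Fin n)) P]

theorem fn_sum_apply {ι : Type*} (t : Finset ι) (f : ι → Fn n P) (q : P) :
    (∑ i ∈ t, f i) q = ∑ i ∈ t, f i q :=
  map_sum (ContMDiffMap.evalRingHom q : Fn n P →+* ℝ) f t

theorem bump_eq {p : P} (ρ : SmoothBumpFunction (𝓡 n) p) {q : P} (hq : q ∈ (chartAt (EuclideanSpace ℝ (Fin n)) p).source) :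
    ρ.toContDiffBump (extChartAt (𝓡 n) p q) = ρ q := (ρ.eqOn_source hq).symm

theorem mem_source {p : P} (ρ : SmoothBumpFunction (𝓡 n) p) {q : P} (hq : ρ q = 1) : q ∈ (chartAt (EuclideanSpace ℝ (Fin n)) p).source :=
  ρ.support_subset_source (by rw [Function.mem_support, hq]; exact one_ne_zero)

/-- Where the bump function is locally `1`, it is locally `1` in the chart. -/
theorem toContDiffBump_eventually {p : P} (ρ : SmoothBumpFunction (𝓡 n) p) {q : P} (hq : ∀ᶠ x in 𝓝 q, ρ x = 1) :
    ∀ᶠ y in 𝓝 (extChartAt (𝓡 n) p q), ρ.toContDiffBump y = 1 := by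
  have hs : q ∈ (extChartAt (𝓡 n) p).source := by
    rw [extChartAt_source]; exact mem_source ρ hq.self_of_nhds
  have hc : ContinuousAt (extChartAt (𝓡 n) p).symm (extChartAt (𝓡 n) p q) :=
    continuousAt_extChartAt_symm' hs
  rw [ContinuousAt, (extChartAt (𝓡 n) p).left_inv hs] at hc
  filter_upwards [hc.eventually hq, (isOpen_extChartAt_target p).mem_nhds
    ((extChartAt (𝓡 n) p).map_source hs)] with y hy ht
  rw [← hy, ← bump_eq ρ (mem_source ρ hy), (extChartAt (𝓡 n) p).right_inv ht]

variable [IsManifold (𝓡 n) ∞ P]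

section Locality

variable [T2Space P]

/-- A smooth bump function, as an element of the algebra of functions. -/
def bump {p : P} (ρ : SmoothBumpFunction (𝓡 n) p) : Fn n P := ⟨ρ, ρ.contMDiff⟩

/-- Derivations are local: for a bump function ψ at q supported where f = g, the product ψ(f - g) is
zero, and the Leibniz rule at q gives the claim. -/
theorem derivation_congr (X : Vect (Fn n P)) {f g : Fn n P} {q : P} (h : ∀ᶠ x in 𝓝 q, f x = g x) :
    X f q = X g q := by
  obtain ⟨ψ, hψ, -⟩ := (SmoothBumpFunction.nhds_basis_support (I := 𝓡 n) h).mem_iff.1 h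
  have h0 : bump ψ * (f - g) = 0 := by
    ext x
    change ψ x * (f x - g x) = 0
    by_cases hx : f x = g x
    · rw [hx, sub_self, mul_zero]
    · have : ψ x = 0 := by
        by_contra h1
        exact hx (hψ (subset_closure h1))
      rw [this, zero_mul]
  have h1 := congrArg (fun u : Fn n P => u q) (congrArg X h0)
  rw [Derivation.leibniz, map_zero, map_sub] at h1
  change ψ q * (X f q - X g q) + (f q - g q) * X (bump ψ) q = 0 at h1
  rw [ψ.eq_one, h.self_of_nhds, sub_self, zero_mul, add_zero, one_mul] at h1
  exact sub_eq_zero.1 h1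

end Locality

theorem contDiffOn_comp_symm (p : P) (f : Fn n P) :
    ContDiffOn ℝ ∞ (fun y => f ((extChartAt (𝓡 n) p).symm y)) (extChartAt (𝓡 n) p).target :=
  contMDiffOn_iff_contDiffOn.1 (f.contMDiff.comp_contMDiffOn (contMDiffOn_extChartAt_symm p))

theorem contMDiffOn_chartDeriv (p : P) (f : Fn n P) (v : EuclideanSpace ℝ (Fin n)) :
    ContMDiffOn (𝓡 n) 𝓘(ℝ, ℝ) ∞ (fun q => fderiv ℝ (fun y => f ((extChartAt (𝓡 n) p).symm y))
      (extChartAt (𝓡 n) p q) v) (chartAt (EuclideanSpace ℝ (Fin n)) p).source := by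
  have h : ContDiffOn ℝ ∞ (fun z => fderiv ℝ (fun y => f ((extChartAt (𝓡 n) p).symm y)) z v)
      (extChartAt (𝓡 n) p).target :=
    ((contDiffOn_comp_symm p f).fderiv_of_isOpen (isOpen_extChartAt_target p) (by simp)).clm_apply
      contDiffOn_const
  refine (contMDiffOn_iff_contDiffOn.2 h).comp (contMDiffOn_extChartAt (x := p)) fun q hq => ?_
  exact (extChartAt (𝓡 n) p).map_source (by rwa [extChartAt_source])

theorem differentiableAt_comp_symm {p q : P} (hq : q ∈ (chartAt (EuclideanSpace ℝ (Fin n)) p).source)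
    (f : Fn n P) : DifferentiableAt ℝ (fun y => f ((extChartAt (𝓡 n) p).symm y))
      (extChartAt (𝓡 n) p q) :=
  ((contDiffOn_comp_symm p f).contDiffAt ((isOpen_extChartAt_target p).mem_nhds
    ((extChartAt (𝓡 n) p).map_source (by rwa [extChartAt_source])))).differentiableAt (by simp)

theorem contDiff_pushforward {p : P} (ρ : SmoothBumpFunction (𝓡 n) p) (f : Fn n P) :
    ContDiff ℝ ∞ fun y => ρ.toContDiffBump y * f ((extChartAt (𝓡 n) p).symm y) := by
  rw [contDiff_iff_contDiffAt]
  intro y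
  by_cases hy : y ∈ Metric.closedBall (extChartAt (𝓡 n) p p) ρ.rOut
  · have hy : y ∈ (extChartAt (𝓡 n) p).target := ρ.closedBall_subset ⟨hy, by simp⟩
    exact ρ.toContDiffBump.contDiff.contDiffAt.mul
      ((contDiffOn_comp_symm p f).contDiffAt ((isOpen_extChartAt_target p).mem_nhds hy))
  · have h : ∀ᶠ z in 𝓝 y, z ∈ (Metric.closedBall (extChartAt (𝓡 n) p p) ρ.rOut)ᶜ :=
      Metric.isClosed_closedBall.isOpen_compl.mem_nhds hy
    refine (contDiffAt_const (c := (0 : ℝ))).congr_of_eventuallyEq (h.mono fun z hz => ?_)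
    rw [Set.mem_compl_iff, Metric.mem_closedBall, not_le] at hz
    change ρ.toContDiffBump z * _ = 0
    rw [ρ.toContDiffBump.zero_of_le_dist hz.le, zero_mul]

variable [T2Space P] {p : P} (ρ : SmoothBumpFunction (𝓡 n) p)

/-- The coordinate functions of a chart, cut off by a bump function. -/
def cutCoord (i : Fin n) : Fn n P :=
  ⟨fun q => ρ q • extChartAt (𝓡 n) p q i, ρ.contMDiff_smul (by
    have h : ContDiff ℝ ∞ fun y : EuclideanSpace ℝ (Fin n) => y i := contDiff_piLp_apply 2
    exact h.contMDiff.comp_contMDiffOn contMDiffOn_extChartAt)⟩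

/-- The derivative in a constant direction of a chart, cut off by a bump function. -/
def cutDeriv (v : EuclideanSpace ℝ (Fin n)) : Vect (Fn n P) :=
  Derivation.mk'
    { toFun := fun f => ⟨fun q => ρ q • fderiv ℝ (fun y => f ((extChartAt (𝓡 n) p).symm y))
        (extChartAt (𝓡 n) p q) v, ρ.contMDiff_smul (contMDiffOn_chartDeriv p f v)⟩
      map_add' := fun f g => by
        ext q
        change ρ q * _ = ρ q * _ + ρ q * _
        by_cases hq : q ∈ (chartAt (EuclideanSpace ℝ (Fin n)) p).source
        · rw [← mul_add]
          congr 1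
          exact congrArg (fun L => L v) (fderiv_add (differentiableAt_comp_symm hq f)
            (differentiableAt_comp_symm hq g))
        · have h0 : ρ q = 0 := by
            by_contra h
            exact hq (ρ.support_subset_source h)
          simp [h0]
      map_smul' := fun c f => by
        ext q
        change ρ q * _ = c * (ρ q * _)
        by_cases hq : q ∈ (chartAt (EuclideanSpace ℝ (Fin n)) p).source
        · rw [mul_left_comm]
          congr 1
          exact congrArg (fun L => L v) (fderiv_const_smul (differentiableAt_comp_symm hq f) c)
        · have h0 : ρ q = 0 := by
            by_contra h
            exact hq (ρ.support_subset_source h)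
          simp [h0] }
    (fun f g => by
      ext q
      change ρ q * _ = f q * (ρ q * _) + g q * (ρ q * _)
      by_cases hq : q ∈ (chartAt (EuclideanSpace ℝ (Fin n)) p).source
      · rw [mul_left_comm (f q), mul_left_comm (g q), ← mul_add]
        congr 1
        have h := congrArg (fun L => L v) (fderiv_mul (differentiableAt_comp_symm hq f)
            (differentiableAt_comp_symm hq g))
        have hl : (extChartAt (𝓡 n) p).symm (extChartAt (𝓡 n) p q) = q :=
          (extChartAt (𝓡 n) p).left_inv (by rwa [extChartAt_source])
        simp only [hl] at h
        exact h
      · have h0 : ρ q = 0 := by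
          by_contra h
          exact hq (ρ.support_subset_source h)
        simp [h0])

theorem cutDeriv_apply (v : EuclideanSpace ℝ (Fin n)) (f : Fn n P) (q : P) :
    cutDeriv ρ v f q = ρ q * fderiv ℝ (fun y => f ((extChartAt (𝓡 n) p).symm y))
      (extChartAt (𝓡 n) p q) v := rfl

/-- By Hadamard's lemma f = f(q) + ∑ (x_i - x_i(q)) k_i near q. A derivation kills constants, and
the differences vanish at q, so only k_i(q) Y(x_i)(q) survives, with k_i(q) the partial derivative
of f. -/
theorem derivation_expand (Y : Vect (Fn n P)) (f : Fn n P) {q : P} (hq : ∀ᶠ x in 𝓝 q, ρ x = 1) :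
    Y f q = ∑ i, Y (cutCoord ρ i) q * cutDeriv ρ (EuclideanSpace.single i 1) f q := by
  set ϕ := extChartAt (𝓡 n) p
  obtain ⟨H, hH, hG, hd⟩ := hadamard (contDiff_pushforward ρ f) (ϕ q)
  let k : Fin n → Fn n P := fun i => ⟨fun x => ρ x • H i (ϕ x), ρ.contMDiff_smul
    ((hH i).contMDiff.comp_contMDiffOn contMDiffOn_extChartAt)⟩
  let c : ℝ → Fn n P := fun r => algebraMap ℝ (Fn n P) r
  have hc : ∀ r x, c r x = r := fun r x => rfl
  have hρ := hq.self_of_nhds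
  have h1 : ∀ᶠ x in 𝓝 q, f x = (c (f q) + ∑ i, (cutCoord ρ i - c (ϕ q i)) * k i : Fn n P) x := by
    filter_upwards [hq] with x hx
    have hxs := mem_source ρ hx
    have hqs := mem_source ρ hρ
    have h2 := hG (ϕ x)
    simp only [ϕ, bump_eq ρ hxs, bump_eq ρ hqs, hx, hρ, one_mul] at h2
    rw [(extChartAt (𝓡 n) p).left_inv (by rwa [extChartAt_source]),
      (extChartAt (𝓡 n) p).left_inv (by rwa [extChartAt_source])] at h2
    rw [ContMDiffMap.coe_add, Pi.add_apply, hc, h2]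
    congr 1
    rw [fn_sum_apply]
    refine Finset.sum_congr rfl fun i _ => ?_
    change _ = (ρ x * ϕ x i - ϕ q i) * (ρ x * H i (ϕ x))
    rw [hx, one_mul, one_mul]
  rw [derivation_congr Y h1, map_add, map_sum]
  have h3 : Y (c (f q)) = 0 := Y.map_algebraMap _
  rw [h3, zero_add, fn_sum_apply]
  refine Finset.sum_congr rfl fun i _ => ?_
  have h4 : Y (c (ϕ q i)) = 0 := Y.map_algebraMap _
  rw [Derivation.leibniz, map_sub, h4, sub_zero]
  change (ρ q * ϕ q i - ϕ q i) * _ + (ρ q * H i (ϕ q)) * Y (cutCoord ρ i) q = _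
  rw [hρ, one_mul, sub_self, zero_mul, zero_add, one_mul, mul_comm, hd, cutDeriv_apply, hρ, one_mul]
  congr 2
  refine Filter.EventuallyEq.fderiv_eq ?_
  filter_upwards [toContDiffBump_eventually ρ hq] with y hy
  rw [hy, one_mul]

theorem cutDeriv_cutCoord (i : Fin n) {q : P} (hq : ∀ᶠ x in 𝓝 q, ρ x = 1) :
    cutDeriv ρ (EuclideanSpace.single i 1) (cutCoord ρ i) q = 1 := by
  have hρ := hq.self_of_nhds
  have hs : q ∈ (extChartAt (𝓡 n) p).source := by
    rw [extChartAt_source]; exact mem_source ρ hρ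
  rw [cutDeriv_apply, hρ, one_mul]
  have h : (fun y => cutCoord ρ i ((extChartAt (𝓡 n) p).symm y)) =ᶠ[𝓝 (extChartAt (𝓡 n) p q)]
      fun y => EuclideanSpace.proj (𝕜 := ℝ) i y := by
    filter_upwards [toContDiffBump_eventually ρ hq, (isOpen_extChartAt_target p).mem_nhds
      ((extChartAt (𝓡 n) p).map_source hs)] with y hy ht
    have h1 : (extChartAt (𝓡 n) p).symm y ∈ (chartAt (EuclideanSpace ℝ (Fin n)) p).source := by
      rw [← extChartAt_source (𝓡 n)]
      exact (extChartAt (𝓡 n) p).map_target ht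
    change ρ ((extChartAt (𝓡 n) p).symm y) * extChartAt (𝓡 n) p ((extChartAt (𝓡 n) p).symm y) i = y i
    rw [← bump_eq ρ h1, (extChartAt (𝓡 n) p).right_inv ht, hy, one_mul]
  rw [h.fderiv_eq, ContinuousLinearMap.fderiv]
  simp

end Charts

/-! ### Frames and volume forms on a manifold. -/

section Manifold

open Topology

variable {n : ℕ} {P : Type*} [TopologicalSpace P] [ChartedSpace (EuclideanSpace ℝ (Fin n)) P]
  [IsManifold (𝓡 n) ∞ P] [T2Space P]

/-- The cut-off coordinates come from a bump ρ, while χ is a second bump supported where ρ is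
locally 1. At each point either χ vanishes or the cut-offs are invisible to derivations. -/
theorem exists_frame (p : P) : ∃ (χ : Fn n P) (x : Fin n → Fn n P) (X : Fin n → Vect (Fn n P)),
    IsFrame χ x X ∧ χ p = 1 := by
  obtain ⟨ρ⟩ : Nonempty (SmoothBumpFunction (𝓡 n) p) := inferInstance
  have h : ∀ᶠ q in 𝓝 p, ∀ᶠ x in 𝓝 q, ρ x = 1 := eventually_eventually_nhds.2 ρ.eventuallyEq_one
  obtain ⟨ψ, hψ, -⟩ := (SmoothBumpFunction.nhds_basis_support (I := 𝓡 n) h).mem_iff.1 h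
  have hχ : ∀ q, ψ q = 0 ∨ ∀ᶠ x in 𝓝 q, ρ x = 1 := fun q => by
    by_cases hq : ψ q = 0
    · exact Or.inl hq
    · exact Or.inr (hψ (subset_closure hq))
  refine ⟨bump ψ, cutCoord ρ, fun i => cutDeriv ρ (EuclideanSpace.single i 1),
    ⟨fun Y => ?_, fun i => ?_⟩, ψ.eq_one⟩
  · ext f q
    have h1 : (∑ i, Y (cutCoord ρ i) • cutDeriv ρ (EuclideanSpace.single i 1)) f q =
        ∑ i, Y (cutCoord ρ i) q * cutDeriv ρ (EuclideanSpace.single i 1) f q := by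
      rw [← Derivation.coeFnAddMonoidHom_apply, map_sum, Finset.sum_apply, fn_sum_apply]
      rfl
    change ψ q * Y f q =
      ψ q * (∑ i, Y (cutCoord ρ i) • cutDeriv ρ (EuclideanSpace.single i 1)) f q
    rcases hχ q with h0 | h0
    · rw [h0, zero_mul, zero_mul]
    · rw [h1, derivation_expand ρ Y f h0]
  · ext q
    change ψ q * cutDeriv ρ _ (cutCoord ρ i) q = ψ q
    rcases hχ q with h0 | h0
    · rw [h0, zero_mul]
    · rw [cutDeriv_cutCoord ρ i h0, mul_one]

theorem framed_fn : Framed (Fn n P) n := by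
  intro a ha
  ext p
  obtain ⟨χ, x, X, h, h1⟩ := exists_frame (n := n) p
  obtain ⟨m, hm⟩ := ha χ x X h
  have h2 := congrArg (fun u : Fn n P => u p) hm
  simpa [h1] using h2

theorem IsVolumeForm.isVolume {μ : Form (Fn n P) n} (hμ : IsVolumeForm μ) : IsVolume μ := by
  refine ⟨framed_fn, fun a b h => ?_, fun ξ => ?_⟩
  · ext p
    obtain ⟨Y, hY⟩ := hμ p
    have h1 := congrArg (fun η : Form (Fn n P) n => η Y p) h
    exact mul_right_cancel₀ hY h1
  · choose Z hZ using hμ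
    -- The quotient ξ/μ does not depend on the vectors it is evaluated on. Near `p` the fixed
    -- vectors `Z p` may thus be used, which makes the coefficient smooth.
    have key : ∀ p q, μ (Z p) q ≠ 0 → ξ (Z q) q / μ (Z q) q = ξ (Z p) q / μ (Z p) q :=
      fun p q h => by
        rw [div_eq_div_iff (hZ q) h]
        have h1 := congrArg (fun u : Fn n P => u q) (framed_fn.mul_comm_apply ξ μ (Z q) (Z p))
        exact h1.trans (mul_comm _ _)
    let g : Fn n P := ⟨fun p => ξ (Z p) p / μ (Z p) p, fun p => by
      have hc : ∀ᶠ q in 𝓝 p, μ (Z p) q ≠ 0 :=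
        (μ (Z p)).contMDiff.continuous.continuousAt.eventually_ne (hZ p)
      exact ((ξ (Z p)).contMDiff.contMDiffAt.div₀ (μ (Z p)).contMDiff.contMDiffAt
        (hZ p)).congr_of_eventuallyEq (hc.mono fun q hq => key p q hq)⟩
    refine ⟨g, ?_⟩
    ext Y q
    have h1 := congrArg (fun u : Fn n P => u q) (framed_fn.mul_comm_apply ξ μ Y (Z q))
    change ξ (Z q) q / μ (Z q) q * μ Y q = ξ Y q
    rw [div_mul_eq_mul_div, div_eq_iff (hZ q)]
    exact (h1.trans (mul_comm _ _)).symm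

end Manifold

/-! ### Assembly of the algebraic statements. -/

section ModularHomotopy

variable {A : Type*} [CommRing A] [Algebra ℝ A] {n : ℕ} {π : MultiVect A 2} {μ : Form A n}

theorem IsVolume.modular_homotopy (hμ : IsVolume μ) (hπ : IsPoisson π) {N : ℤ} {θ : Vect A}
    {b : ∀ k, MultiVect A (k + 1) →ₗ[ℝ] MultiVect A k} {s : LinePow A (Form A n) N}
    {d : ∀ k, Cochain A n N k →ₗ[ℝ] Cochain A n N (k + 1)}
    (hθ : IsModularVectorField π μ θ) (hb : IsDivergence μ b) (hs : IsVolumePower μ N s)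
    (hd : IsAlgebroidDifferential π n N d) :
    (∀ k φ, (lieCochain θ n N (k + 1)).op (d k φ) = d k ((lieCochain θ n N k).op φ)) ∧
    (∀ k, ∃ T : Cohomology d k →ₗ[ℝ] Cohomology d k,
      (∀ z : LinearMap.ker (d k),
        ∃ hz : (lieCochain θ n N k).op z ∈ LinearMap.ker (d k),
          T (Submodule.Quotient.mk z) = Submodule.Quotient.mk ⟨_, hz⟩) ∧
      (N ≠ 1 → T = 0)) ∧
    (∀ k, Function.Bijective fun V : MultiVect A k => V.smulRight s) ∧
    ∃ δ : ∀ k, MultiVect A k →ₗ[ℝ] MultiVect A (k + 1),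
      (∀ k V, (δ k V).smulRight s = d k (V.smulRight s)) ∧
      (∀ V, b 0 (δ 0 V) = (1 - (N : ℝ)) • (lieMultiVect θ 0).op V) ∧
      (∀ k V, b (k + 1) (δ (k + 1) V) + δ k (b k V) =
        (1 - (N : ℝ)) • (lieMultiVect θ (k + 1)).op V) := by
  have hL := hμ.lieCochain_differential hπ hθ hs hd
  obtain ⟨δ, hδ, hδ'⟩ := hμ.exists_delta_smulRight hθ hs hd
  refine ⟨hL, fun k => ?_, hμ.bijective_smulRight hs, δ, hδ, hμ.homotopy_zero hθ hδ' hb,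
    hμ.homotopy_succ hθ hδ' hb⟩
  obtain ⟨T, hT, hT'⟩ := exists_cohomology_action d (fun k => (lieCochain θ n N k).op) hL k
  exact ⟨T, hT, fun hN => hT' (hμ.lieCochain_mem_coboundaries hθ hs hd hN k)⟩

end ModularHomotopy

end PoissonCohomology

end

theorem mainTheorem5 {n : ℕ} {P : Type*} [TopologicalSpace P]
    [ChartedSpace (EuclideanSpace ℝ (Fin n)) P] [IsManifold (𝓡 n) ∞ P]
    [T2Space P] [SigmaCompactSpace P]
    (π : MultiVect (Fn n P) 2) (hπ : IsPoisson π)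
    (μ : Form (Fn n P) n) (hμ : IsVolumeForm μ) :
    -- the modular vector field `θ_μ` and the operator `b_μ` exist and are unique
    (∃! θ, IsModularVectorField π μ θ) ∧ (∃! b, IsDivergence μ b) ∧
    ∀ N : ℤ,
      -- the section `μ^N` and the differential `d_N` exist and are unique
      (∃! s, IsVolumePower μ N s) ∧ (∃! d, IsAlgebroidDifferential π n N d) ∧
      ∀ θ b s d, IsModularVectorField π μ θ → IsDivergence μ b → IsVolumePower μ N s →
        IsAlgebroidDifferential π n N d →
        -- `L_θ` commutes with `d_N`
        (∀ k φ, (lieCochain θ n N (k + 1)).op (d k φ) = d k ((lieCochain θ n N k).op φ)) ∧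
        -- `L_θ` acts on the cohomology, and trivially so if `N ≠ 1`
        (∀ k, ∃ T : Cohomology d k →ₗ[ℝ] Cohomology d k,
          (∀ z : LinearMap.ker (d k),
            ∃ hz : (lieCochain θ n N k).op z ∈ LinearMap.ker (d k),
              T (Submodule.Quotient.mk z) = Submodule.Quotient.mk ⟨_, hz⟩) ∧
          (N ≠ 1 → T = 0)) ∧
        -- `V ↦ V ⊗ μ^N` is an isomorphism onto the cochains, and the differential `δ_N`
        -- corresponding to `d_N` under it satisfies the homotopy identity
        (∀ k, Function.Bijective fun V : MultiVect (Fn n P) k => V.smulRight s) ∧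
        ∃ δ : ∀ k, MultiVect (Fn n P) k →ₗ[ℝ] MultiVect (Fn n P) (k + 1),
          (∀ k V, (δ k V).smulRight s = d k (V.smulRight s)) ∧
          (∀ V, b 0 (δ 0 V) = (1 - (N : ℝ)) • (lieMultiVect θ 0).op V) ∧
          (∀ k V, b (k + 1) (δ (k + 1) V) + δ k (b k V) =
            (1 - (N : ℝ)) • (lieMultiVect θ (k + 1)).op V) := by
  have hv : IsVolume μ := hμ.isVolume
  exact ⟨hv.existsUnique_modularVectorField π, hv.existsUnique_divergence, fun N =>
    ⟨hv.existsUnique_volumePower N, hv.existsUnique_algebroidDifferential π N,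
      fun _ _ _ _ hθ hb hs hd => hv.modular_homotopy hπ hθ hb hs hd⟩⟩
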